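/- Let $A=(a_{ij})$ be a generalized Cartan matrix with entries in $\{2,0,-1,-2\}$ and Dynkin diagram $\Gamma$ (distinct vertices $i,j$ are adjacent iff $a_{ij}\neq0$; a double edge points towards $i$ if $a_{ij}=-2$). Its Weyl group $W$ is generated by involutions $s_i$ subject to $s_is_j=s_js_i$ if $a_{ij}=0$, and $s_is_js_i=s_js_is_j$ (resp. $s_is_js_is_j=s_js_is_js_i$) if $a_{ij}<0$ and $a_{ij}a_{ji}=1$ (resp. $=2$). A \emph{heap} over $\Gamma$ is a locally finite poset $E$ with a labelling $\varepsilon$ of its elements by vertices of $\Gamma$ such that elements with equal or adjacent labels are comparable and $\le$ is the transitive closure of its restriction to such pairs. It is \emph{fibred} if each $\varepsilon^{-1}(p)$ is unbounded above and below and, for $p,q$ adjacent, each element labelled $p$ covers or is covered by an element labelled $q$. It is \emph{full} if moreover $\sum_{\alpha<\gamma<\beta}a_{p,\varepsilon(\gamma)}=-2$ whenever $\alpha<\beta$ are consecutive elements labelled $p$. It is \emph{periodic} if it has a nonidentity automorphism $\phi$ of labelled posets with $\phi(x)\ge x$ for all $x$, and \emph{self-dual} if it is isomorphic to its dual as a labelled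 poset. A \emph{proper ideal} is a down-closed set $I$ with $\emptyset\subsetneq I\subsetneq E$ and $\emptyset\subsetneq I\cap\varepsilon^{-1}(p)\subsetneq\varepsilon^{-1}(p)$ for all $p$; $\mathcal B$ is the set of proper ideals ordered by inclusion, and $\langle\gamma_1,\dots,\gamma_k\rangle$ is the ideal generated by $\gamma_1,\dots,\gamma_k$. Let $S_i(I)$ be the ideal obtained from $I$ by removing an element labelled $i$ if this leaves an ideal, otherwise by adding an element labelled $i$ if this gives an ideal, otherwise $S_i(I)=I$. In each of the four cases below the diagram has vertices $0,1,\dots,l$, and $E$ consists of elements $p(y)$ ($0\le p\le l$, $y\in\mathbb Z$), with $\varepsilon(p(y))=p$; it is given by its successive layers (one-element layers are written without braces), each element of a layer lying below all elements of the later layers. Then, in each case: $\bullet$ $E$ is a periodic full heap over $\Gamma$, self-dual in cases (C), (B), (D). $\bullet$ $\mathcal B$ is as described. The order on $\mathcal B$ obtained from inclusion by adding the stipulated relations (if any) is total, and there is an isomorphism of totally ordered sets $\zeta:\mathcal B\to\mathbb Z$ with the given values. $\bullet$ $s_i\mapsto S_i$ defines an action of $W$ on $\mathcal B$, and both this action and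 the action on $\mathbb Z$ that it induces through $\zeta$ are faithful. The action on $\mathbb Z$ commutes with $z\mapsto z+N$ and is given on generators by the formulas below, where congruences are modulo $N$ and integers $z$ in no listed class are fixed. \textbf{(A)} Type $A_l^{(1)}$, $l>1$: $\Gamma$ is a cycle $0,1,\dots,l$ with simple edges; $E$ is the chain $\cdots<0(0)<1(0)<\cdots<l(0)<0(1)<1(1)<\cdots$. The proper ideals are exactly the $\langle p(y)\rangle$, $\zeta(\langle p(y)\rangle)=(l+1)y+p+1$, and $N=l+1$. Here $s_i(z)=z+1$ if $z\equiv i$, and $s_i(z)=z-1$ if $z\equiv i+1$. \textbf{(C)} Type $C_l^{(1)}$, $l>1$: $\Gamma$ is $0\Rightarrow1-2-\cdots-(l-1)\Leftarrow l$; $E$ is the chain $\cdots<0(0)<1(0)<\cdots<(l-1)(0)<l(0)<(l-1)(1)<\cdots<1(1)<0(1)<1(2)<\cdots$. The proper ideals are exactly the $\langle p(y)\rangle$; $N=2l$. One has $\zeta(\langle0(y)\rangle)=2ly+1$, $\zeta(\langle l(y)\rangle)=2ly+l+1$, and for $0<p<l$, $\zeta(\langle p(y)\rangle)=ly+p+1$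 ($y$ even), $l(y+1)-p+1$ ($y$ odd). For all $j$: $$(*)\qquad s_j(z)=z+1\text{ if }z\equiv\pm j,\qquad s_j(z)=z-1\text{ if }z\equiv(\pm j)+1.$$ \textbf{(B)} Type $A_{2l-1}^{(2)}$, $l>2$: $\Gamma$ is $1-2-\cdots-(l-1)\Leftarrow l$ with $0$ joined to $2$ by a further simple edge; the layers of $E$ are $\dots,\{0(-1),1(0)\},2(0),\dots,(l-1)(0),l(0),(l-1)(1),\dots,2(1),\{0(0),1(1)\},2(2),\dots$. The proper ideals are exactly the $\langle p(y)\rangle$ and the ideals $\langle0(y),1(y+1)\rangle$, the latter being non-principal; stipulate $\langle0(y)\rangle<\langle1(y+1)\rangle$ for all $y$; $N=2l$. One has $\zeta(\langle0(y-1),1(y)\rangle)=2ly+2$, $\zeta(\langle0(y)\rangle)=2l(y+1)$, $\zeta(\langle1(y)\rangle)=2ly+1$, $\zeta(\langle l(y)\rangle)=2ly+l+1$, and for $1<p<l$, $\zeta(\langle p(y)\rangle)=ly+p+1$ ($y$ even), $l(y+1)-p+1$ ($y$ odd). For $j\ne0,1$, $s_j$ is given by $(*)$; $s_0(z)=z+1$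 if $z\equiv\pm1$ and $z-1$ if $z\equiv0$ or $2$; $s_1(z)=z+2$ if $z\equiv-1$ or $0$ and $z-2$ if $z\equiv1$ or $2$. \textbf{(D)} Type $D_l^{(1)}$, $l>3$: $\Gamma$ is $1-2-\cdots-(l-1)$ with $0$ joined to $2$ and $l$ joined to $l-2$, all edges simple; the layers of $E$ are $\dots,\{0(-1),1(0)\},2(0),\dots,(l-2)(0),\{(l-1)(0),l(0)\},(l-2)(1),\dots,2(1),\{0(0),1(1)\},2(2),\dots$. The proper ideals are exactly the $\langle p(y)\rangle$ and the ideals $\langle0(y),1(y+1)\rangle$ and $\langle(l-1)(y),l(y)\rangle$, the latter two kinds being non-principal; $\mathcal B$ is not totally ordered by inclusion; stipulate $\langle0(y)\rangle<\langle1(y+1)\rangle$ and $\langle(l-1)(y)\rangle<\langle l(y)\rangle$ for all $y$; $N=2l$. One has $\zeta(\langle0(y-1),1(y)\rangle)=2ly+2$, $\zeta(\langle(l-1)(y),l(y)\rangle)=2ly+l+2$, $\zeta(\langle0(y)\rangle)=2l(y+1)$, $\zeta(\langle1(y)\rangle)=2ly+1$, $\zeta(\langle p(y)\rangle)=2ly+p+1$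 for $p\in\{l-1,l\}$, and for $1<p<l-1$, $\zeta(\langle p(y)\rangle)=ly+p+1$ ($y$ even), $l(y+1)-p+1$ ($y$ odd). Put $c(0)=c(1)=0$, $c(l-1)=c(l)=1$. For $j\notin\{0,1,l-1,l\}$, $s_j$ is given by $(*)$; for $j\in\{0,l-1\}$, $s_j(z)=z+1$ if $z\equiv j-1+c(j)$ or $j+1+c(j)$, and $z-1$ if $z\equiv j+c(j)$ or $j+2+c(j)$; for $j\in\{1,l\}$, $s_j(z)=z+2$ if $z\equiv j-2+c(j)$ or $j-1+c(j)$, and $z-2$ if $z\equiv j+c(j)$ or $j+1+c(j)$. -/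

import Mathlib

/-! ### Generalized Cartan matrices and Weyl groups -/

/-- Generalized Cartan matrices with entries in `{2, 0, -1, -2}` (doubly laced ones). The Dynkin
diagram of `A` has vertex set `P`; distinct vertices `p`, `q` are adjacent when `A p q ≠ 0`. -/
structure IsGCM {P : Type} (A : P → P → ℤ) : Prop where
  diag : ∀ i, A i i = 2
  off_diag : ∀ i j, i ≠ j → A i j = 0 ∨ A i j = -1 ∨ A i j = -2
  zero_iff : ∀ i j, A i j = 0 ↔ A j i = 0

/-- Adjacency in the Dynkin diagram. -/
def DynkinAdj {P : Type} (A : P → P → ℤ) (p q : P) : Prop := p ≠ q ∧ A p q ≠ 0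

/-- The relation "equal or adjacent" on the vertices of the Dynkin diagram. -/
def DynkinConc {P : Type} (A : P → P → ℤ) (p q : P) : Prop := p = q ∨ DynkinAdj A p q

open FreeGroup in
/-- The defining relators of the Weyl group: a relation `u = v` is encoded as `u * v⁻¹`. -/
def weylRelators {P : Type} (A : P → P → ℤ) : Set (FreeGroup P) :=
  {r | (∃ i, r = of i * of i) ∨
    (∃ i j, A i j = 0 ∧ r = (of i * of j) * (of j * of i)⁻¹) ∨
    (∃ i j, A i j < 0 ∧ A i j * A j i = 1 ∧
      r = (of i * of j * of i) * (of j * of i * of j)⁻¹) ∨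
    (∃ i j, A i j < 0 ∧ A i j * A j i = 2 ∧
      r = (of i * of j * of i * of j) * (of j * of i * of j * of i)⁻¹)}

/-- The Weyl group of a (doubly laced) generalized Cartan matrix, by generators and relations. -/
abbrev WeylGroup {P : Type} (A : P → P → ℤ) : Type := PresentedGroup (weylRelators A)

/-- The generator `s_i` of the Weyl group. -/
def weylGen {P : Type} (A : P → P → ℤ) (i : P) : WeylGroup A := PresentedGroup.of i

/-! ### Labelled heaps, full heaps, proper ideals -/

section Heaps

variable {P E : Type} [PartialOrder E]

/-- The poset `E`, with labels `ε : E → P`, is a labelled heap over the Dynkin diagram of `A`. -/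
structure IsLabelledHeap (A : P → P → ℤ) (ε : E → P) : Prop where
  locally_finite : ∀ a b : E, (Set.Icc a b).Finite
  comparable : ∀ a b : E, DynkinConc A (ε a) (ε b) → a ≤ b ∨ b ≤ a
  le_iff : ∀ a b : E,
    a ≤ b ↔ Relation.TransGen (fun x y => x ≤ y ∧ DynkinConc A (ε x) (ε y)) a b

/-- Fibred heaps. -/
structure IsFibredHeap (A : P → P → ℤ) (ε : E → P) : Prop extends IsLabelledHeap A ε where
  nonempty : ∀ p, (ε ⁻¹' {p}).Nonempty
  unbounded_above : ∀ p, ¬ BddAbove (ε ⁻¹' {p})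
  unbounded_below : ∀ p, ¬ BddBelow (ε ⁻¹' {p})
  neighbour : ∀ p q, DynkinAdj A p q → ∀ a : E, ε a = p → ∃ b : E, ε b = q ∧ (b ⋖ a ∨ a ⋖ b)

/-- Full heaps: fibred heaps over the Dynkin diagram of a generalized Cartan matrix `A` such that
the labels strictly between two consecutive elements with label `p` satisfy `∑ A p q = -2`. -/
structure IsFullHeap (A : P → P → ℤ) (ε : E → P) : Prop extends IsFibredHeap A ε where
  gcm : IsGCM A
  sum_eq : ∀ a b : E, a < b → ε a = ε b → (∀ c ∈ Set.Ioo a b, ε c ≠ ε a) →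
    ∑ᶠ c ∈ Set.Ioo a b, A (ε a) (ε c) = -2

/-- Periodic heaps. -/
def IsPeriodicHeap (ε : E → P) : Prop :=
  ∃ φ : E ≃o E, (∀ x, ε (φ x) = ε x) ∧ (∀ x, x ≤ φ x) ∧ ∃ x, φ x ≠ x

/-- Self-dual heaps: `E` is isomorphic, as a labelled poset, to its dual. -/
def IsSelfDualHeap (ε : E → P) : Prop :=
  ∃ e : E ≃o Eᵒᵈ, ∀ x, ε (OrderDual.ofDual (e x)) = ε x

/-- Proper ideals: ideals `I` with `∅ ⊊ I ⊊ E` and `∅ ⊊ I ∩ ε⁻¹(p) ⊊ ε⁻¹(p)` for every vertex `p`. -/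
structure IsProperIdeal (ε : E → P) (I : Set E) : Prop where
  isLowerSet : IsLowerSet I
  empty_ssubset : ∅ ⊂ I
  ssubset_univ : I ⊂ Set.univ
  empty_ssubset_fibre : ∀ p, ∅ ⊂ I ∩ ε ⁻¹' {p}
  fibre_ssubset : ∀ p, I ∩ ε ⁻¹' {p} ⊂ ε ⁻¹' {p}

/-- The set `𝓑` of proper ideals, ordered by inclusion. -/
abbrev ProperIdeal (ε : E → P) : Type := {I : Set E // IsProperIdeal ε I}

/-- `L ≻ I`: the set `L` can be added to the ideal `I`. -/
def Addable (L I : Set E) : Prop := IsLowerSet (I ∪ L) ∧ I ∩ L = ∅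

/-- `L ≺ I`: the set `L` can be removed from the ideal `I`. -/
def Removable (L I : Set E) : Prop := L ⊆ I ∧ IsLowerSet (I \ L)

open Classical in
/-- `S_i(I)`: remove the element labelled `i` that can be removed from `I`, if there is one;
otherwise add the element labelled `i` that can be added to `I`, if there is one; otherwise leave
`I` as it is. (In a full heap these elements are unique when they exist.) -/
noncomputable def reflectIdeal (ε : E → P) (i : P) (I : Set E) : Set E :=
  if h : ∃ a, ε a = i ∧ Removable {a} I then I \ {h.choose}
  else if h : ∃ a, ε a = i ∧ Addable {a} I then I ∪ {h.choose}
  else I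

/-- The order on proper ideals obtained from inclusion by stipulating further relations `R`. -/
def RefinedLE (ε : E → P) (R : Set E → Set E → Prop) (I J : ProperIdeal ε) : Prop :=
  Relation.ReflTransGen (fun I' J' : ProperIdeal ε => I' ≤ J' ∨ R I'.1 J'.1) I J

/-- The assignment `s_i ↦ S_i` defines a faithful action `ρ` of the Weyl group on the set of proper
ideals. The action `σ` on `ℤ` which it induces under the identification `ζ` is faithful, is by
permutations commuting with translation by `N`, and its generators act by the formulas `s`. -/
def RealizesWeylGroup (A : P → P → ℤ) (ε : E → P) (ζ : ProperIdeal ε ≃ ℤ) (N : ℤ)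
    (s : P → ℤ → ℤ) : Prop :=
  ∃ (ρ : WeylGroup A →* Equiv.Perm (ProperIdeal ε)) (σ : WeylGroup A →* Equiv.Perm ℤ),
    (∀ i I, ((ρ (weylGen A i) I : ProperIdeal ε) : Set E) = reflectIdeal ε i I) ∧
    Function.Injective ρ ∧
    (∀ w I, σ w (ζ I) = ζ (ρ w I)) ∧
    Function.Injective σ ∧
    (∀ i z, σ (weylGen A i) z = s i z) ∧
    (∀ w z, σ w (z + N) = σ w z + N)

end Heaps

/-! ### The Cartan matrices of types `A_l^(1)`, `C_l^(1)`, `A_{2l-1}^(2)` and `D_l^(1)`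

The vertices are `0, 1, …, l`. -/

/-- Type `A_l^(1)`: a cycle with vertices `0, 1, …, l`. -/
def cartanA (l : ℕ) (i j : Fin (l + 1)) : ℤ :=
  if i = j then 2
  else if i + 1 = j ∨ j + 1 = i then -1
  else 0

/-- Type `C_l^(1)`: a path `0 ⇒ 1 - 2 - ⋯ - (l-1) ⇐ l`. -/
def cartanC (l : ℕ) (i j : Fin (l + 1)) : ℤ :=
  if i = j then 2
  else if ((i : ℕ) = 1 ∧ (j : ℕ) = 0) ∨ ((i : ℕ) + 1 = l ∧ (j : ℕ) = l) then -2
  else if (i : ℕ) + 1 = j ∨ (j : ℕ) + 1 = i then -1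
  else 0

/-- Type `A_{2l-1}^(2)`: a path `1 - 2 - ⋯ - (l-1) ⇐ l`, with `0` joined to `2`. -/
def cartanA2 (l : ℕ) (i j : Fin (l + 1)) : ℤ :=
  if i = j then 2
  else if (i : ℕ) + 1 = l ∧ (j : ℕ) = l then -2
  else if ((i : ℕ) = 0 ∧ (j : ℕ) = 2) ∨ ((i : ℕ) = 2 ∧ (j : ℕ) = 0) ∨
    (1 ≤ (i : ℕ) ∧ (i : ℕ) + 1 = j) ∨ (1 ≤ (j : ℕ) ∧ (j : ℕ) + 1 = i) then -1
  else 0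

/-- The edges `i → j` with `i < j` of the diagram of type `D_l^(1)`: a path `1 - 2 - ⋯ - (l-1)`,
with `0` joined to `2` and `l` joined to `l-2`. -/
def edgeD (l i j : ℕ) : Prop :=
  (i = 0 ∧ j = 2) ∨ (1 ≤ i ∧ i + 1 = j ∧ j < l) ∨ (i + 2 = l ∧ j = l)

open Classical in
/-- Type `D_l^(1)`. -/
noncomputable def cartanD (l : ℕ) (i j : Fin (l + 1)) : ℤ :=
  if i = j then 2
  else if edgeD l i j ∨ edgeD l j i then -1
  else 0

/-! ### The heaps

All four heaps have elements `p(y)`, where `0 ≤ p ≤ l` and `y ∈ ℤ`. They are ranked posets made of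
successive layers, with every element of a layer below every element of the next one, so that
`p(y) < q(z)` exactly when the rank of `p(y)` is less than that of `q(z)`. -/

/-- The element `p(y)` of the heap with rank function `rk`, where `p = label` and `y = index`. -/
structure HeapElt (l : ℕ) (rk : ℕ → ℤ → ℤ) : Type where
  label : Fin (l + 1)
  index : ℤ

/-- The rank of the element `p(y)`. -/
def HeapElt.rank {l : ℕ} {rk : ℕ → ℤ → ℤ} (x : HeapElt l rk) : ℤ := rk x.label x.index

instance (l : ℕ) (rk : ℕ → ℤ → ℤ) : PartialOrder (HeapElt l rk) where
  le x y := x = y ∨ x.rank < y.rank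
  lt x y := x.rank < y.rank
  le_refl x := Or.inl rfl
  le_trans x y z := by
    rintro (rfl | h) (rfl | h')
    · exact Or.inl rfl
    · exact Or.inr h'
    · exact Or.inr h
    · exact Or.inr (h.trans h')
  le_antisymm x y := by
    rintro (h | h) (h' | h')
    · exact h
    · exact h
    · exact h'.symm
    · exact absurd h' h.asymm
  lt_iff_le_not_ge x y := by
    constructor
    · intro h
      refine ⟨Or.inr h, ?_⟩
      rintro (rfl | h')
      · exact lt_irrefl _ h
      · exact h.asymm h'
    · rintro ⟨rfl | h, h'⟩
      · exact absurd (Or.inl rfl) h'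
      · exact h

/-- The element `p(y)`, for a natural number `p ≤ l`. -/
def el {l : ℕ} {rk : ℕ → ℤ → ℤ} (p : ℕ) (y : ℤ) : HeapElt l rk := ⟨Fin.ofNat (l + 1) p, y⟩

/-- The chain `⋯ < 0(0) < 1(0) < ⋯ < l(0) < 0(1) < 1(1) < ⋯`. -/
def rankA (l p : ℕ) (y : ℤ) : ℤ := (l + 1) * y + p

/-- The chain `⋯ < 0(0) < 1(0) < ⋯ < (l-1)(0) < l(0) < (l-1)(1) < ⋯ < 1(1) < 0(1) < 1(2) < ⋯`. -/
def rankC (l p : ℕ) (y : ℤ) : ℤ :=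
  if p = 0 then 2 * l * y
  else if p = l then 2 * l * y + l
  else if Even y then l * y + p
  else l * (y + 1) - p

/-- The successive layers are `⋯, {0(-1), 1(0)}, {2(0)}, …, {(l-1)(0)}, {l(0)}, {(l-1)(1)}, …,
{2(1)}, {0(0), 1(1)}, {2(2)}, ⋯`. -/
def rankA2 (l p : ℕ) (y : ℤ) : ℤ :=
  if p = 0 then 2 * (l - 1) * (y + 1)
  else if p = 1 then 2 * (l - 1) * y
  else if p = l then 2 * (l - 1) * y + (l - 1)
  else if Even y then (l - 1) * y + p - 1
  else (l - 1) * (y + 1) - p + 1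

/-- The successive layers are `⋯, {0(-1), 1(0)}, {2(0)}, …, {(l-2)(0)}, {(l-1)(0), l(0)},
{(l-2)(1)}, …, {2(1)}, {0(0), 1(1)}, {2(2)}, ⋯`. -/
def rankD (l p : ℕ) (y : ℤ) : ℤ :=
  if p = 0 then 2 * (l - 2) * (y + 1)
  else if p = 1 then 2 * (l - 2) * y
  else if p + 1 = l ∨ p = l then 2 * (l - 2) * y + (l - 2)
  else if Even y then (l - 2) * y + p - 1
  else (l - 2) * (y + 1) - p + 1

abbrev HeapA (l : ℕ) : Type := HeapElt l (rankA l)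
abbrev HeapC (l : ℕ) : Type := HeapElt l (rankC l)
abbrev HeapA2 (l : ℕ) : Type := HeapElt l (rankA2 l)
abbrev HeapD (l : ℕ) : Type := HeapElt l (rankD l)

def labelA (l : ℕ) : HeapA l → Fin (l + 1) := HeapElt.label
def labelC (l : ℕ) : HeapC l → Fin (l + 1) := HeapElt.label
def labelA2 (l : ℕ) : HeapA2 l → Fin (l + 1) := HeapElt.label
def labelD (l : ℕ) : HeapD l → Fin (l + 1) := HeapElt.label

/-! ### The integers attached to the principal ideals `⟨p(y)⟩` -/

def zetaA (l p : ℕ) (y : ℤ) : ℤ := (l + 1) * y + p + 1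

def zetaC (l p : ℕ) (y : ℤ) : ℤ :=
  if p = 0 then 2 * l * y + 1
  else if p = l then 2 * l * y + l + 1
  else if Even y then l * y + p + 1
  else l * (y + 1) - p + 1

def zetaA2 (l p : ℕ) (y : ℤ) : ℤ :=
  if p = 0 then 2 * l * (y + 1)
  else if p = 1 then 2 * l * y + 1
  else if p = l then 2 * l * y + l + 1
  else if Even y then l * y + p + 1
  else l * (y + 1) - p + 1

def zetaD (l p : ℕ) (y : ℤ) : ℤ :=
  if p = 0 then 2 * l * (y + 1)
  else if p = 1 then 2 * l * y + p
  else if p + 1 = l ∨ p = l then 2 * l * y + p + 1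
  else if Even y then l * y + p + 1
  else l * (y + 1) - p + 1

/-! ### The formulas for the action of `s_j` on `ℤ` -/

def stepA (l : ℕ) (j : Fin (l + 1)) (z : ℤ) : ℤ :=
  if z ≡ (j : ℤ) [ZMOD (l + 1)] then z + 1
  else if z ≡ (j : ℤ) + 1 [ZMOD (l + 1)] then z - 1
  else z

def stepC (l : ℕ) (j : Fin (l + 1)) (z : ℤ) : ℤ :=
  if z ≡ (j : ℤ) [ZMOD (2 * l)] ∨ z ≡ -(j : ℤ) [ZMOD (2 * l)] then z + 1
  else if z ≡ (j : ℤ) + 1 [ZMOD (2 * l)] ∨ z ≡ -(j : ℤ) + 1 [ZMOD (2 * l)] then z - 1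
  else z

def stepA2 (l : ℕ) (j : Fin (l + 1)) (z : ℤ) : ℤ :=
  if (j : ℕ) = 0 then
    if z ≡ 1 [ZMOD (2 * l)] ∨ z ≡ -1 [ZMOD (2 * l)] then z + 1
    else if z ≡ 0 [ZMOD (2 * l)] ∨ z ≡ 2 [ZMOD (2 * l)] then z - 1
    else z
  else if (j : ℕ) = 1 then
    if z ≡ -1 [ZMOD (2 * l)] ∨ z ≡ 0 [ZMOD (2 * l)] then z + 2
    else if z ≡ 1 [ZMOD (2 * l)] ∨ z ≡ 2 [ZMOD (2 * l)] then z - 2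
    else z
  else
    if z ≡ (j : ℤ) [ZMOD (2 * l)] ∨ z ≡ -(j : ℤ) [ZMOD (2 * l)] then z + 1
    else if z ≡ (j : ℤ) + 1 [ZMOD (2 * l)] ∨ z ≡ -(j : ℤ) + 1 [ZMOD (2 * l)] then z - 1
    else z

/-- The correction `c`, with `c(0) = c(1) = 0` and `c(l-1) = c(l) = 1`. -/
def corrD (j : ℕ) : ℤ := if j = 0 ∨ j = 1 then 0 else 1

def stepD (l : ℕ) (j : Fin (l + 1)) (z : ℤ) : ℤ :=
  if (j : ℕ) = 0 ∨ (j : ℕ) + 1 = l then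
    if z ≡ j - 1 + corrD j [ZMOD (2 * l)] ∨ z ≡ j + 1 + corrD j [ZMOD (2 * l)] then z + 1
    else if z ≡ j + corrD j [ZMOD (2 * l)] ∨ z ≡ j + 2 + corrD j [ZMOD (2 * l)] then z - 1
    else z
  else if (j : ℕ) = 1 ∨ (j : ℕ) = l then
    if z ≡ j - 2 + corrD j [ZMOD (2 * l)] ∨ z ≡ j - 1 + corrD j [ZMOD (2 * l)] then z + 2
    else if z ≡ j + corrD j [ZMOD (2 * l)] ∨ z ≡ j + 1 + corrD j [ZMOD (2 * l)] then z - 2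
    else z
  else
    if z ≡ (j : ℤ) [ZMOD (2 * l)] ∨ z ≡ -(j : ℤ) [ZMOD (2 * l)] then z + 1
    else if z ≡ (j : ℤ) + 1 [ZMOD (2 * l)] ∨ z ≡ -(j : ℤ) + 1 [ZMOD (2 * l)] then z - 1
    else z

/-! ### The stipulated order relations between incomparable ideals -/

/-- `⟨0(y)⟩ < ⟨1(y+1)⟩` for all `y`. -/
def stipA2 (l : ℕ) (I J : Set (HeapA2 l)) : Prop :=
  ∃ y : ℤ, I = Set.Iic (el 0 y) ∧ J = Set.Iic (el 1 (y + 1))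

/-- `⟨0(y)⟩ < ⟨1(y+1)⟩` and `⟨(l-1)(y)⟩ < ⟨l(y)⟩` for all `y`. -/
def stipD (l : ℕ) (I J : Set (HeapD l)) : Prop :=
  ∃ y : ℤ, (I = Set.Iic (el 0 y) ∧ J = Set.Iic (el 1 (y + 1))) ∨
    (I = Set.Iic (el (l - 1) y) ∧ J = Set.Iic (el l y))

/-! ### The Weyl group: word length and faithfulness -/

section Weyl

variable {P : Type} {A : P → P → ℤ}

/-! Each heap is almost a chain. Number the element `p(y)` by the value that `ζ` is to take on the
ideal it generates. The numbers fill `ℤ` except for a set `T` (empty in types A and C), and `z` in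
`T` is preceded by two incomparable elements, numbered `z - 2` and `z - 1`, which together generate
the ideal to be numbered `z`. With `cut` as the ideal attached to an integer, a proper ideal is
recovered from its greatest number `m` and, when `m + 1` is in `T`, from whether it contains the
element numbered `m - 1` (`exists_eq_cut`). This gives `ζ` and the description of the proper ideals.
Inclusion is the order of `ℤ` except on the two ideals generated by the single members of an
incomparable pair, and those are the stipulated relations.

Adding an element labelled `i` is an edge between two integers, and `S_i` exchanges its ends, so it
becomes `step i` (`reflectIdeal_cut`). The sign of `step i z - z` records whether an element
labelled `i` can be added or removed. The one numerical fact about the diagram is `sign_sub`: adding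
an element labelled `p` changes the vector of signs by minus column `p` of `A`. It yields the heap
axioms, and the full heap condition by telescoping (`sum_Ioo`).

For the Weyl group, take a class of functions `f` on `ℤ` whose increment along an edge depends only
on the label of the edge. These increments are coordinates of `f`; if they determine `f`, then
`sign_sub` says that composing with `step i` is a simple reflection in these coordinates. The Weyl
relations then follow from identities between reflections (`relators`). The coordinates of the
identity are positive, so those of `w` behave like the values of a regular dominant weight on the
roots obtained from the simple roots by `w`. Such values are positive at non-descents
(`pos_of_weylLength_le`), and a nontrivial `w` has a descent, so no nontrivial `w` acts trivially.

In type A the class consists of functions compatible with translation by `l + 1`, with a fixed sum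
over a period. In the other types it consists of functions compatible with translation by `2l` and
with `z ↦ 1 - z`; each `step j` is then a single reflection `swapStep`, and `sign_sub` need be
checked on only one edge per label (`IsSignedModel`). -/

theorem weylGen_mul_self (i : P) : weylGen A i * weylGen A i = 1 := by
  have h : FreeGroup.of i * FreeGroup.of i ∈ weylRelators A := Or.inl ⟨i, rfl⟩
  simpa [weylGen, PresentedGroup.of] using PresentedGroup.one_of_mem h

theorem weylGen_mul_weylGen_mul (w : WeylGroup A) (i : P) :
    w * weylGen A i * weylGen A i = w := by
  rw [mul_assoc, weylGen_mul_self, mul_one]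

theorem weylGen_comm {i j : P} (h : A i j = 0) :
    weylGen A i * weylGen A j = weylGen A j * weylGen A i := by
  have h : (FreeGroup.of i * FreeGroup.of j) * (FreeGroup.of j * FreeGroup.of i)⁻¹ ∈
      weylRelators A := Or.inr (Or.inl ⟨i, j, h, rfl⟩)
  have := PresentedGroup.one_of_mem h
  rw [map_mul, map_inv, mul_inv_eq_one] at this
  simpa [weylGen, PresentedGroup.of] using this

theorem weylGen_braid_three {i j : P} (h : A i j < 0) (h' : A i j * A j i = 1) :
    weylGen A i * weylGen A j * weylGen A i = weylGen A j * weylGen A i * weylGen A j := by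
  have h : (FreeGroup.of i * FreeGroup.of j * FreeGroup.of i) *
      (FreeGroup.of j * FreeGroup.of i * FreeGroup.of j)⁻¹ ∈
      weylRelators A := Or.inr (Or.inr (Or.inl ⟨i, j, h, h', rfl⟩))
  have := PresentedGroup.one_of_mem h
  rw [map_mul, map_inv, mul_inv_eq_one] at this
  simpa [weylGen, PresentedGroup.of] using this

theorem weylGen_braid_four {i j : P} (h : A i j < 0) (h' : A i j * A j i = 2) :
    weylGen A i * weylGen A j * weylGen A i * weylGen A j =
      weylGen A j * weylGen A i * weylGen A j * weylGen A i := by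
  have h : (FreeGroup.of i * FreeGroup.of j * FreeGroup.of i * FreeGroup.of j) *
      (FreeGroup.of j * FreeGroup.of i * FreeGroup.of j * FreeGroup.of i)⁻¹ ∈
      weylRelators A := Or.inr (Or.inr (Or.inr ⟨i, j, h, h', rfl⟩))
  have := PresentedGroup.one_of_mem h
  rw [map_mul, map_inv, mul_inv_eq_one] at this
  simpa [weylGen, PresentedGroup.of] using this

/-- `IsWordProd A n w`: the element `w` is a product of `n` generators. -/
inductive IsWordProd (A : P → P → ℤ) : ℕ → WeylGroup A → Prop
  | one : IsWordProd A 0 1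
  | mul_gen {n w} (i : P) : IsWordProd A n w → IsWordProd A (n + 1) (w * weylGen A i)

theorem IsWordProd.mul {m n : ℕ} {v w : WeylGroup A} (hv : IsWordProd A m v)
    (hw : IsWordProd A n w) : IsWordProd A (m + n) (v * w) := by
  induction hw with
  | one => simpa using hv
  | mul_gen i _ ih => rw [← mul_assoc]; exact ih.mul_gen i

theorem isWordProd_weylGen (i : P) : IsWordProd A 1 (weylGen A i) := by
  simpa using IsWordProd.one.mul_gen i

theorem exists_isWordProd (w : WeylGroup A) : ∃ n, IsWordProd A n w := by
  induction w using PresentedGroup.induction_on with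
  | _ x =>
    induction x using FreeGroup.induction_on with
    | C1 => exact ⟨0, by simpa using IsWordProd.one⟩
    | of i => exact ⟨1, isWordProd_weylGen i⟩
    | inv_of i _ =>
      refine ⟨1, ?_⟩
      have : (PresentedGroup.mk (weylRelators A) (FreeGroup.of i))⁻¹ = weylGen A i :=
        inv_eq_of_mul_eq_one_left (weylGen_mul_self (A := A) i)
      rw [map_inv, this]
      exact isWordProd_weylGen i
    | mul x y hx hy =>
      obtain ⟨m, hm⟩ := hx
      obtain ⟨n, hn⟩ := hy
      exact ⟨m + n, by rw [map_mul]; exact hm.mul hn⟩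

open Classical in
/-- The word length on the Weyl group. -/
noncomputable def weylLength (w : WeylGroup A) : ℕ := Nat.find (exists_isWordProd w)

theorem isWordProd_weylLength (w : WeylGroup A) : IsWordProd A (weylLength w) w := by
  classical exact Nat.find_spec (exists_isWordProd w)

theorem IsWordProd.weylLength_le {n : ℕ} {w : WeylGroup A} (h : IsWordProd A n w) :
    weylLength w ≤ n := by
  classical exact Nat.find_min' (exists_isWordProd w) h

theorem weylLength_mul_gen_le (w : WeylGroup A) (i : P) :
    weylLength (w * weylGen A i) ≤ weylLength w + 1 :=
  ((isWordProd_weylLength w).mul_gen i).weylLength_le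

theorem exists_weylLength_mul_gen_lt {w : WeylGroup A} (hw : w ≠ 1) :
    ∃ i, weylLength (w * weylGen A i) < weylLength w := by
  have h := isWordProd_weylLength w
  generalize hn : weylLength w = n at h
  cases h with
  | one => exact absurd rfl hw
  | mul_gen i h =>
    refine ⟨i, ?_⟩
    rw [weylGen_mul_weylGen_mul]
    exact Nat.lt_succ_of_le h.weylLength_le

/-! ### Positivity of weights at non-descents. -/

theorem IsGCM.cases (hA : IsGCM A) {i j : P} (hij : i ≠ j) (hprod : A i j * A j i ≤ 2) :
    (A i j = 0 ∧ A j i = 0) ∨ (A i j = -1 ∧ A j i = -1) ∨ (A i j = -1 ∧ A j i = -2) ∨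
      (A i j = -2 ∧ A j i = -1) := by
  rcases hA.off_diag i j hij with h | h | h
  · exact Or.inl ⟨h, (hA.zero_iff i j).1 h⟩
  all_goals
    have h0 : A j i ≠ 0 := fun h' => by rw [(hA.zero_iff j i).1 h'] at h; omega
    rcases hA.off_diag j i hij.symm with h' | h' | h'
    all_goals
      rw [h, h'] at hprod
      simp_all

/-- The values of a family `Λ` of integer functions transforming under the Weyl group like a
regular dominant weight are positive at all non-descents. -/
theorem pos_of_weylLength_le (hA : IsGCM A) (hprod : ∀ i j, i ≠ j → A i j * A j i ≤ 2)
    {Λ : WeylGroup A → P → ℤ} (h_one : ∀ j, 0 < Λ 1 j)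
    (h_mul : ∀ w i j, Λ (w * weylGen A i) j = Λ w j - A i j * Λ w i)
    (w : WeylGroup A) (s : P) (hs : weylLength w ≤ weylLength (w * weylGen A s)) :
    0 < Λ w s := by
  induction hn : weylLength w using Nat.strong_induction_on generalizing w s with
  | _ n ih =>
  by_cases hw : w = 1
  · rw [hw]; exact h_one s
  obtain ⟨t, ht⟩ := exists_weylLength_mul_gen_lt hw
  have hst : t ≠ s := by rintro rfl; omega
  obtain ⟨w₁, rfl⟩ : ∃ w₁, w = w₁ * weylGen A t :=
    ⟨_, (weylGen_mul_weylGen_mul w t).symm⟩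
  rw [weylGen_mul_weylGen_mul] at ht
  have e1 := ih _ (hn ▸ ht) w₁ t ht.le rfl
  have l1 := weylLength_mul_gen_le w₁ t
  rw [h_mul]
  -- Strip `t`, `s`, `t`, ... off the right of `w`, inside the dihedral group generated by `s` and
  -- `t`. As soon as the next letter is not a descent, both values are positive by induction, and
  -- `h_mul` writes `Λ w s` as a combination of them with nonnegative coefficients, not both zero.
  -- If the stripping goes on too long, a braid relation makes `w * weylGen A s` shorter than `w`,
  -- against `hs`.
  by_cases h1 : weylLength w₁ ≤ weylLength (w₁ * weylGen A s)
  · have e2 := ih _ (hn ▸ ht) w₁ s h1 rfl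
    rcases hA.cases hst (hprod t s hst) with h | h | h | h <;> rw [h.1] <;> linarith
  push Not at h1
  obtain ⟨w₂, rfl⟩ : ∃ w₂, w₁ = w₂ * weylGen A s :=
    ⟨_, (weylGen_mul_weylGen_mul w₁ s).symm⟩
  rw [weylGen_mul_weylGen_mul] at h1
  have l2 := weylLength_mul_gen_le w₂ s
  have hc := hA.cases hst (hprod t s hst)
  have h0 : A t s ≠ 0 := by
    intro h0
    have e : w₂ * weylGen A s * weylGen A t * weylGen A s = w₂ * weylGen A t := by
      rw [mul_assoc w₂, ← weylGen_comm h0, ← mul_assoc, weylGen_mul_weylGen_mul]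
    rw [e] at hs
    have := weylLength_mul_gen_le w₂ t
    omega
  have e3 := ih _ (hn ▸ h1.trans ht) w₂ s h1.le rfl
  simp only [h_mul, hA.diag]
  by_cases h2 : weylLength w₂ ≤ weylLength (w₂ * weylGen A t)
  · have e4 := ih _ (hn ▸ h1.trans ht) w₂ t h2 rfl
    rcases hc with h | h | h | h
    · exact absurd h.1 h0
    all_goals rw [h.1, h.2]; linarith
  push Not at h2
  obtain ⟨w₃, rfl⟩ : ∃ w₃, w₂ = w₃ * weylGen A t :=
    ⟨_, (weylGen_mul_weylGen_mul w₂ t).symm⟩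
  rw [weylGen_mul_weylGen_mul] at h2
  have l3 := weylLength_mul_gen_le w₃ t
  have e4 := ih _ (hn ▸ (h2.trans h1).trans ht) w₃ t h2.le rfl
  have hneg : A t s < 0 := by rcases hc with h | h | h | h <;> omega
  have h3 : A t s * A s t ≠ 1 := by
    intro h3
    have e : w₃ * weylGen A t * weylGen A s * weylGen A t * weylGen A s =
        w₃ * weylGen A s * weylGen A t := by
      have := weylGen_braid_three hneg h3
      simp only [mul_assoc] at this ⊢
      rw [← mul_assoc (weylGen A s) (weylGen A t) (weylGen A s)]
      have e' := congrArg (fun x => w₃ * (x * weylGen A s)) this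
      simp only [mul_assoc, weylGen_mul_self, mul_one] at e' ⊢
      exact e'
    rw [e] at hs
    have := weylLength_mul_gen_le w₃ s
    have := weylLength_mul_gen_le (w₃ * weylGen A s) t
    omega
  have h4 : A t s * A s t = 2 := by
    rcases hc with h | h | h | h <;> rw [h.1, h.2] at h3 ⊢ <;> omega
  by_cases h5 : weylLength w₃ ≤ weylLength (w₃ * weylGen A s)
  · have e5 := ih _ (hn ▸ (h2.trans h1).trans ht) w₃ s h5 rfl
    simp only [h_mul, hA.diag]
    rcases hc with h | h | h | h <;> rw [h.1, h.2] at h4 ⊢ <;> linarith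
  push Not at h5
  obtain ⟨w₄, rfl⟩ : ∃ w₄, w₃ = w₄ * weylGen A s :=
    ⟨_, (weylGen_mul_weylGen_mul w₃ s).symm⟩
  rw [weylGen_mul_weylGen_mul] at h5
  -- Here `w` ends in all four letters of the longest element of the dihedral group of order 8, so
  -- multiplying by `s` must shorten it.
  exfalso
  have e : w₄ * weylGen A s * weylGen A t * weylGen A s * weylGen A t * weylGen A s =
      w₄ * weylGen A t * weylGen A s * weylGen A t := by
    have e' := congrArg (fun x => w₄ * (x * weylGen A s)) (weylGen_braid_four hneg h4)
    simp only [mul_assoc, weylGen_mul_self, mul_one] at e' ⊢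
    exact e'.symm
  rw [e] at hs
  have := weylLength_mul_gen_le w₄ t
  have := weylLength_mul_gen_le (w₄ * weylGen A t) s
  have := weylLength_mul_gen_le (w₄ * weylGen A t * weylGen A s) t
  omega

/-- If `w ≠ 1` has descent `i`, positivity applies to `w * weylGen A i` at `i`. The reflection
negates the `i`-th value, so this says `0 < -Λ w i = -Λ 1 i`, which is absurd. -/
theorem eq_one_of_weights_eq (hA : IsGCM A) (hprod : ∀ i j, i ≠ j → A i j * A j i ≤ 2)
    {Λ : WeylGroup A → P → ℤ} (h_one : ∀ j, 0 < Λ 1 j)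
    (h_mul : ∀ w i j, Λ (w * weylGen A i) j = Λ w j - A i j * Λ w i)
    {w : WeylGroup A} (hw : Λ w = Λ 1) : w = 1 := by
  by_contra h
  obtain ⟨i, hi⟩ := exists_weylLength_mul_gen_lt h
  have h1 := pos_of_weylLength_le hA hprod h_one h_mul (w * weylGen A i) i
    (by rw [weylGen_mul_weylGen_mul]; exact hi.le)
  have h2 := h_one i
  rw [h_mul, hA.diag, hw] at h1
  omega

/-- A class `F` of functions on `ℤ` closed under precomposition with the maps `step i`, whose
members are determined by the differences `f (b j) - f (a j)`, on which the maps `step i` act as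
the simple reflections of the Weyl group. -/
structure IsReflectionModel (A : P → P → ℤ) (step : P → ℤ → ℤ) (F : (ℤ → ℤ) → Prop)
    (a b : P → ℤ) : Prop where
  gcm : IsGCM A
  prod_le : ∀ i j, i ≠ j → A i j * A j i ≤ 2
  id_mem : F id
  comp_mem : ∀ f i, F f → F (f ∘ step i)
  lt : ∀ j, a j < b j
  comp_sub : ∀ f i j, F f → f (step i (b j)) - f (step i (a j)) =
    f (b j) - f (a j) - A i j * (f (b i) - f (a i))
  ext : ∀ f g, F f → F g → (∀ j, f (b j) - f (a j) = g (b j) - g (a j)) → f = g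

/-! ### Reflection models: the action on `ℤ` and its faithfulness. -/

namespace IsReflectionModel

variable {step : P → ℤ → ℤ} {F : (ℤ → ℤ) → Prop} {a b : P → ℤ}

theorem step_step (h : IsReflectionModel A step F a b) (i : P) (z : ℤ) :
    step i (step i z) = z := by
  have h1 := h.comp_mem _ i h.id_mem
  have := h.ext _ _ (h.comp_mem _ i h1) h.id_mem fun j => by
    have e1 := h.comp_sub _ i j h1
    have e2 := h.comp_sub _ i j h.id_mem
    have e3 := h.comp_sub _ i i h.id_mem
    simp only [Function.comp_apply, id, h.gcm.diag] at e1 e2 e3 ⊢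
    rw [e1, e2, e3]; ring
  exact congrFun this z

/-- The permutation of `ℤ` defined by `step i`. -/
def perm (h : IsReflectionModel A step F a b) (i : P) : Equiv.Perm ℤ :=
  ⟨step i, step i, h.step_step i, h.step_step i⟩

/-- The two sides of each relation lie in `F`, so only their coordinates need comparing. By
`comp_sub` these are computed by the reflections attached to `A`, and the relation becomes a linear
identity for the possible pairs of entries. -/
theorem relators (h : IsReflectionModel A step F a b) :
    ∀ r ∈ weylRelators A, FreeGroup.lift h.perm r = 1 := by
  have key : ∀ u v : ℤ → ℤ, F u → F v →
      (∀ j, u (b j) - u (a j) = v (b j) - v (a j)) → ∀ z, u z = v z :=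
    fun u v hu hv huv z => congrFun (h.ext u v hu hv huv) z
  rintro r (⟨i, rfl⟩ | ⟨i, j, hij, rfl⟩ | ⟨i, j, hij, hp, rfl⟩ | ⟨i, j, hij, hp, rfl⟩)
  · ext z
    simpa [perm] using h.step_step i z
  all_goals
    have hne : i ≠ j := by
      rintro rfl
      have := h.gcm.diag i
      omega
    have hc := h.gcm.cases hne (h.prod_le i j hne)
    have m1 := fun i => h.comp_mem _ i h.id_mem
    have m2 := fun i j => h.comp_mem _ j (m1 i)
    have m3 := fun i j k => h.comp_mem _ k (m2 i j)
    have m4 := fun i j k m => h.comp_mem _ m (m3 i j k)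
    have c1 := fun i k => h.comp_sub _ i k h.id_mem
    have c2 := fun i j k => h.comp_sub _ j k (m1 i)
    have c3 := fun i j m k => h.comp_sub _ m k (m2 i j)
    have c4 := fun i j m n k => h.comp_sub _ n k (m3 i j m)
    simp only [Function.comp_apply, id] at c1 c2 c3 c4
    rw [map_mul, map_inv, mul_inv_eq_one]
    ext z
    simp only [map_mul, FreeGroup.lift_apply_of, Equiv.Perm.mul_apply, perm, Equiv.coe_fn_mk]
  · refine key _ _ (m2 i j) (m2 j i) (fun k => ?_) z
    simp only [Function.comp_apply, id, c2, c1, hij, (h.gcm.zero_iff i j).1 hij]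
    ring
  · refine key _ _ (m3 i j i) (m3 j i j) (fun k => ?_) z
    simp only [Function.comp_apply, id, c3, c2, c1, h.gcm.diag]
    rcases hc with e | e | e | e <;> rw [e.1, e.2] at hp ⊢ <;> first | omega | ring
  · refine key _ _ (m4 i j i j) (m4 j i j i) (fun k => ?_) z
    simp only [Function.comp_apply, id, c4, c3, c2, c1, h.gcm.diag]
    rcases hc with e | e | e | e <;> rw [e.1, e.2] at hp ⊢ <;> first | omega | ring

/-- The action of the Weyl group on `ℤ` given by the maps `step i`. -/
def action (h : IsReflectionModel A step F a b) : WeylGroup A →* Equiv.Perm ℤ :=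
  PresentedGroup.toGroup h.relators

theorem action_weylGen (h : IsReflectionModel A step F a b) (i : P) (z : ℤ) :
    h.action (weylGen A i) z = step i z := by
  simp [action, weylGen, perm]

theorem action_mem (h : IsReflectionModel A step F a b) (w : WeylGroup A) :
    F (h.action w) := by
  obtain ⟨n, hn⟩ := exists_isWordProd w
  induction hn with
  | one => simpa using h.id_mem
  | mul_gen i _ ih =>
    have := h.comp_mem _ i ih
    convert this using 1
    ext z
    simp [action_weylGen]

/-- The coordinates of `h.action w` form a family to which `eq_one_of_weights_eq` applies; at `w =
1` they are `b j - a j > 0`. -/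
theorem action_injective (h : IsReflectionModel A step F a b) :
    Function.Injective h.action := by
  rw [injective_iff_map_eq_one]
  intro w hw
  refine eq_one_of_weights_eq (Λ := fun w j => h.action w (b j) - h.action w (a j))
    h.gcm h.prod_le (fun j => ?_) (fun w i j => ?_) ?_
  · simpa using h.lt j
  · simpa [action_weylGen] using h.comp_sub _ i j (h.action_mem w)
  · ext j
    simp [hw]

end IsReflectionModel

end Weyl

/-! ### Linearised heaps -/

section LinearModel

variable {P E : Type} [PartialOrder E]

/-- The set of elements of the ideal numbered `z`, for an enumeration `e` of the heap. -/
def cut (T : ℤ → Prop) (e : E → ℤ) (z : ℤ) : Set E :=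
  {x | e x ≤ z ∧ ¬ (z = e x + 1 ∧ T (z + 1))}

/-- The ideal numbered `z'` is obtained from the one numbered `z` by adding `x`. -/
def CutEdge (T : ℤ → Prop) (e : E → ℤ) (x : E) (z z' : ℤ) : Prop :=
  (¬ T (e x + 1) ∧ z = e x - 1 ∧ z' = e x) ∨
  (T (e x + 1) ∧ z = e x - 2 ∧ z' = e x) ∨
  (T (e x + 1) ∧ z = e x - 1 ∧ z' = e x + 1) ∨
  (T (e x + 2) ∧ z = e x + 1 ∧ z' = e x + 2)

/-- A labelled poset enumerated by the integers which do not satisfy `T`: if `T z` then the elements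
numbered `z - 2` and `z - 1` are incomparable, and all other pairs are ordered as their numbers. The
maps `step i` interchange the numbers of the ideals differing by an element labelled `i`. -/
structure IsLinearModel (A : P → P → ℤ) (ε : E → P) (T : ℤ → Prop) (e : E → ℤ)
    (step : P → ℤ → ℤ) : Prop where
  gcm : IsGCM A
  inj : Function.Injective e
  exists_eq : ∀ z, ¬ T z → ∃ x, e x = z
  not_top : ∀ x, ¬ T (e x)
  le_iff : ∀ x y, x ≤ y ↔ e x ≤ e y ∧ ¬ (e y = e x + 1 ∧ T (e y + 1))
  sep : ∀ z, T z → ¬ T (z + 1) ∧ ¬ T (z + 2) ∧ ¬ T (z + 3)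
  below : ∀ p z, ∃ x, ε x = p ∧ e x < z
  above : ∀ p z, ∃ x, ε x = p ∧ z < e x
  step_edge : ∀ x z z', CutEdge T e x z z' → step (ε x) z = z' ∧ step (ε x) z' = z
  edge_step : ∀ i z, step i z ≠ z →
    ∃ x, ε x = i ∧ (CutEdge T e x z (step i z) ∨ CutEdge T e x (step i z) z)
  sign_sub : ∀ i x z z', CutEdge T e x z z' →
    Int.sign (step i z' - z') - Int.sign (step i z - z) = - A i (ε x)

/-! ### Ideals of a linear model and the edges between them. -/

namespace IsLinearModel

variable {A : P → P → ℤ} {ε : E → P} {T : ℤ → Prop} {e : E → ℤ} {step : P → ℤ → ℤ}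

theorem isLowerSet_cut (h : IsLinearModel A ε T e step) (z : ℤ) : IsLowerSet (cut T e z) := by
  intro y x hxy hy
  rw [h.le_iff] at hxy
  have := @h.inj x y
  have hT := h.not_top
  simp only [cut, Set.mem_ofPred_eq] at hy ⊢
  refine ⟨by omega, ?_⟩
  rintro ⟨rfl, ht⟩
  grind

theorem cut_eq_Iic (h : IsLinearModel A ε T e step) (x : E) : cut T e (e x) = Set.Iic x := by
  ext y
  simp [cut, h.le_iff]

theorem cut_of_top (h : IsLinearModel A ε T e step) {x y : E} {z : ℤ} (hz : T z)
    (hx : e x = z - 2) (hy : e y = z - 1) : cut T e z = Set.Iic x ∪ Set.Iic y := by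
  have h1 := h.sep z hz
  have h2 : ¬ T (z - 1) := fun h' => (h.sep _ h').1 (by simpa using hz)
  ext w
  have h3 := h.not_top w
  simp only [cut, Set.mem_ofPred_eq, Set.mem_union, Set.mem_Iic, h.le_iff, hx, hy]
  have e1 : z - 2 + 1 = z - 1 := by ring
  have e2 : z - 1 + 1 = z := by ring
  simp only [e1, e2, hz, h1.1, h2, and_false, and_true, not_false_eq_true]
  constructor
  · intro h4
    have : e w ≠ z := fun h' => h3 (h' ▸ hz)
    omega
  · omega

/-- The exceptional case is `w = z + 1` with `T (z + 2)`: these ideals are generated by the two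
members of an incomparable pair, and neither contains the other. -/
theorem cut_subset_iff (h : IsLinearModel A ε T e step) (z w : ℤ) :
    cut T e z ⊆ cut T e w ↔ z ≤ w ∧ ¬ (w = z + 1 ∧ T (w + 1)) := by
  constructor
  · intro hs
    by_cases hz : T z
    · have h1 := h.sep z hz
      obtain ⟨x, hx⟩ := h.exists_eq (z - 1) fun h' => (h.sep _ h').1 (by simpa using hz)
      obtain ⟨y, hy⟩ := h.exists_eq (z - 2) fun h' => (h.sep _ h').2.1 (by simpa using hz)
      have mx : x ∈ cut T e z := ⟨by omega, fun h' => h1.1 h'.2⟩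
      have my : y ∈ cut T e z := ⟨by omega, fun h' => h1.1 h'.2⟩
      have mx' := (hs mx).1
      have my' := (hs my).2
      have h2 : w ≠ z - 1 := by
        rintro rfl
        exact my' ⟨by omega, by simpa using hz⟩
      refine ⟨by omega, ?_⟩
      rintro ⟨rfl, h'⟩
      exact h1.2.1 (by simpa [add_assoc] using h')
    · obtain ⟨x, hx⟩ := h.exists_eq z hz
      have mx : x ∈ cut T e z := ⟨by omega, by omega⟩
      simpa [cut, hx] using hs mx
  · rintro ⟨hzw, hn⟩ x ⟨hx, hx'⟩
    refine ⟨by omega, ?_⟩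
    rintro ⟨rfl, h'⟩
    have : z = e x ∨ z = e x + 1 := by omega
    rcases this with rfl | rfl
    · exact hn ⟨rfl, h'⟩
    · exact hx' ⟨rfl, h'⟩

theorem cut_injective (h : IsLinearModel A ε T e step) : Function.Injective (cut T e) := by
  intro z w hzw
  exact le_antisymm ((h.cut_subset_iff z w).1 hzw.subset).1
    ((h.cut_subset_iff w z).1 hzw.symm.subset).1

theorem isProperIdeal_cut (h : IsLinearModel A ε T e step) (z : ℤ) :
    IsProperIdeal ε (cut T e z) := by
  have key : ∀ p, (∃ x, ε x = p ∧ x ∈ cut T e z) ∧ ∃ x, ε x = p ∧ x ∉ cut T e z := by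
    intro p
    obtain ⟨x, hx, hx'⟩ := h.below p (z - 1)
    obtain ⟨y, hy, hy'⟩ := h.above p z
    exact ⟨⟨x, hx, by omega, by omega⟩, y, hy, fun h' => by have := h'.1; omega⟩
  obtain ⟨x₀, -⟩ : ∃ x : E, True := by
    by_cases h0 : T 0
    · exact (h.exists_eq 1 (h.sep 0 h0).1).imp fun _ _ => trivial
    · exact (h.exists_eq 0 h0).imp fun _ _ => trivial
  obtain ⟨⟨x, hx, hxm⟩, y, hy, hym⟩ := key (ε x₀)
  refine ⟨h.isLowerSet_cut z, ?_, ?_, fun p => ?_, fun p => ?_⟩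
  · exact Set.empty_ssubset.2 ⟨x, hxm⟩
  · exact Set.ssubset_univ_iff.2 fun h' => hym (h' ▸ Set.mem_univ y)
  · obtain ⟨⟨x, hx, hxm⟩, -⟩ := key p
    exact Set.empty_ssubset.2 ⟨x, hxm, hx⟩
  · obtain ⟨-, y, hy, hym⟩ := key p
    exact ⟨Set.inter_subset_right, fun h' => hym (h' hy).1⟩

/-- Let `x` carry the greatest number in `I`. If `T (e x + 1)` fails, `I` is the ideal generated by
`x`. Otherwise the element `t` numbered just below is incomparable to `x`, and `I` has number `e x +
1` or `e x` according to whether it contains `t`. -/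
theorem exists_eq_cut (h : IsLinearModel A ε T e step) {I : Set E} (hI : IsLowerSet I)
    (h0 : I.Nonempty) (h1 : Iᶜ.Nonempty) : ∃ z, I = cut T e z := by
  obtain ⟨y, hy⟩ := h1
  obtain ⟨x₁, hx₁⟩ := h0
  have hb : ∀ x ∈ I, e x ≤ e y + 1 := by
    intro x hx
    by_contra! hlt
    exact hy (hI ((h.le_iff y x).2 ⟨by omega, by omega⟩) hx)
  obtain ⟨m, ⟨x, hx, rfl⟩, hmax⟩ := Int.exists_greatest_of_bdd (P := fun z => ∃ x ∈ I, e x = z)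
    ⟨e y + 1, fun z ⟨x, hx, hz⟩ => hz ▸ hb x hx⟩ ⟨_, x₁, hx₁, rfl⟩
  have hmax : ∀ w ∈ I, e w ≤ e x := fun w hw => hmax _ ⟨w, hw, rfl⟩
  by_cases hT : T (e x + 1)
  · obtain ⟨t, ht⟩ := h.exists_eq (e x - 1) fun h' => (h.sep _ h').2.1 (by
      rw [show e x - 1 + 2 = e x + 1 by ring]; exact hT)
    by_cases htI : t ∈ I
    · refine ⟨e x + 1, Set.Subset.antisymm (fun w hw => ?_) (fun w hw => ?_)⟩
      · have := hmax w hw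
        exact ⟨by omega, fun h' => (h.sep _ hT).1 h'.2⟩
      · have h2 : e w ≠ e x + 1 := fun h' => h.not_top w (h' ▸ hT)
        have h3 := hw.1
        by_cases h4 : e w = e x - 1
        · rwa [h.inj (h4.trans ht.symm)]
        · exact hI ((h.le_iff w x).2 ⟨by omega, by omega⟩) hx
    · refine ⟨e x, Set.Subset.antisymm (fun w hw => ?_) (fun w hw => ?_)⟩
      · have := hmax w hw
        refine ⟨this, fun h' => htI ?_⟩
        rwa [h.inj (show e t = e w by omega)]
      · exact hI ((h.le_iff w x).2 hw) hx
  · exact ⟨e x, Set.Subset.antisymm (fun w hw => ⟨hmax w hw, fun h' => hT h'.2⟩)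
      fun w hw => hI ((h.le_iff w x).2 hw) hx⟩

theorem isProperIdeal_iff (h : IsLinearModel A ε T e step) (I : Set E) :
    IsProperIdeal ε I ↔ ∃ z, I = cut T e z := by
  constructor
  · intro hI
    exact h.exists_eq_cut hI.isLowerSet (Set.empty_ssubset.1 hI.empty_ssubset)
      (Set.nonempty_compl.2 (Set.ssubset_univ_iff.1 hI.ssubset_univ))
  · rintro ⟨z, rfl⟩
    exact h.isProperIdeal_cut z

theorem cutEdge_of_insert (h : IsLinearModel A ε T e step) {x : E} {z w : ℤ}
    (hx : x ∉ cut T e z) (hw : cut T e w = insert x (cut T e z)) : CutEdge T e x z w := by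
  have hsub := (h.cut_subset_iff z w).1 (hw ▸ Set.subset_insert _ _)
  have hxw : x ∈ cut T e w := hw ▸ Set.mem_insert _ _
  have key : ∀ y, e y ≠ e x → y ∈ cut T e w → y ∈ cut T e z := by
    intro y hy hyw
    rw [hw] at hyw
    exact hyw.resolve_left fun h' => hy (congrArg e h')
  -- From here on the elements are replaced by their numbers. Testing this implication at the few
  -- numbers just below `w` pins down `z`; the gaps in `T` ensure that these numbers belong to
  -- elements.
  have key' : ∀ v, ¬ T v → v ≠ e x → (v ≤ w ∧ ¬ (w = v + 1 ∧ T (w + 1))) →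
      (v ≤ z ∧ ¬ (z = v + 1 ∧ T (z + 1))) := by
    intro v hv hvx hvw
    obtain ⟨y, rfl⟩ := h.exists_eq v hv
    exact key y hvx hvw
  have hsep := h.sep
  have hnt := h.not_top x
  simp only [cut, Set.mem_ofPred_eq] at hx hxw
  unfold CutEdge
  generalize e x = u at *
  have hzw : z ≠ w := by rintro rfl; exact hx hxw
  by_cases hzu : z = u + 1
  · subst hzu
    have hT : T (u + 2) := by
      by_contra hT
      exact hx ⟨by omega, fun h' => hT (by simpa [add_assoc] using h'.2)⟩
    have s1 := hsep _ hT
    have := key' (u + 3) (by simpa [add_assoc] using s1.1)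
    have : w = u + 2 := by
      by_contra hne
      have := this (by omega) ⟨by omega, fun h' => s1.2.2 (by
        rw [show u + 2 + 3 = w + 1 by omega]; exact h'.2)⟩
      omega
    exact Or.inr (Or.inr (Or.inr ⟨hT, rfl, this⟩))
  have hzu : z < u := by
    by_contra h'
    exact hx ⟨by omega, fun h'' => hzu h''.1⟩
  by_cases hTw : T w
  · have s1 := hsep _ hTw
    have t1 : ¬ T (w - 1) := fun h' => (hsep _ h').1 (by simpa using hTw)
    have t2 : ¬ T (w - 2) := fun h' => (hsep _ h').2.1 (by simpa using hTw)
    have k1 := key' (w - 1) t1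
    have k2 := key' (w - 2) t2
    have hwu : w ≠ u := by rintro rfl; exact hnt hTw
    have : u = w - 1 := by
      by_contra hne
      have := k1 (by omega) ⟨by omega, fun h' => s1.1 h'.2⟩
      omega
    have k2 := k2 (by omega) ⟨by omega, fun h' => s1.1 h'.2⟩
    refine Or.inr (Or.inr (Or.inl ⟨?_, by omega, by omega⟩))
    rw [this]; simpa using hTw
  · have : w = u := by
      by_contra hne
      have := key' w hTw hne ⟨le_rfl, by omega⟩
      omega
    subst this
    by_cases hT1 : T (w + 1)
    · have t2 : ¬ T (w - 2) := fun h' => (hsep _ h').2.2 (by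
        rw [show w - 2 + 3 = w + 1 by ring]; exact hT1)
      have := key' (w - 2) t2 (by omega) ⟨by omega, by omega⟩
      have h4 : z ≠ w - 1 := fun h' => hsub.2 ⟨by omega, hT1⟩
      exact Or.inr (Or.inl ⟨hT1, by omega, rfl⟩)
    · refine Or.inl ⟨hT1, ?_, rfl⟩
      by_cases hT0 : T (w - 1)
      · have t2 : ¬ T (w - 2) := fun h' => (hsep _ h').1 (by
          rw [show w - 2 + 1 = w - 1 by ring]; exact hT0)
        have t3 : ¬ T (w - 3) := fun h' => (hsep _ h').2.1 (by
          rw [show w - 3 + 2 = w - 1 by ring]; exact hT0)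
        have k2 := key' (w - 2) t2 (by omega) ⟨by omega, by omega⟩
        have k3 := key' (w - 3) t3 (by omega) ⟨by omega, by omega⟩
        have : z ≠ w - 2 := fun h' => k3.2 ⟨by omega, by
          rw [show z + 1 = w - 1 by omega]; exact hT0⟩
        omega
      · have := key' (w - 1) hT0 (by omega) ⟨by omega, fun h' => hT1 h'.2⟩
        omega

theorem insert_of_cutEdge (h : IsLinearModel A ε T e step) {x : E} {z w : ℤ}
    (hE : CutEdge T e x z w) : x ∉ cut T e z ∧ cut T e w = insert x (cut T e z) := by
  have hx := h.not_top x
  constructor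
  · rintro ⟨h1, h2⟩
    rcases hE with ⟨h3, h4, h5⟩ | ⟨h3, h4, h5⟩ | ⟨h3, h4, h5⟩ | ⟨h3, h4, h5⟩
    · omega
    · omega
    · omega
    · exact h2 ⟨h4, by rw [h4, add_assoc]; exact h3⟩
  · ext y
    have hy := h.not_top y
    have hyx : y = x ↔ e y = e x := h.inj.eq_iff.symm
    simp only [Set.mem_insert_iff, hyx, cut, Set.mem_ofPred_eq]
    have hsep := h.sep
    unfold CutEdge at hE
    generalize e x = u at *
    generalize e y = v at *
    rcases hE with ⟨h3, rfl, rfl⟩ | ⟨h3, rfl, rfl⟩ | ⟨h3, rfl, rfl⟩ | ⟨h3, rfl, rfl⟩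
    · have e1 : w - 1 + 1 = w := by ring
      simp only [e1, hx, h3, and_false, not_false_eq_true, and_true]
      omega
    · have e1 : w - 2 + 1 = w - 1 := by ring
      have t1 : ¬ T (w - 1) := fun h' => (hsep _ h').2.1 (by
        rw [show w - 1 + 2 = w + 1 by ring]; exact h3)
      simp only [e1, h3, t1, and_false, not_false_eq_true, and_true]
      omega
    · have e1 : u - 1 + 1 = u := by ring
      have := hsep _ h3
      have : v ≠ u + 1 := fun h' => hy (h' ▸ h3)
      simp only [e1, hx, (hsep _ h3).1, and_false, not_false_eq_true, and_true]
      omega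
    · have e1 : u + 1 + 1 = u + 2 := by ring
      have := hsep _ h3
      have : v ≠ u + 2 := fun h' => hy (h' ▸ h3)
      simp only [e1, h3, (hsep _ h3).1, and_false, not_false_eq_true, and_true]
      omega

theorem cutEdge_iff (h : IsLinearModel A ε T e step) {x : E} {z w : ℤ} :
    CutEdge T e x z w ↔ x ∉ cut T e z ∧ cut T e w = insert x (cut T e z) :=
  ⟨h.insert_of_cutEdge, fun h' => h.cutEdge_of_insert h'.1 h'.2⟩

end IsLinearModel

end LinearModel

theorem CutEdge.lt {E : Type} {T : ℤ → Prop} {e : E → ℤ} {x : E} {z w : ℤ} (h : CutEdge T e x z w) :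
    z < w := by
  unfold CutEdge at h
  omega

/-! ### Reflections of ideals, the heap axioms, and transfer of the action. -/

section LinearModel

variable {P E : Type} [PartialOrder E]

namespace IsLinearModel

variable {A : P → P → ℤ} {ε : E → P} {T : ℤ → Prop} {e : E → ℤ} {step : P → ℤ → ℤ}

theorem exists_cut_diff (h : IsLinearModel A ε T e step) {x : E} {z : ℤ} (hx : x ∈ cut T e z)
    (hl : IsLowerSet (cut T e z \ {x})) : ∃ w, cut T e z \ {x} = cut T e w ∧ CutEdge T e x w z := by
  obtain ⟨y, -, hy⟩ := h.below (ε x) (min (e x) (z - 1))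
  obtain ⟨w, hw⟩ := h.exists_eq_cut hl
    ⟨y, ⟨by omega, by omega⟩, by rintro rfl; omega⟩ ⟨x, fun h' => h'.2 rfl⟩
  refine ⟨w, hw, h.cutEdge_iff.2 ⟨fun h' => ?_, ?_⟩⟩
  · rw [← hw] at h'; exact h'.2 rfl
  · rw [← hw, Set.insert_sdiff_singleton, Set.insert_eq_of_mem hx]

theorem exists_cut_insert (h : IsLinearModel A ε T e step) {x : E} {z : ℤ} (hx : x ∉ cut T e z)
    (hl : IsLowerSet (insert x (cut T e z))) :
    ∃ w, insert x (cut T e z) = cut T e w ∧ CutEdge T e x z w := by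
  obtain ⟨y, -, hy⟩ := h.above (ε x) (max (e x) z)
  obtain ⟨w, hw⟩ := h.exists_eq_cut hl ⟨x, Set.mem_insert _ _⟩ ⟨y, fun h' => by
    rcases h' with rfl | h'
    · omega
    · have := h'.1; omega⟩
  exact ⟨w, hw, h.cutEdge_iff.2 ⟨hx, hw.symm⟩⟩

/-- The choice of the removed or added element does not matter: any candidate gives an edge at `z`
labelled `i`, and `step_edge` forces its other end to be `step i z`. Conversely, if there is no
candidate, `edge_step` shows that `step i` fixes `z`. -/
theorem reflectIdeal_cut (h : IsLinearModel A ε T e step) (i : P) (z : ℤ) :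
    reflectIdeal ε i (cut T e z) = cut T e (step i z) := by
  unfold reflectIdeal
  split_ifs with h1 h2
  · obtain ⟨hi, hm, hl⟩ := h1.choose_spec
    generalize h1.choose = x at *
    obtain ⟨w, hw, hE⟩ := h.exists_cut_diff (hm rfl) hl
    rw [hw, ← hi, (h.step_edge _ _ _ hE).2]
  · obtain ⟨hi, hl, hm⟩ := h2.choose_spec
    generalize h2.choose = x at *
    rw [Set.union_singleton] at hl ⊢
    obtain ⟨w, hw, hE⟩ := h.exists_cut_insert
      (fun h' => Set.eq_empty_iff_forall_notMem.1 hm x ⟨h', rfl⟩) hl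
    rw [hw, ← hi, (h.step_edge _ _ _ hE).1]
  · by_contra hne
    obtain ⟨x, hi, hE | hE⟩ := h.edge_step i z fun h' => hne (by rw [h'])
    · have := h.cutEdge_iff.1 hE
      refine h2 ⟨x, hi, ?_, ?_⟩
      · rw [Set.union_singleton, ← this.2]
        exact h.isLowerSet_cut _
      · exact Set.inter_singleton_eq_empty.2 this.1
    · have := h.cutEdge_iff.1 hE
      refine h1 ⟨x, hi, ?_, ?_⟩
      · rw [this.2, Set.singleton_subset_iff]; exact Set.mem_insert _ _
      · rw [this.2, Set.insert_sdiff_self_of_notMem this.1]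
        exact h.isLowerSet_cut _

theorem sign_left (h : IsLinearModel A ε T e step) {x : E} {z w : ℤ} (hE : CutEdge T e x z w) :
    Int.sign (step (ε x) z - z) = 1 := by
  rw [(h.step_edge _ _ _ hE).1, Int.sign_eq_one_iff_pos]
  have := hE.lt
  omega

theorem sign_right (h : IsLinearModel A ε T e step) {x : E} {z w : ℤ} (hE : CutEdge T e x z w) :
    Int.sign (step (ε x) w - w) = -1 := by
  rw [(h.step_edge _ _ _ hE).2, Int.sign_eq_neg_one_iff_neg]
  have := hE.lt
  omega

theorem exists_edge_of_sign_pos (h : IsLinearModel A ε T e step) {i : P} {z : ℤ}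
    (hs : 0 < Int.sign (step i z - z)) : ∃ x w, ε x = i ∧ CutEdge T e x z w := by
  rw [Int.sign_pos_iff] at hs
  obtain ⟨x, hi, hE | hE⟩ := h.edge_step i z (by omega)
  · exact ⟨x, _, hi, hE⟩
  · have := hE.lt
    omega

theorem exists_edge_of_sign_neg (h : IsLinearModel A ε T e step) {i : P} {z : ℤ}
    (hs : Int.sign (step i z - z) < 0) : ∃ x w, ε x = i ∧ CutEdge T e x w z := by
  rw [Int.sign_neg_iff] at hs
  obtain ⟨x, hi, hE | hE⟩ := h.edge_step i z (by omega)
  · have := hE.lt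
    omega
  · exact ⟨x, _, hi, hE⟩

theorem conc_of_ne_zero (h : IsLinearModel A ε T e step) {p q : P} (hA : A p q ≠ 0) :
    DynkinConc A p q ∧ DynkinConc A q p := by
  have hA' : A q p ≠ 0 := fun h' => hA ((h.gcm.zero_iff q p).1 h')
  by_cases hpq : p = q
  · exact ⟨Or.inl hpq, Or.inl hpq.symm⟩
  · exact ⟨Or.inr ⟨hpq, hA⟩, Or.inr ⟨Ne.symm hpq, hA'⟩⟩

theorem ne_zero_of_conc (h : IsLinearModel A ε T e step) {p q : P} (hc : DynkinConc A p q) :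
    A p q ≠ 0 := by
  rcases hc with rfl | hc
  · rw [h.gcm.diag]; decide
  · exact hc.2

/-- Incomparable elements have labels which are neither equal nor adjacent. -/
theorem eq_zero_of_top (h : IsLinearModel A ε T e step) {x y : E} (hxy : e y = e x + 1)
    (hT : T (e y + 1)) : A (ε y) (ε x) = 0 := by
  have hT2 : T (e x + 2) := by rw [show e x + 2 = e y + 1 by omega]; exact hT
  -- The element `y` can be added both before and after `x`, so the sign of `step (ε y)` is `1` at
  -- both ends of the edge adding `x`, and `sign_sub` gives a zero entry.
  have h1 : CutEdge T e x (e x - 1) (e x) :=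
    Or.inl ⟨fun h' => (h.sep _ h').1 (by simpa [add_assoc] using hT2), rfl, rfl⟩
  have h2 : CutEdge T e y (e x - 1) (e y) := Or.inr (Or.inl ⟨hT, by omega, rfl⟩)
  have h3 : CutEdge T e y (e x) (e y + 1) := Or.inr (Or.inr (Or.inl ⟨hT, by omega, rfl⟩))
  have := h.sign_sub (ε y) _ _ _ h1
  rw [h.sign_left h2, h.sign_left h3] at this
  omega

theorem comparable (h : IsLinearModel A ε T e step) (a b : E)
    (hc : DynkinConc A (ε a) (ε b)) : a ≤ b ∨ b ≤ a := by
  have hc1 := h.ne_zero_of_conc hc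
  have hc2 : A (ε b) (ε a) ≠ 0 := fun h' => hc1 ((h.gcm.zero_iff _ _).1 h')
  by_contra! hn
  rw [h.le_iff, h.le_iff] at hn
  rcases lt_or_ge (e a) (e b) with hlt | hlt
  · have hn := not_not.1 fun h' => hn.1 ⟨hlt.le, h'⟩
    exact hc2 (h.eq_zero_of_top hn.1 hn.2)
  · have hn := not_not.1 fun h' => hn.2 ⟨hlt, h'⟩
    exact hc1 (h.eq_zero_of_top hn.1 hn.2)

theorem finite_Icc (h : IsLinearModel A ε T e step) (a b : E) : (Set.Icc a b).Finite := by
  refine Set.Finite.of_finite_image (f := e) ?_ h.inj.injOn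
  refine (Set.finite_Icc (e a) (e b)).subset ?_
  rintro _ ⟨x, hx, rfl⟩
  exact ⟨((h.le_iff _ _).1 hx.1).1, ((h.le_iff _ _).1 hx.2).1⟩

/-- Every element `x` can be added to the ideal of the elements below it. -/
theorem exists_edge_Iic (h : IsLinearModel A ε T e step) (x : E) :
    ∃ z, CutEdge T e x z (e x) ∧ cut T e z = Set.Iio x := by
  obtain ⟨z, hz, hE⟩ := h.exists_cut_diff (x := x) (z := e x)
    (by rw [h.cut_eq_Iic]; exact le_rfl) (by
      rw [h.cut_eq_Iic, Set.Iic_sdiff_right]; exact isLowerSet_Iio x)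
  rw [h.cut_eq_Iic, Set.Iic_sdiff_right] at hz
  exact ⟨z, hE, hz.symm⟩

/-- Remove `a` from the ideal of elements below `b`. If the entry `A (ε b) (ε a)` were zero, the
sign for `ε b` would still be `1`, so some `c` labelled `ε b` could be added to the smaller ideal.
It is comparable to `b`; it cannot lie above `b`, as `a` is missing, so it is `a` itself and the
labels coincide. -/
theorem conc_of_covBy (h : IsLinearModel A ε T e step) {a b : E} (hab : a ⋖ b) :
    DynkinConc A (ε a) (ε b) := by
  obtain ⟨z', hE', hz'⟩ := h.exists_edge_Iic b
  obtain ⟨z, hz, hE⟩ := h.exists_cut_diff (x := a) (z := z') (by rw [hz']; exact hab.lt) (by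
    rw [hz']
    rintro x y hyx ⟨hx, hxa⟩
    refine ⟨hyx.trans_lt hx, ?_⟩
    rintro rfl
    exact hab.2 (lt_of_le_of_ne hyx fun h' => hxa h'.symm) hx)
  rw [hz'] at hz
  have hs := h.sign_sub (ε b) _ _ _ hE
  rw [h.sign_left hE'] at hs
  by_cases hb : A (ε b) (ε a) = 0
  · obtain ⟨c, w, hc, hEc⟩ := h.exists_edge_of_sign_pos (i := ε b) (z := z) (by omega)
    have hcz := h.cutEdge_iff.1 hEc
    have hlow := h.isLowerSet_cut w
    rw [hcz.2] at hlow
    rcases h.comparable b c (Or.inl hc.symm) with hbc | hcb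
    · have hm : b ∈ insert c (cut T e z) := hlow hbc (Set.mem_insert _ _)
      rcases hm with rfl | hm
      · have ham : a ∈ insert b (cut T e z) := hlow hab.le (Set.mem_insert _ _)
        rcases ham with ham | ham
        · exact absurd ham hab.ne
        · rw [← hz] at ham
          exact absurd rfl ham.2
      · rw [← hz] at hm
        exact absurd hm.1 (lt_irrefl b)
    · rcases hcb.eq_or_lt with rfl | hcb
      · have ham : a ∈ insert c (cut T e z) := hlow hab.le (Set.mem_insert _ _)
        rcases ham with ham | ham
        · exact absurd ham hab.ne
        · rw [← hz] at ham
          exact absurd rfl ham.2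
      · have : c = a := by
          by_contra hca
          exact hcz.1 (hz ▸ ⟨hcb, hca⟩)
        exact Or.inl (this ▸ hc)
  · exact (h.conc_of_ne_zero hb).2

theorem isLabelledHeap (h : IsLinearModel A ε T e step) : IsLabelledHeap A ε where
  locally_finite := h.finite_Icc
  comparable := h.comparable
  le_iff a b := by
    constructor
    · intro hab
      -- Since intervals are finite, the order is generated by covers, and covers have equal or
      -- adjacent labels.
      let _ := LocallyFiniteOrder.ofFiniteIcc h.finite_Icc
      have := le_iff_reflTransGen_covBy.1 hab
      induction this with
      | refl => exact Relation.TransGen.single ⟨le_rfl, Or.inl rfl⟩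
      | tail h1 h2 ih =>
        exact (ih (le_iff_reflTransGen_covBy.2 h1)).tail ⟨h2.le, h.conc_of_covBy h2⟩
    · intro hab
      induction hab with
      | single h1 => exact h1.1
      | tail _ h2 ih => exact ih.trans h2.1

/-- Adding `a` raises the sign for `q` by `-A q (ε a) > 0`. Hence either it is positive afterwards,
and an element labelled `q` can be added right above `a`, or it is negative before, and one can be
removed right below `a`. -/
theorem exists_covBy (h : IsLinearModel A ε T e step) {p q : P} (hpq : DynkinAdj A p q) (a : E)
    (ha : ε a = p) : ∃ b, ε b = q ∧ (b ⋖ a ∨ a ⋖ b) := by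
  subst ha
  obtain ⟨z, hE, hz⟩ := h.exists_edge_Iic a
  have hs := h.sign_sub q _ _ _ hE
  have hqp : A q (ε a) < 0 := by
    have h0 : A q (ε a) ≠ 0 := fun h' => hpq.2 ((h.gcm.zero_iff _ _).1 h')
    have := h.gcm.off_diag q (ε a) hpq.1.symm
    omega
  by_cases hs1 : 0 < Int.sign (step q (e a) - e a)
  · obtain ⟨b, w, hb, hEb⟩ := h.exists_edge_of_sign_pos hs1
    have hbz := h.cutEdge_iff.1 hEb
    rw [h.cut_eq_Iic] at hbz
    have hlow := h.isLowerSet_cut w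
    rw [hbz.2] at hlow
    refine ⟨b, hb, Or.inr ⟨?_, fun c hac hcb => ?_⟩⟩
    · have hab := (h.comparable a b (Or.inr (hb ▸ hpq))).resolve_right hbz.1
      exact lt_of_le_of_ne hab fun h' => hbz.1 h'.symm.le
    · rcases hlow hcb.le (Set.mem_insert _ _) with hm | hm
      · exact hcb.ne hm
      · exact not_lt_of_ge hm hac
  · obtain ⟨b, w, hb, hEb⟩ := h.exists_edge_of_sign_neg (i := q) (z := z) (by omega)
    have hbz := h.cutEdge_iff.1 hEb
    rw [hz] at hbz
    have hba : b ∈ Set.Iio a := hbz.2 ▸ Set.mem_insert _ _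
    refine ⟨b, hb, Or.inl ⟨hba, fun c hbc hca => ?_⟩⟩
    have hc : c ∈ insert b (cut T e w) := hbz.2 ▸ hca
    rcases hc with hc | hc
    · exact hbc.ne' hc
    · exact hbz.1 (h.isLowerSet_cut w hbc.le hc)

theorem isFibredHeap (h : IsLinearModel A ε T e step) : IsFibredHeap A ε where
  toIsLabelledHeap := h.isLabelledHeap
  nonempty p := (h.below p 0).imp fun _ hx => hx.1
  unbounded_above p := by
    rintro ⟨b, hb⟩
    obtain ⟨x, hx, hbx⟩ := h.above p (e b)
    have := ((h.le_iff _ _).1 (hb hx)).1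
    omega
  unbounded_below p := by
    rintro ⟨b, hb⟩
    obtain ⟨x, hx, hbx⟩ := h.below p (e b)
    have := ((h.le_iff _ _).1 (hb hx)).1
    omega
  neighbour p q hpq a ha := h.exists_covBy hpq a ha

open Classical in
/-- The entry of `A` contributed by the element numbered `z`. -/
noncomputable def entryAt (A : P → P → ℤ) (ε : E → P) (e : E → ℤ) (p : P) (z : ℤ) : ℤ :=
  if hz : ∃ x, e x = z then A p (ε hz.choose) else 0

theorem entryAt_apply (h : IsLinearModel A ε T e step) (p : P) (x : E) :
    entryAt A ε e p (e x) = A p (ε x) := by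
  have hz : ∃ y, e y = e x := ⟨x, rfl⟩
  rw [entryAt, dif_pos hz, h.inj hz.choose_spec]

open Classical in
/-- The sign of `step p` at the ideal of the elements with numbers at most `z`. -/
noncomputable def signAt (T : ℤ → Prop) (step : P → ℤ → ℤ) (p : P) (z : ℤ) : ℤ :=
  if T (z + 1) then Int.sign (step p (z + 1) - (z + 1)) else Int.sign (step p z - z)

/-- This is `sign_sub` in a form that telescopes over all integers. For `z` in `T` both signs refer
to the same ideal, matching the zero default of `entryAt`. -/
theorem entryAt_eq_sub (h : IsLinearModel A ε T e step) (p : P) (z : ℤ) :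
    entryAt A ε e p z = signAt T step p (z - 1) - signAt T step p z := by
  unfold signAt
  rw [sub_add_cancel]
  by_cases hz : T z
  · have : ¬ ∃ x, e x = z := by
      rintro ⟨x, rfl⟩
      exact h.not_top x hz
    rw [entryAt, dif_neg this, if_pos hz, if_neg (h.sep z hz).1, sub_self]
  · obtain ⟨x, rfl⟩ := h.exists_eq z hz
    rw [h.entryAt_apply, if_neg hz]
    split_ifs with hT
    · have := h.sign_sub p _ _ _ (Or.inr (Or.inr (Or.inl ⟨hT, rfl, rfl⟩)))
      omega
    · have := h.sign_sub p _ _ _ (Or.inl ⟨hT, rfl, rfl⟩)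
      omega

theorem sum_entryAt (h : IsLinearModel A ε T e step) (p : P) {u w : ℤ} (huw : u < w) :
    ∑ z ∈ Finset.Ioo u w, entryAt A ε e p z =
      signAt T step p u - signAt T step p (w - 1) := by
  induction w, Int.add_one_le_iff.2 huw using Int.leInduction with
  | base =>
    have : Finset.Ioo u (u + 1) = ∅ := by ext; simp
    simp [this]
  | succ w hw ih =>
    have : Finset.Ioo u (w + 1) = insert w (Finset.Ioo u w) := by ext; simp; omega
    rw [this, Finset.sum_insert (by simp), ih (by omega), h.entryAt_eq_sub, add_sub_cancel_right]
    ring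

/-- After telescoping, the sum is the sign just after adding `a` minus the sign just before adding
`b`, that is `-1 - 1`. -/
theorem sum_Ioo (h : IsLinearModel A ε T e step) {a b : E} (hab : a < b) (hl : ε a = ε b) :
    ∑ᶠ c ∈ Set.Ioo a b, A (ε a) (ε c) = -2 := by
  have huw : e a < e b := by
    have h1 := ((h.le_iff _ _).1 hab.le).1
    have h2 : e a ≠ e b := fun h' => hab.ne (h.inj h')
    omega
  have h1 : ∑ᶠ c ∈ Set.Ioo a b, A (ε a) (ε c) =
      ∑ᶠ z ∈ e '' Set.Ioo a b, entryAt A ε e (ε a) z := by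
    rw [finsum_mem_image h.inj.injOn]
    simp only [h.entryAt_apply]
  -- An element numbered between `a` and `b` but outside the interval is incomparable to `a` or `b`,
  -- hence contributes a zero entry; so do the skipped numbers.
  have h2 : ∑ᶠ z ∈ e '' Set.Ioo a b, entryAt A ε e (ε a) z =
      ∑ᶠ z ∈ (Finset.Ioo (e a) (e b) : Set ℤ), entryAt A ε e (ε a) z := by
    refine finsum_mem_inter_support_eq _ _ _ ?_
    ext z
    constructor
    · rintro ⟨⟨x, hx, rfl⟩, hs⟩
      refine ⟨?_, hs⟩
      have h3 := (h.le_iff _ _).1 hx.1.le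
      have h4 := (h.le_iff _ _).1 hx.2.le
      have h5 : e a ≠ e x := fun h' => hx.1.ne (h.inj h')
      have h6 : e x ≠ e b := fun h' => hx.2.ne (h.inj h')
      simp
      omega
    · rintro ⟨hz, hs⟩
      refine ⟨?_, hs⟩
      have hT : ¬ T z := by
        intro hT
        refine hs ?_
        rw [entryAt, dif_neg]
        rintro ⟨x, rfl⟩
        exact h.not_top x hT
      obtain ⟨x, rfl⟩ := h.exists_eq z hT
      have hs : A (ε a) (ε x) ≠ 0 := by rw [← h.entryAt_apply]; exact hs
      rw [Finset.mem_coe, Finset.mem_Ioo] at hz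
      refine ⟨x, ⟨?_, ?_⟩, rfl⟩
      · rcases h.comparable a x (h.conc_of_ne_zero hs).1 with h3 | h3
        · exact lt_of_le_of_ne h3 fun h' => by rw [h'] at hz; omega
        · have := ((h.le_iff _ _).1 h3).1
          omega
      · rcases h.comparable x b (hl ▸ (h.conc_of_ne_zero hs).2) with h3 | h3
        · exact lt_of_le_of_ne h3 fun h' => by rw [h'] at hz; omega
        · have := ((h.le_iff _ _).1 h3).1
          omega
  rw [h1, h2, finsum_mem_coe_finset, h.sum_entryAt _ huw]
  have h3 : signAt T step (ε a) (e a) = -1 := by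
    unfold signAt
    split_ifs with hT
    · exact h.sign_right (Or.inr (Or.inr (Or.inl ⟨hT, rfl, rfl⟩)))
    · exact h.sign_right (Or.inl ⟨hT, rfl, rfl⟩)
  have h4 : signAt T step (ε a) (e b - 1) = 1 := by
    unfold signAt
    rw [sub_add_cancel, if_neg (h.not_top b), hl]
    by_cases hT : T (e b + 1)
    · exact h.sign_left (Or.inr (Or.inr (Or.inl ⟨hT, rfl, rfl⟩)))
    · exact h.sign_left (Or.inl ⟨hT, rfl, rfl⟩)
  rw [h3, h4]
  rfl

theorem isFullHeap (h : IsLinearModel A ε T e step) : IsFullHeap A ε where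
  toIsFibredHeap := h.isFibredHeap
  gcm := h.gcm
  sum_eq _ _ hab hl _ := h.sum_Ioo hab hl

/-- The numbering of the proper ideals. -/
noncomputable def zeta (h : IsLinearModel A ε T e step) : ProperIdeal ε ≃ ℤ :=
  (Equiv.ofBijective (fun z => (⟨cut T e z, h.isProperIdeal_cut z⟩ : ProperIdeal ε))
    ⟨fun _ _ hzw => h.cut_injective (congrArg Subtype.val hzw), fun ⟨I, hI⟩ => by
      obtain ⟨z, hz⟩ := (h.isProperIdeal_iff I).1 hI
      exact ⟨z, Subtype.ext hz.symm⟩⟩).symm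

theorem coe_zeta_symm (h : IsLinearModel A ε T e step) (z : ℤ) :
    (h.zeta.symm z : Set E) = cut T e z := rfl

theorem cut_zeta (h : IsLinearModel A ε T e step) (I : ProperIdeal ε) :
    cut T e (h.zeta I) = I.1 := by
  rw [← h.coe_zeta_symm, Equiv.symm_apply_apply]

theorem zeta_eq_iff (h : IsLinearModel A ε T e step) (I : ProperIdeal ε) (z : ℤ) :
    h.zeta I = z ↔ I.1 = cut T e z := by
  rw [← h.cut_zeta I, h.cut_injective.eq_iff]

theorem le_iff_zeta_le (h : IsLinearModel A ε T e step) (hT : ∀ z, ¬ T z) (I J : ProperIdeal ε) :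
    I ≤ J ↔ h.zeta I ≤ h.zeta J := by
  rw [← Subtype.coe_le_coe, ← h.cut_zeta I, ← h.cut_zeta J, h.cut_subset_iff]
  simp [hT]

/-- Inclusion misses `≤` on numbers exactly at the pairs supplied by `R`, so the union of the two
relations is already the total order and one step suffices. -/
theorem refinedLE_iff (h : IsLinearModel A ε T e step) {R : Set E → Set E → Prop}
    (hR : ∀ z w, R (cut T e z) (cut T e w) ↔ w = z + 1 ∧ T (w + 1)) (I J : ProperIdeal ε) :
    RefinedLE ε R I J ↔ h.zeta I ≤ h.zeta J := by
  have key : ∀ I J : ProperIdeal ε, (I ≤ J ∨ R I.1 J.1) ↔ h.zeta I ≤ h.zeta J := by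
    intro I J
    rw [← Subtype.coe_le_coe, ← h.cut_zeta I, ← h.cut_zeta J, h.cut_subset_iff,
      hR]
    constructor
    · omega
    · intro h'
      by_cases h'' : h.zeta J = h.zeta I + 1 ∧ T (h.zeta J + 1)
      · exact Or.inr h''
      · exact Or.inl ⟨h', h''⟩
  constructor
  · intro hIJ
    induction hIJ with
    | refl => exact le_rfl
    | tail _ h2 ih => exact ih.trans ((key _ _).1 h2)
  · intro hIJ
    exact Relation.ReflTransGen.single ((key _ _).2 hIJ)

/-- All edges labelled `i` have the same increment under `f`, so moving by `step i` changes `f` by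
the sign at `z` times that increment. Differencing along an edge labelled `j` turns the signs into
`-A i j`. -/
theorem isReflectionModel (h : IsLinearModel A ε T e step) {F : (ℤ → ℤ) → Prop} {a b : P → ℤ}
    (hprod : ∀ i j, i ≠ j → A i j * A j i ≤ 2) (hid : F id)
    (hcomp : ∀ f i, F f → F (f ∘ step i)) (hedge : ∀ j, ∃ x, ε x = j ∧ CutEdge T e x (a j) (b j))
    (hsub : ∀ f x z w, F f → CutEdge T e x z w → f w - f z = f (b (ε x)) - f (a (ε x)))
    (hext : ∀ f g, F f → F g → (∀ j, f (b j) - f (a j) = g (b j) - g (a j)) → f = g) :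
    IsReflectionModel A step F a b where
  gcm := h.gcm
  prod_le := hprod
  id_mem := hid
  comp_mem := hcomp
  lt j := by
    obtain ⟨x, -, hx⟩ := hedge j
    exact hx.lt
  ext := hext
  comp_sub f i j hf := by
    have key : ∀ z, f (step i z) = f z + Int.sign (step i z - z) * (f (b i) - f (a i)) := by
      intro z
      by_cases hz : step i z = z
      · simp [hz]
      · obtain ⟨x, rfl, hE | hE⟩ := h.edge_step i z hz
        · rw [h.sign_left hE, ← hsub f x _ _ hf hE]; ring
        · rw [h.sign_right hE, ← hsub f x _ _ hf hE]; ring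
    obtain ⟨x, rfl, hE⟩ := hedge j
    have := h.sign_sub i _ _ _ hE
    rw [key, key, ← neg_eq_iff_eq_neg.2 this]
    ring

theorem realizesWeylGroup (h : IsLinearModel A ε T e step) {F : (ℤ → ℤ) → Prop} {a b : P → ℤ}
    (hF : IsReflectionModel A step F a b) {N : ℤ} (hN : ∀ f z, F f → f (z + N) = f z + N) :
    RealizesWeylGroup A ε h.zeta N step := by
  let c : Equiv.Perm ℤ ≃* Equiv.Perm (ProperIdeal ε) := h.zeta.symm.permCongrHom
  refine ⟨c.toMonoidHom.comp hF.action, hF.action, ?_, ?_, ?_, hF.action_injective,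
    hF.action_weylGen, fun w z => hN _ z (hF.action_mem w)⟩
  · intro i I
    have : c (hF.action (weylGen A i)) I = h.zeta.symm (step i (h.zeta I)) := by
      rw [← hF.action_weylGen]; rfl
    change ((c (hF.action (weylGen A i)) I : ProperIdeal ε) : Set E) = _
    rw [this, h.coe_zeta_symm, ← h.reflectIdeal_cut, h.cut_zeta]
  · exact c.injective.comp hF.action_injective
  · intro w I
    change _ = h.zeta (h.zeta.symm (hF.action w (h.zeta I)))
    rw [Equiv.apply_symm_apply]

end IsLinearModel

end LinearModel

/-! ### Arithmetic modulo `N` -/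

/-- Trades congruences in a bounded window for equalities, which linear arithmetic can decide. -/
theorem modEq_iff_of_lt {N z c : ℤ} (h1 : z - c < 2 * N) (h2 : -(2 * N) < z - c) :
    z ≡ c [ZMOD N] ↔ z = c ∨ z = c + N ∨ z = c - N := by
  rw [Int.modEq_comm, Int.modEq_iff_dvd]
  constructor
  · rintro ⟨k, hk⟩
    have h3 : k < 2 := by nlinarith
    have h4 : -2 < k := by nlinarith
    obtain rfl | rfl | rfl : k = -1 ∨ k = 0 ∨ k = 1 := by omega
    all_goals omega
  · rintro (h | h | h)
    · exact ⟨0, by linarith⟩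
    · exact ⟨1, by linarith⟩
    · exact ⟨-1, by linarith⟩

theorem exists_of_modEq {N z c : ℤ} (h : z ≡ c [ZMOD N]) : ∃ k, z = N * k + c := by
  obtain ⟨k, hk⟩ := (Int.modEq_iff_dvd.1 h.symm)
  exact ⟨k, by linarith⟩

theorem apply_mul_add {f : ℤ → ℤ} {N : ℤ} (h : ∀ z, f (z + N) = f z + N) (k z : ℤ) :
    f (N * k + z) = N * k + f z := by
  induction k using Int.induction_on with
  | zero => simp
  | succ i ih =>
    rw [show N * ((i : ℤ) + 1) + z = N * i + z + N by ring, h, ih]; ring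
  | pred i ih =>
    have := h (N * (-(i : ℤ) - 1) + z)
    rw [show N * (-(i : ℤ) - 1) + z + N = N * -(i : ℤ) + z by ring, ih] at this
    linarith

theorem mul_add_modEq {N k z c : ℤ} : N * k + z ≡ c [ZMOD N] ↔ z ≡ c [ZMOD N] := by
  simp [Int.ModEq]

theorem add_self_modEq {N z c : ℤ} : z + N ≡ c [ZMOD N] ↔ z ≡ c [ZMOD N] := by
  simp [Int.ModEq]

theorem modEq_sub_self {N z c : ℤ} : z ≡ c - N [ZMOD N] ↔ z ≡ c [ZMOD N] := by
  simp [Int.ModEq]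

theorem exists_eq_mul_add {N : ℤ} (hN : 0 < N) (m z : ℤ) :
    ∃ k r, z = N * k + r ∧ m ≤ r ∧ r < m + N := by
  refine ⟨(z - m) / N, (z - m) % N + m, ?_, ?_, ?_⟩
  · have := Int.mul_ediv_add_emod (z - m) N
    linarith
  · have := Int.emod_nonneg (z - m) hN.ne'
    omega
  · have := Int.emod_lt_of_pos (z - m) hN
    omega

theorem exists_mul_add_lt {N : ℤ} (hN : 0 < N) (z : ℤ) : ∃ k, N * k + N < z := by
  obtain ⟨k, r, rfl, h0, h1⟩ := exists_eq_mul_add hN 0 z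
  exact ⟨k - 2, by linarith⟩

theorem exists_lt_mul {N : ℤ} (hN : 0 < N) (z : ℤ) : ∃ k, z < N * k := by
  obtain ⟨k, r, rfl, h0, h1⟩ := exists_eq_mul_add hN 0 z
  exact ⟨k + 1, by linarith⟩

/-- Makes comparison of `N * k + c` linear: distinct `k` differ by at least a full period, for the
numbers (`N`) and the ranks (`M`) at once. Where ranks play no role, `M = 1` is a dummy. -/
theorem mul_trichotomy {N M : ℤ} (hN : 0 < N) (hM : 0 < M) (k k' : ℤ) :
    (k < k' ∧ N * k + N ≤ N * k' ∧ M * k + M ≤ M * k') ∨ k = k' ∨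
      (k' < k ∧ N * k' + N ≤ N * k ∧ M * k' + M ≤ M * k) := by
  rcases lt_trichotomy k k' with h | h | h
  · exact Or.inl ⟨h, by nlinarith, by nlinarith⟩
  · exact Or.inr (Or.inl h)
  · exact Or.inr (Or.inr ⟨h, by nlinarith, by nlinarith⟩)

theorem sign_ite_two {z d : ℤ} (hd : 0 < d) (p q : Prop) [Decidable p] [Decidable q] :
    Int.sign ((if p then z + d else if q then z - d else z) - z) =
      if p then 1 else if q then -1 else 0 := by
  split_ifs
  · rw [Int.sign_eq_one_iff_pos]; omega
  · rw [Int.sign_eq_neg_one_iff_neg]; omega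
  · simp

theorem HeapElt.le_iff {l : ℕ} {rk : ℕ → ℤ → ℤ} (x y : HeapElt l rk) :
    x ≤ y ↔ x = y ∨ x.rank < y.rank := Iff.rfl

theorem HeapElt.ext_iff' {l : ℕ} {rk : ℕ → ℤ → ℤ} (x y : HeapElt l rk) :
    x = y ↔ (x.label : ℕ) = y.label ∧ x.index = y.index := by
  cases x
  cases y
  simp [Fin.ext_iff]

theorem HeapElt.el_label {l : ℕ} {rk : ℕ → ℤ → ℤ} {p : ℕ} (hp : p ≤ l) (y : ℤ) :
    ((el p y : HeapElt l rk).label : ℕ) = p := by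
  simp only [el, Fin.val_ofNat]
  exact Nat.mod_eq_of_lt (by omega)

theorem HeapElt.el_index {l : ℕ} {rk : ℕ → ℤ → ℤ} (p : ℕ) (y : ℤ) :
    (el p y : HeapElt l rk).index = y := rfl

/-- A rank preserving shift of the indices is an automorphism. -/
theorem isPeriodicHeap_of_shift {l : ℕ} {rk : ℕ → ℤ → ℤ} (t : ℕ → ℤ) {M : ℤ}
    (hM : 0 < M) (h : ∀ p y, rk p (y + t p) = rk p y + M) :
    IsPeriodicHeap (HeapElt.label : HeapElt l rk → Fin (l + 1)) := by
  let φ : HeapElt l rk ≃ HeapElt l rk :=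
    { toFun := fun x => ⟨x.label, x.index + t x.label⟩
      invFun := fun x => ⟨x.label, x.index - t x.label⟩
      left_inv := fun x => by simp
      right_inv := fun x => by simp }
  have hr : ∀ x, (φ x).rank = x.rank + M := fun x => h x.label x.index
  refine ⟨⟨φ, fun {x y} => ?_⟩, fun x => rfl, fun x => ?_, el 0 0, fun h0 => ?_⟩
  · rw [HeapElt.le_iff, HeapElt.le_iff, φ.injective.eq_iff, hr, hr, add_lt_add_iff_right]
  · refine (HeapElt.le_iff _ _).2 (Or.inr ?_)
    change _ < (φ x).rank
    rw [hr]
    omega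
  · have h1 := hr (el 0 0)
    change φ (el 0 0) = el 0 0 at h0
    rw [h0] at h1
    omega

/-- A reflection of the indices which negates the rank is an isomorphism to the dual. -/
theorem isSelfDualHeap_of_reflection {l : ℕ} {rk : ℕ → ℤ → ℤ} (t : ℕ → ℤ)
    (h : ∀ p y, rk p (t p - y) = -rk p y) :
    IsSelfDualHeap (HeapElt.label : HeapElt l rk → Fin (l + 1)) := by
  let φ : HeapElt l rk ≃ (HeapElt l rk)ᵒᵈ :=
    { toFun := fun x => OrderDual.toDual ⟨x.label, t x.label - x.index⟩
      invFun := fun x => ⟨(OrderDual.ofDual x).label,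
        t (OrderDual.ofDual x).label - (OrderDual.ofDual x).index⟩
      left_inv := fun x => by simp
      right_inv := fun x => by
        obtain ⟨x, rfl⟩ := OrderDual.toDual.surjective x
        simp }
  have hr : ∀ x, (OrderDual.ofDual (φ x)).rank = - x.rank := fun x => h x.label x.index
  refine ⟨⟨φ, fun {x y} => ?_⟩, fun x => rfl⟩
  rw [← OrderDual.ofDual_le_ofDual, HeapElt.le_iff, HeapElt.le_iff, hr, hr, neg_lt_neg_iff,
    OrderDual.ofDual_inj, φ.injective.eq_iff, eq_comm]

/-! ### Type `A_l^(1)` -/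

section TypeA

variable {l : ℕ}

/-- The numbering of the elements of the heap of type `A_l^(1)`. -/
def numA (x : HeapA l) : ℤ := zetaA l x.label x.index

theorem stepA_add (j : Fin (l + 1)) (z : ℤ) :
    stepA l j (z + (l + 1)) = stepA l j z + (l + 1) := by
  simp only [stepA, add_self_modEq]
  split_ifs <;> ring

theorem sign_stepA (j : Fin (l + 1)) (z : ℤ) : Int.sign (stepA l j z - z) =
    if z ≡ (j : ℤ) [ZMOD (l + 1)] then 1 else if z ≡ (j : ℤ) + 1 [ZMOD (l + 1)] then -1 else 0 :=
  sign_ite_two one_pos _ _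

theorem fin_add_one_eq_iff (hl : 1 < l) (i j : Fin (l + 1)) :
    i + 1 = j ↔ (i : ℕ) + 1 = j ∨ ((i : ℕ) = l ∧ (j : ℕ) = 0) := by
  have h1 : ((i + 1 : Fin (l + 1)) : ℕ) = if (i : ℕ) = l then 0 else (i : ℕ) + 1 := by
    rw [Fin.val_add_one]
    simp [Fin.ext_iff]
  rw [Fin.ext_iff, h1]
  have := j.isLt
  split_ifs <;> omega

theorem numA_eq (x : HeapA l) : numA x = x.rank + 1 := by
  simp [numA, zetaA, HeapElt.rank, rankA]

theorem numA_injective : Function.Injective (numA (l := l)) := by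
  intro x y hxy
  rw [HeapElt.ext_iff']
  simp only [numA, zetaA] at hxy
  have := x.label.isLt
  have := y.label.isLt
  rcases mul_trichotomy (N := l + 1) (M := 1) (by omega) (by omega) x.index y.index with h | h | h
  · omega
  · rw [h] at hxy ⊢; omega
  · omega

theorem cutEdgeA_iff {x : HeapA l} {z w : ℤ} : CutEdge (fun _ => False) numA x z w ↔
    z = (l + 1) * x.index + x.label ∧ w = (l + 1) * x.index + (x.label + 1) := by
  simp only [CutEdge, numA, zetaA, not_false_eq_true, true_and, false_and, or_false]
  omega

theorem isLinearModelA (hl : 1 < l) :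
    IsLinearModel (cartanA l) (labelA l) (fun _ => False) numA (stepA l) where
  gcm := by
    constructor
    · intro i; simp [cartanA]
    · intro i j hij
      simp only [cartanA, if_neg hij]
      split_ifs <;> simp
    · intro i j
      simp only [cartanA, eq_comm (a := j) (b := i), or_comm (a := j + 1 = i)]
  inj := numA_injective
  exists_eq z _ := by
    obtain ⟨k, r, rfl, h1, h2⟩ := exists_eq_mul_add (N := l + 1) (by omega) 1 z
    refine ⟨el (r - 1).toNat k, ?_⟩
    simp only [numA, zetaA]
    rw [HeapElt.el_label (by omega), HeapElt.el_index]
    omega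
  not_top x := id
  le_iff x y := by
    have h1 := numA_eq x
    have h2 := numA_eq y
    have h3 := @numA_injective l x y
    have h4 : x = y → numA x = numA y := congrArg _
    rw [HeapElt.le_iff]
    simp only [and_false, not_false_eq_true, and_true]
    constructor
    · rintro (h | h)
      · exact (h4 h).le
      · omega
    · intro h
      rcases h.eq_or_lt with h | h
      · exact Or.inl (h3 h)
      · exact Or.inr (by omega)
  sep z := False.elim
  below p z := by
    refine ⟨⟨p, z / (l + 1) - 2⟩, rfl, ?_⟩
    have h1 := Int.mul_ediv_add_emod z (l + 1)
    have h2 := Int.emod_nonneg z (b := l + 1) (by omega)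
    have h3 := p.isLt
    simp only [numA, zetaA, mul_sub]
    omega
  above p z := by
    refine ⟨⟨p, z / (l + 1) + 1⟩, rfl, ?_⟩
    have h1 := Int.mul_ediv_add_emod z (l + 1)
    have h2 := Int.emod_lt_of_pos z (b := l + 1) (by omega)
    simp only [numA, zetaA, mul_add]
    omega
  step_edge x z w := by
    intro h
    obtain ⟨rfl, rfl⟩ := cutEdgeA_iff.1 h
    have hp := x.label.isLt
    change stepA l x.label _ = _ ∧ stepA l x.label _ = _
    rw [apply_mul_add (stepA_add _), apply_mul_add (stepA_add _)]
    simp (disch := omega) only [stepA, modEq_iff_of_lt, true_or]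
    constructor <;> split_ifs <;> omega
  edge_step i z := by
    have key : ∀ k : ℤ, CutEdge (fun _ => False) numA (⟨i, k⟩ : HeapA l) ((l + 1) * k + i)
        ((l + 1) * k + (i + 1)) := fun k => cutEdgeA_iff.2 ⟨rfl, rfl⟩
    have hi := i.isLt
    have hs : ∀ k : ℤ, stepA l i ((l + 1) * k + i) = (l + 1) * k + (i + 1) ∧
        stepA l i ((l + 1) * k + (i + 1)) = (l + 1) * k + i := by
      intro k
      rw [apply_mul_add (stepA_add _), apply_mul_add (stepA_add _)]
      simp (disch := omega) only [stepA, modEq_iff_of_lt, true_or]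
      constructor <;> split_ifs <;> omega
    intro hz
    by_cases h1 : z ≡ (i : ℤ) [ZMOD (l + 1)]
    · obtain ⟨k, rfl⟩ := exists_of_modEq h1
      exact ⟨⟨i, k⟩, rfl, Or.inl (by rw [(hs k).1]; exact key k)⟩
    · by_cases h2 : z ≡ (i : ℤ) + 1 [ZMOD (l + 1)]
      · obtain ⟨k, rfl⟩ := exists_of_modEq h2
        exact ⟨⟨i, k⟩, rfl, Or.inr (by rw [(hs k).2]; exact key k)⟩
      · exact absurd (by rw [stepA, if_neg h1, if_neg h2]) hz
  sign_sub i x z w := by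
    intro h
    obtain ⟨rfl, rfl⟩ := cutEdgeA_iff.1 h
    have hp := x.label.isLt
    have hi := i.isLt
    change _ = -cartanA l i x.label
    simp only [sign_stepA, mul_add_modEq]
    simp (disch := omega) only [modEq_iff_of_lt, cartanA, fin_add_one_eq_iff hl, Fin.ext_iff]
    split_ifs <;> omega

/-- The affine permutations, as functions normalised by the sum over a period. -/
def IsAffineA (l : ℕ) (f : ℤ → ℤ) : Prop :=
  (∀ z, f (z + (l + 1)) = f z + (l + 1)) ∧
    ∑ z ∈ Finset.Icc (1 : ℤ) (l + 1), f z = ∑ z ∈ Finset.Icc (1 : ℤ) (l + 1), z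

/-- In the window `1, ..., l + 1` only two terms change, and their changes cancel. For `i = 0` the
two positions are the ends of the window, and the cancellation uses the translation property. -/
theorem isAffineA_comp_stepA (hl : 1 < l) {f : ℤ → ℤ} (hf : IsAffineA l f) (i : Fin (l + 1)) :
    IsAffineA l (f ∘ stepA l i) := by
  refine ⟨fun z => by simp [stepA_add, hf.1], ?_⟩
  have hi := i.isLt
  rw [← hf.2, ← sub_eq_zero, ← Finset.sum_sub_distrib]
  -- The representative of `i` modulo `l + 1` in the window.
  let a : ℤ := if (i : ℤ) = 0 then l + 1 else i
  have ha : (a = l + 1 ∧ (i : ℤ) = 0) ∨ (a = i ∧ (i : ℤ) ≠ 0) := by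
    simp only [a]
    split_ifs with h
    · exact Or.inl ⟨rfl, h⟩
    · exact Or.inr ⟨rfl, h⟩
  generalize a = a at ha
  have hs : ∀ z ∈ Finset.Icc (1 : ℤ) (l + 1), stepA l i z =
      if z = a then z + 1 else if z = i + 1 then z - 1 else z := by
    intro z hz
    rw [Finset.mem_Icc] at hz
    simp (disch := omega) only [stepA, modEq_iff_of_lt]
    split_ifs <;> omega
  rw [Finset.sum_eq_add (a := a) (b := i + 1) (by omega)]
  · have e1 := hs a (by rw [Finset.mem_Icc]; omega)
    have e2 := hs (i + 1) (by rw [Finset.mem_Icc]; omega)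
    rw [if_pos rfl] at e1
    rw [if_neg (by omega), if_pos rfl] at e2
    simp only [Function.comp_apply, e1, e2]
    rcases ha with ⟨rfl, h0⟩ | ⟨rfl, h0⟩
    · have e3 := hf.1 0
      have e4 := hf.1 1
      rw [show (0 : ℤ) + (l + 1) = l + 1 by ring] at e3
      rw [show (1 : ℤ) + (l + 1) = l + 1 + 1 by ring] at e4
      rw [h0, e3, e4]
      simp
    · rw [add_sub_cancel_right]
      ring
  · intro c hc hne
    simp [hs c hc, hne.1, hne.2]
  · intro h; rw [Finset.mem_Icc] at h; omega
  · intro h; rw [Finset.mem_Icc] at h; omega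

/-- Increments over a period determine `f` up to an additive constant, which the normalised sum
removes. -/
theorem isAffineA_ext (f g : ℤ → ℤ) (hf : IsAffineA l f) (hg : IsAffineA l g)
    (h : ∀ j : Fin (l + 1), f (j + 1) - f j = g (j + 1) - g j) : f = g := by
  have h1 : ∀ n : ℕ, n ≤ l + 1 → f n - g n = f 0 - g 0 := by
    intro n
    induction n with
    | zero => simp
    | succ n ih =>
      intro hn
      have := h ⟨n, hn⟩
      have := ih (by omega)
      push_cast at *
      omega
  have h2 : ∀ z, f z - g z = f 0 - g 0 := by
    intro z
    obtain ⟨k, r, rfl, hr0, hr⟩ := exists_eq_mul_add (N := l + 1) (by omega) 0 z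
    have := h1 r.toNat (by omega)
    rw [Int.toNat_of_nonneg hr0] at this
    rw [apply_mul_add hf.1, apply_mul_add hg.1]
    omega
  have h3 : ∑ z ∈ Finset.Icc (1 : ℤ) (l + 1), (f z - g z) = 0 := by
    rw [Finset.sum_sub_distrib, hf.2, hg.2, sub_self]
  simp only [h2, Finset.sum_const, Int.card_Icc, nsmul_eq_mul, mul_eq_zero] at h3
  ext z
  have := h2 z
  omega

theorem isReflectionModelA (hl : 1 < l) :
    IsReflectionModel (cartanA l) (stepA l) (IsAffineA l) (fun j => j) (fun j => j + 1) := by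
  refine (isLinearModelA hl).isReflectionModel ?_ ⟨fun z => rfl, rfl⟩
    (fun f i hf => isAffineA_comp_stepA hl hf i)
    (fun j => ⟨⟨j, 0⟩, rfl, cutEdgeA_iff.2 ⟨by simp, by simp⟩⟩) ?_ isAffineA_ext
  · intro i j hij
    simp only [cartanA, if_neg hij, if_neg hij.symm]
    split_ifs <;> simp
  · intro f x z w hf h
    obtain ⟨rfl, rfl⟩ := cutEdgeA_iff.1 h
    rw [apply_mul_add hf.1, apply_mul_add hf.1]
    simp only [labelA]
    ring

end TypeA

/-! ### Affine permutations commuting with `z ↦ 1 - z` -/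

/-- The affine signed permutations of period `2l`. -/
def IsAffineSigned (l : ℕ) (f : ℤ → ℤ) : Prop :=
  (∀ z, f (z + 2 * l) = f z + 2 * l) ∧ ∀ z, f (1 - z) = 1 - f z

theorem IsAffineSigned.comp {l : ℕ} {f g : ℤ → ℤ} (hf : IsAffineSigned l f)
    (hg : IsAffineSigned l g) : IsAffineSigned l (f ∘ g) :=
  ⟨fun z => by simp [hg.1, hf.1], fun z => by simp [hg.2, hf.2]⟩

theorem isAffineSigned_id (l : ℕ) : IsAffineSigned l id := ⟨fun _ => rfl, fun _ => rfl⟩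

/-- The window from `1 - l` to `l` is a full period, and `z ↦ 1 - z` exchanges its halves. -/
theorem IsAffineSigned.ext {l : ℕ} (hl : 0 < l) {f g : ℤ → ℤ} (hf : IsAffineSigned l f)
    (hg : IsAffineSigned l g) (h : ∀ z : ℤ, 1 ≤ z → z ≤ l → f z = g z) : f = g := by
  have h' : ∀ z : ℤ, 1 - l ≤ z → z ≤ l → f z = g z := by
    intro z h1 h2
    by_cases h3 : 1 ≤ z
    · exact h z h3 h2
    · have h4 := h (1 - z) (by omega) (by omega)
      rw [hf.2, hg.2] at h4
      omega
  ext z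
  obtain ⟨k, r, rfl, hr0, hr⟩ := exists_eq_mul_add (N := 2 * l) (by omega) (1 - l) z
  rw [apply_mul_add hf.1, apply_mul_add hg.1, h' r hr0 (by omega)]

/-- If two functions have the same increments from `m` to `n`, their difference is constant. -/
theorem sub_eq_sub_of_increments {f g : ℤ → ℤ} {m n : ℤ}
    (h : ∀ z, m ≤ z → z < n → f (z + 1) - f z = g (z + 1) - g z) (z : ℤ) (hm : m ≤ z)
    (hn : z ≤ n) : f z - g z = f m - g m := by
  induction z, hm using Int.leInduction with
  | base => rfl
  | succ z hz ih =>
    have := h z hz (by omega)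
    have := ih (by omega)
    omega

/-- The reflection of `ℤ` interchanging `a` with `b` and `1 - b` with `1 - a`, modulo `2l`. -/
def swapStep (l : ℕ) (a b z : ℤ) : ℤ :=
  if z ≡ a [ZMOD (2 * l)] ∨ z ≡ 1 - b [ZMOD (2 * l)] then z + (b - a)
  else if z ≡ b [ZMOD (2 * l)] ∨ z ≡ 1 - a [ZMOD (2 * l)] then z - (b - a)
  else z

theorem one_sub_modEq {N z c : ℤ} : 1 - z ≡ c [ZMOD N] ↔ z ≡ 1 - c [ZMOD N] := by
  rw [Int.modEq_iff_dvd, Int.modEq_iff_dvd, ← dvd_neg]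
  ring_nf

/-! ### Reflections of `ℤ` modulo `2l`. -/

section swapStep

variable {l : ℕ} {a b : ℤ}

theorem ite_eq_swapStep {z d : ℤ} {p q : Prop} [Decidable p] [Decidable q]
    (hp : p ↔ z ≡ a [ZMOD (2 * l)] ∨ z ≡ 1 - b [ZMOD (2 * l)])
    (hq : q ↔ z ≡ b [ZMOD (2 * l)] ∨ z ≡ 1 - a [ZMOD (2 * l)]) (hd : d = b - a) :
    (if p then z + d else if q then z - d else z) = swapStep l a b z := by
  subst hd
  simp only [swapStep, hp, hq]

/-- `z - (1 - z)` is odd and the modulus even: the mirror `z ↦ 1 - z` fixes no residue class. -/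
theorem not_modEq_one_sub (l : ℕ) (z : ℤ) : ¬ z ≡ 1 - z [ZMOD (2 * l)] := by
  rw [Int.modEq_iff_dvd]
  rintro ⟨k, hk⟩
  have : 1 = 2 * (l * k + z) := by linarith
  omega

theorem not_modEq_of_lt (hab : a < b) (hb : b < a + 2 * l) : ¬ a ≡ b [ZMOD (2 * l)] := by
  rw [modEq_iff_of_lt (by omega) (by omega)]
  omega

/-- Classes moved up are never moved down, so the order of the tests in `swapStep` is harmless and
the map is an involution. -/
theorem swapStep_up (hab : a < b) (hb : b < a + 2 * l) {z : ℤ}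
    (hz : z ≡ a [ZMOD (2 * l)] ∨ z ≡ 1 - b [ZMOD (2 * l)]) :
    ¬ (z ≡ b [ZMOD (2 * l)] ∨ z ≡ 1 - a [ZMOD (2 * l)]) := by
  have h1 := not_modEq_of_lt hab hb
  have h2 := not_modEq_one_sub l a
  have h3 := not_modEq_one_sub l b
  rintro (h | h) <;> rcases hz with h' | h'
  · exact h1 (h'.symm.trans h)
  · exact h3 (h.symm.trans h')
  · exact h2 (h'.symm.trans h)
  · refine h1 ?_
    have := (h.symm.trans h').sub (Int.ModEq.refl 1)
    simpa using this.neg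

theorem swapStep_add (z : ℤ) : swapStep l a b (z + 2 * l) = swapStep l a b z + 2 * l := by
  simp only [swapStep, add_self_modEq]
  split_ifs <;> ring

theorem isAffineSigned_swapStep (hab : a < b) (hb : b < a + 2 * l) :
    IsAffineSigned l (swapStep l a b) := by
  refine ⟨swapStep_add, fun z => ?_⟩
  have h := swapStep_up hab hb (z := z)
  simp only [swapStep, one_sub_modEq, sub_sub_cancel]
  simp only [or_comm (a := z ≡ 1 - a [ZMOD (2 * l)]) (b := z ≡ b [ZMOD (2 * l)]),
    or_comm (a := z ≡ 1 - b [ZMOD (2 * l)]) (b := z ≡ a [ZMOD (2 * l)])]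
  by_cases h1 : z ≡ a [ZMOD (2 * l)] ∨ z ≡ 1 - b [ZMOD (2 * l)]
  · rw [if_neg (h h1), if_pos h1, if_pos h1]
    ring
  · rw [if_neg h1, if_neg h1]
    split_ifs <;> ring

theorem swapStep_of_modEq_left (hab : a < b) (hb : b < a + 2 * l) (k : ℤ) :
    swapStep l a b (2 * l * k + a) = 2 * l * k + b ∧
      swapStep l a b (2 * l * k + b) = 2 * l * k + a := by
  have h1 : swapStep l a b a = b := by
    rw [swapStep, if_pos (Or.inl (.refl _))]; ring
  have h2 : swapStep l a b b = a := by
    rw [swapStep, if_neg fun h => swapStep_up hab hb h (Or.inl rfl), if_pos (Or.inl (.refl _))]; ring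
  rw [apply_mul_add swapStep_add, apply_mul_add swapStep_add, h1, h2]
  exact ⟨rfl, rfl⟩

theorem swapStep_of_modEq_right (hab : a < b) (hb : b < a + 2 * l) (k : ℤ) :
    swapStep l a b (2 * l * k + (1 - b)) = 2 * l * k + (1 - a) ∧
      swapStep l a b (2 * l * k + (1 - a)) = 2 * l * k + (1 - b) := by
  have h := swapStep_of_modEq_left hab hb 0
  simp only [mul_zero, zero_add] at h
  have h1 := isAffineSigned_swapStep hab hb
  rw [apply_mul_add swapStep_add, apply_mul_add swapStep_add, h1.2, h1.2, h.1, h.2]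
  exact ⟨rfl, rfl⟩

theorem sign_swapStep_one_sub (hab : a < b) (hb : b < a + 2 * l) (z : ℤ) :
    Int.sign (swapStep l a b (1 - z) - (1 - z)) = - Int.sign (swapStep l a b z - z) := by
  rw [(isAffineSigned_swapStep hab hb).2, ← Int.sign_neg]
  ring_nf

theorem sign_swapStep_mul_add (k z : ℤ) :
    Int.sign (swapStep l a b (2 * l * k + z) - (2 * l * k + z)) =
      Int.sign (swapStep l a b z - z) := by
  rw [apply_mul_add swapStep_add, add_sub_add_left_eq_sub]

/-- The window from `0` to `l + 1` contains all the positions `a j` and `b j` used below, so this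
reduces every sign computation to linear arithmetic. -/
theorem sign_swapStep_cases (hl : 1 < l) (ha : 0 ≤ a) (hab : a < b) (hb : b ≤ l + 1) {z : ℤ}
    (h0 : 0 ≤ z) (h1 : z ≤ l + 1) :
    (Int.sign (swapStep l a b z - z) = 1 ∧ (z = a ∨ z = 1 - b ∨ z = 2 * l + 1 - b)) ∨
    (Int.sign (swapStep l a b z - z) = -1 ∧ (z = b ∨ z = 1 - a ∨ z = 2 * l + 1 - a)) ∨
    (Int.sign (swapStep l a b z - z) = 0 ∧ z ≠ a ∧ z ≠ 1 - b ∧ z ≠ 2 * l + 1 - b ∧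
      z ≠ b ∧ z ≠ 1 - a ∧ z ≠ 2 * l + 1 - a) := by
  rw [swapStep, sign_ite_two (by omega)]
  simp (disch := omega) only [modEq_iff_of_lt]
  split_ifs
  · exact Or.inl ⟨rfl, by omega⟩
  · exact Or.inr (Or.inl ⟨rfl, by omega⟩)
  · exact Or.inr (Or.inr ⟨rfl, by omega⟩)

end swapStep

/-- The data describing a linear model in which `step j` is the reflection interchanging `a j` and
`b j`. -/
structure IsSignedModel {P E : Type} [PartialOrder E] (A : P → P → ℤ) (ε : E → P) (T : ℤ → Prop)
    (e : E → ℤ) (l : ℕ) (a b : P → ℤ) (step : P → ℤ → ℤ) : Prop where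
  gcm : IsGCM A
  prod_le : ∀ i j, i ≠ j → A i j * A j i ≤ 2
  inj : Function.Injective e
  exists_eq : ∀ z, ¬ T z → ∃ x, e x = z
  not_top : ∀ x, ¬ T (e x)
  le_iff : ∀ x y, x ≤ y ↔ e x ≤ e y ∧ ¬ (e y = e x + 1 ∧ T (e y + 1))
  sep : ∀ z, T z → ¬ T (z + 1) ∧ ¬ T (z + 2) ∧ ¬ T (z + 3)
  pos : 0 < l
  lt : ∀ j, a j < b j
  lt_add : ∀ j, b j < a j + 2 * l
  step_eq : ∀ j, step j = swapStep l (a j) (b j)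
  edge_of : ∀ x z w, CutEdge T e x z w → ∃ k : ℤ,
    (z = 2 * l * k + a (ε x) ∧ w = 2 * l * k + b (ε x)) ∨
    (z = 2 * l * k + (1 - b (ε x)) ∧ w = 2 * l * k + (1 - a (ε x)))
  exists_edge_left : ∀ j (k : ℤ), ∃ x, ε x = j ∧
    CutEdge T e x (2 * l * k + a j) (2 * l * k + b j)
  exists_edge_right : ∀ j (k : ℤ), ∃ x, ε x = j ∧
    CutEdge T e x (2 * l * k + (1 - b j)) (2 * l * k + (1 - a j))
  sign_sub : ∀ i j, Int.sign (swapStep l (a i) (b i) (b j) - b j) -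
    Int.sign (swapStep l (a i) (b i) (a j) - a j) = - A i j
  ext_of_sub_eq : ∀ f g, IsAffineSigned l f → IsAffineSigned l g →
    (∀ j, f (b j) - f (a j) = g (b j) - g (a j)) → f = g

/-! ### From reflections modulo `2l` to linear and reflection models. -/

namespace IsSignedModel

variable {P E : Type} [PartialOrder E] {A : P → P → ℤ} {ε : E → P} {T : ℤ → Prop} {e : E → ℤ}
  {l : ℕ} {a b : P → ℤ} {step : P → ℤ → ℤ}

/-- Every edge is a translate of a base edge from `a j` to `b j` or of its mirror. The mirror
reverses the edge and negates the signs of `swapStep`, so the difference in `sign_sub` is the same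
on all of them. -/
theorem isLinearModel (h : IsSignedModel A ε T e l a b step) : IsLinearModel A ε T e step where
  gcm := h.gcm
  inj := h.inj
  exists_eq := h.exists_eq
  not_top := h.not_top
  le_iff := h.le_iff
  sep := h.sep
  below p z := by
    have := h.pos
    obtain ⟨k, hk⟩ := exists_mul_add_lt (N := 2 * l) (by omega) (z - b p)
    obtain ⟨x, hx, hE⟩ := h.exists_edge_left p k
    refine ⟨x, hx, ?_⟩
    unfold CutEdge at hE
    omega
  above p z := by
    have := h.pos
    obtain ⟨k, hk⟩ := exists_lt_mul (N := 2 * l) (by omega) (z + 1 - a p)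
    obtain ⟨x, hx, hE⟩ := h.exists_edge_left p k
    refine ⟨x, hx, ?_⟩
    unfold CutEdge at hE
    omega
  step_edge x z w hE := by
    rw [h.step_eq]
    obtain ⟨k, ⟨rfl, rfl⟩ | ⟨rfl, rfl⟩⟩ := h.edge_of x z w hE
    · exact swapStep_of_modEq_left (h.lt _) (h.lt_add _) k
    · exact swapStep_of_modEq_right (h.lt _) (h.lt_add _) k
  edge_step i z := by
    rw [h.step_eq]
    have h1 := swapStep_of_modEq_left (h.lt i) (h.lt_add i)
    have h2 := swapStep_of_modEq_right (h.lt i) (h.lt_add i)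
    intro hz
    by_cases c1 : z ≡ a i [ZMOD (2 * l)]
    · obtain ⟨k, rfl⟩ := exists_of_modEq c1
      rw [(h1 k).1]
      exact (h.exists_edge_left i k).imp fun x hx => ⟨hx.1, Or.inl hx.2⟩
    by_cases c2 : z ≡ b i [ZMOD (2 * l)]
    · obtain ⟨k, rfl⟩ := exists_of_modEq c2
      rw [(h1 k).2]
      exact (h.exists_edge_left i k).imp fun x hx => ⟨hx.1, Or.inr hx.2⟩
    by_cases c3 : z ≡ 1 - b i [ZMOD (2 * l)]
    · obtain ⟨k, rfl⟩ := exists_of_modEq c3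
      rw [(h2 k).1]
      exact (h.exists_edge_right i k).imp fun x hx => ⟨hx.1, Or.inl hx.2⟩
    by_cases c4 : z ≡ 1 - a i [ZMOD (2 * l)]
    · obtain ⟨k, rfl⟩ := exists_of_modEq c4
      rw [(h2 k).2]
      exact (h.exists_edge_right i k).imp fun x hx => ⟨hx.1, Or.inr hx.2⟩
    exact absurd (by rw [swapStep, if_neg (by tauto), if_neg (by tauto)]) hz
  sign_sub i x z w hE := by
    rw [h.step_eq, ← h.sign_sub]
    obtain ⟨k, ⟨rfl, rfl⟩ | ⟨rfl, rfl⟩⟩ := h.edge_of x z w hE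
    · rw [sign_swapStep_mul_add, sign_swapStep_mul_add]
    · rw [sign_swapStep_mul_add, sign_swapStep_mul_add,
        sign_swapStep_one_sub (h.lt i) (h.lt_add i), sign_swapStep_one_sub (h.lt i) (h.lt_add i)]
      ring

theorem isReflectionModel (h : IsSignedModel A ε T e l a b step) :
    IsReflectionModel A step (IsAffineSigned l) a b := by
  refine h.isLinearModel.isReflectionModel h.prod_le (isAffineSigned_id l) (fun f i hf => ?_)
    (fun j => ?_) (fun f x z w hf hE => ?_) h.ext_of_sub_eq
  · rw [h.step_eq]
    exact hf.comp (isAffineSigned_swapStep (h.lt i) (h.lt_add i))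
  · simpa using h.exists_edge_left j 0
  · obtain ⟨k, ⟨rfl, rfl⟩ | ⟨rfl, rfl⟩⟩ := h.edge_of x z w hE
    · rw [apply_mul_add hf.1, apply_mul_add hf.1]; ring
    · rw [apply_mul_add hf.1, apply_mul_add hf.1, hf.2, hf.2]; ring

theorem realizesWeylGroup (h : IsSignedModel A ε T e l a b step) :
    RealizesWeylGroup A ε h.isLinearModel.zeta (2 * l) step :=
  h.isLinearModel.realizesWeylGroup h.isReflectionModel fun _ z hf => hf.1 z

end IsSignedModel

/-! ### Type `C_l^(1)` -/

section TypeC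

variable {l : ℕ}

/-- The numbering of the elements of the heap of type `C_l^(1)`. -/
def numC (x : HeapC l) : ℤ := zetaC l x.label x.index

/-- The element `p(y)` has number `2lk + c`. -/
def SlotC (l p : ℕ) (y k c : ℤ) : Prop :=
  (p = 0 ∧ y = k ∧ c = 1) ∨ (p = l ∧ y = k ∧ c = l + 1) ∨
    (0 < p ∧ p < l ∧ y = 2 * k ∧ c = p + 1) ∨ (0 < p ∧ p < l ∧ y = 2 * k + 1 ∧ c = 2 * l + 1 - p)

theorem SlotC.zeta_eq (hl : 1 < l) {p : ℕ} {y k c : ℤ} (h : SlotC l p y k c) :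
    zetaC l p y = 2 * l * k + c := by
  rcases h with ⟨rfl, rfl, rfl⟩ | ⟨rfl, rfl, rfl⟩ | ⟨h1, h2, rfl, rfl⟩ | ⟨h1, h2, rfl, rfl⟩
  · simp [zetaC]
  · rw [zetaC, if_neg (by omega), if_pos rfl]; ring
  · rw [zetaC, if_neg (by omega), if_neg (by omega), if_pos (even_two_mul k)]; ring
  · rw [zetaC, if_neg (by omega), if_neg (by omega), if_neg (by simp)]; ring

theorem exists_slotC (x : HeapC l) : ∃ k c, SlotC l x.label x.index k c := by
  have := x.label.isLt
  unfold SlotC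
  rcases Int.even_or_odd' x.index with ⟨m, h | h⟩
  · by_cases hp : (x.label : ℕ) = 0 ∨ (x.label : ℕ) = l
    · exact ⟨x.index, (x.label : ℕ) + 1, by omega⟩
    · exact ⟨m, (x.label : ℕ) + 1, by omega⟩
  · by_cases hp : (x.label : ℕ) = 0 ∨ (x.label : ℕ) = l
    · exact ⟨x.index, (x.label : ℕ) + 1, by omega⟩
    · exact ⟨m, 2 * l + 1 - (x.label : ℕ), by omega⟩

theorem exists_numC (hl : 1 < l) (x : HeapC l) :
    ∃ k c, SlotC l x.label x.index k c ∧ numC x = 2 * l * k + c := by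
  obtain ⟨k, c, h⟩ := exists_slotC x
  exact ⟨k, c, h, h.zeta_eq hl⟩

theorem SlotC.exists_elt (hl : 1 < l) {p : Fin (l + 1)} {y k c : ℤ} (h : SlotC l p y k c) :
    ∃ x : HeapC l, labelC l x = p ∧ numC x = 2 * l * k + c :=
  ⟨⟨p, y⟩, rfl, h.zeta_eq hl⟩

theorem numC_eq (x : HeapC l) : numC x = x.rank + 1 := by
  simp only [numC, zetaC, HeapElt.rank, rankC]
  split_ifs <;> ring

theorem numC_injective (hl : 1 < l) : Function.Injective (numC (l := l)) := by
  intro x y hxy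
  rw [HeapElt.ext_iff']
  obtain ⟨k, c, h1, h2⟩ := exists_numC hl x
  obtain ⟨k', c', h1', h2'⟩ := exists_numC hl y
  rw [h2, h2'] at hxy
  unfold SlotC at h1 h1'
  rcases mul_trichotomy (N := 2 * l) (M := 1) (by omega) (by omega) k k' with h | rfl | h <;> omega

theorem cutEdgeC_iff {x : HeapC l} {z w : ℤ} : CutEdge (fun _ => False) numC x z w ↔
    z = numC x - 1 ∧ w = numC x := by
  simp only [CutEdge, not_false_eq_true, true_and, false_and, or_false]

theorem isGCM_cartanC (hl : 1 < l) : IsGCM (cartanC l) := by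
  constructor
  · intro i; simp [cartanC]
  · intro i j hij
    simp only [cartanC, if_neg hij]
    split_ifs <;> simp
  · intro i j
    simp only [cartanC, Fin.ext_iff]
    split_ifs <;> simp <;> omega

theorem cartanC_cases (hl : 1 < l) (i j : Fin (l + 1)) :
    (cartanC l i j = 2 ∧ (i : ℕ) = j) ∨
    (cartanC l i j = -2 ∧ (((i : ℕ) = 1 ∧ (j : ℕ) = 0) ∨ ((i : ℕ) + 1 = l ∧ (j : ℕ) = l))) ∨
    (cartanC l i j = -1 ∧ ((i : ℕ) + 1 = j ∧ (j : ℕ) ≠ l ∨ (j : ℕ) + 1 = i ∧ (j : ℕ) ≠ 0)) ∨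
    (cartanC l i j = 0 ∧ (i : ℕ) ≠ j ∧ (i : ℕ) + 1 ≠ j ∧ (j : ℕ) + 1 ≠ i) := by
  simp only [cartanC, Fin.ext_iff]
  split_ifs <;> omega

theorem exists_numC_eq (hl : 1 < l) (z : ℤ) : ∃ x : HeapC l, numC x = z := by
  obtain ⟨k, r, rfl, h1, h2⟩ := exists_eq_mul_add (N := 2 * l) (by omega) 1 z
  have hp : ∃ p y, p < l + 1 ∧ SlotC l p y k r := by
    unfold SlotC
    rcases le_or_gt r (l + 1) with h | h
    · by_cases h' : r = 1 ∨ r = l + 1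
      · exact ⟨(r - 1).toNat, k, by omega, by omega⟩
      · exact ⟨(r - 1).toNat, 2 * k, by omega, by omega⟩
    · exact ⟨(2 * l + 1 - r).toNat, 2 * k + 1, by omega, by omega⟩
  obtain ⟨p, y, hp, hs⟩ := hp
  obtain ⟨x, -, hx⟩ := SlotC.exists_elt (p := ⟨p, hp⟩) hl hs
  exact ⟨x, hx⟩

theorem stepC_eq (j : Fin (l + 1)) : stepC l j = swapStep l j (j + 1) := by
  ext z
  rw [stepC, swapStep, show (1 : ℤ) - (j + 1) = -j by ring, show (1 : ℤ) - j = -j + 1 by ring,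
    add_sub_cancel_left]

theorem exists_edgeC (hl : 1 < l) {p : Fin (l + 1)} {y k c : ℤ} (h : SlotC l p y k c) {z w : ℤ}
    (hz : z = 2 * l * k + c - 1) (hw : w = 2 * l * k + c) :
    ∃ x, labelC l x = p ∧ CutEdge (fun _ => False) numC x z w := by
  obtain ⟨x, hx, hx'⟩ := h.exists_elt hl
  exact ⟨x, hx, cutEdgeC_iff.2 (by omega)⟩

/-- The entries `-2` come from the ends of the path: for `i = 1`, `j = 0` the reflection `s_1` moves
`0` and `1`, which are mirror images, in opposite directions, and likewise `s_{l-1}` moves `l` and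
`l + 1`. -/
theorem sign_swapStep_sub_cartanC (hl : 1 < l) (i j : Fin (l + 1)) :
    Int.sign (swapStep l i (i + 1) (j + 1) - (j + 1)) - Int.sign (swapStep l i (i + 1) j - j) =
      -cartanC l i j := by
  have hi := i.isLt
  have hj := j.isLt
  have hc := cartanC_cases hl i j
  have s1 := sign_swapStep_cases (l := l) (a := i) (b := i + 1) (z := j) hl (by omega) (by omega)
    (by omega) (by omega) (by omega)
  have s2 := sign_swapStep_cases (l := l) (a := i) (b := i + 1) (z := j + 1) hl (by omega)
    (by omega) (by omega) (by omega) (by omega)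
  generalize cartanC l i j = v at *
  generalize Int.sign _ = u at *
  generalize Int.sign _ = w at *
  rcases s1 with ⟨rfl, s1⟩ | ⟨rfl, s1⟩ | ⟨rfl, s1⟩ <;>
  rcases s2 with ⟨rfl, s2⟩ | ⟨rfl, s2⟩ | ⟨rfl, s2⟩ <;> omega

theorem isSignedModelC (hl : 1 < l) :
    IsSignedModel (cartanC l) (labelC l) (fun _ => False) numC l (fun j => j) (fun j => j + 1)
      (stepC l) where
  gcm := isGCM_cartanC hl
  prod_le i j hij := by
    have hij : (i : ℕ) ≠ j := fun h => hij (Fin.ext h)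
    have h1 := i.isLt
    have h2 := j.isLt
    rcases cartanC_cases hl i j with ⟨e, h⟩ | ⟨e, h⟩ | ⟨e, h⟩ | ⟨e, h⟩ <;>
    rcases cartanC_cases hl j i with ⟨e', h'⟩ | ⟨e', h'⟩ | ⟨e', h'⟩ | ⟨e', h'⟩ <;>
    rw [e, e'] <;> omega
  inj := numC_injective hl
  exists_eq z _ := exists_numC_eq hl z
  not_top x := id
  le_iff x y := by
    have h1 := numC_eq x
    have h2 := numC_eq y
    have h3 := @numC_injective l hl x y
    have h4 : x = y → numC x = numC y := congrArg _
    rw [HeapElt.le_iff]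
    simp only [and_false, not_false_eq_true, and_true]
    constructor
    · rintro (h | h)
      · exact (h4 h).le
      · omega
    · intro h
      rcases h.eq_or_lt with h | h
      · exact Or.inl (h3 h)
      · exact Or.inr (by omega)
  sep z := False.elim
  pos := by omega
  lt j := by omega
  lt_add j := by omega
  step_eq := stepC_eq
  edge_of x z w hE := by
    obtain ⟨rfl, rfl⟩ := cutEdgeC_iff.1 hE
    obtain ⟨k, c, h1, h2⟩ := exists_numC hl x
    change ∃ k : ℤ, (_ = 2 * l * k + ((x.label : ℕ) : ℤ) ∧ _ = 2 * l * k + ((x.label : ℕ) + 1 : ℤ)) ∨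
      (_ = 2 * l * k + (1 - ((x.label : ℕ) + 1) : ℤ) ∧ _ = 2 * l * k + (1 - (x.label : ℕ) : ℤ))
    have hk : 2 * (l : ℤ) * (k + 1) = 2 * l * k + 2 * l := by ring
    have hp := x.label.isLt
    have hc : c = (x.label : ℕ) + 1 ∨ c = 2 * l + 1 - (x.label : ℕ) := by
      unfold SlotC at h1; omega
    -- The second value is `c = 2l + (1 - p)`, the upper end of a mirror edge one period later.
    rcases hc with hc | hc
    · exact ⟨k, Or.inl (by omega)⟩
    · exact ⟨k + 1, Or.inr (by omega)⟩
  exists_edge_left j k := by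
    have hj := j.isLt
    by_cases h : (j : ℕ) = 0 ∨ (j : ℕ) = l
    · exact exists_edgeC (y := k) (k := k) (c := j + 1) hl (by unfold SlotC; omega) (by ring) (by ring)
    · exact exists_edgeC (y := 2 * k) (k := k) (c := j + 1) hl (by unfold SlotC; omega) (by ring)
        (by ring)
  exists_edge_right j k := by
    have hj := j.isLt
    by_cases h : (j : ℕ) = 0
    · exact exists_edgeC (y := k) (k := k) (c := 1) hl (by unfold SlotC; omega)
        (by rw [h]; push_cast; ring) (by rw [h]; push_cast; ring)
    by_cases h' : (j : ℕ) = l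
    · exact exists_edgeC (y := k - 1) (k := k - 1) (c := l + 1) hl (by unfold SlotC; omega)
        (by rw [h']; ring) (by rw [h']; ring)
    · exact exists_edgeC (y := 2 * (k - 1) + 1) (k := k - 1) (c := 2 * l + 1 - j) hl
        (by unfold SlotC; omega) (by ring) (by ring)
  sign_sub := sign_swapStep_sub_cartanC hl
  ext_of_sub_eq f g hf hg h := by
    refine hf.ext (by omega) hg fun z h1 h2 => ?_
    have key := sub_eq_sub_of_increments (f := f) (g := g) (m := 0) (n := l) fun z hz hz' => by
      have := h ⟨z.toNat, by omega⟩
      simpa [hz] using this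
    have k1 := key 1 (by omega) (by omega)
    have k2 := key z (by omega) h2
    -- The difference of `f` and `g` is constant on `0, ..., l`; as `f 0 + f 1 = 1 = g 0 + g 1`, the
    -- constant is zero.
    have e1 := hf.2 0
    have e2 := hg.2 0
    rw [sub_zero] at e1 e2
    omega

end TypeC

/-! ### Type `D_l^(1)` -/

section TypeD

variable {l : ℕ}

/-- The numbering of the elements of the heap of type `D_l^(1)`. -/
def numD (x : HeapD l) : ℤ := zetaD l x.label x.index

/-- The numbers of the non-principal proper ideals. -/
def TopD (l : ℕ) (z : ℤ) : Prop := z ≡ 2 [ZMOD (2 * l)] ∨ z ≡ l + 2 [ZMOD (2 * l)]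

/-- The element `p(y)` has number `2lk + c` and rank `2(l-2)k + d`. -/
def SlotD (l p : ℕ) (y k c d : ℤ) : Prop :=
  (p = 0 ∧ y = k - 1 ∧ c = 0 ∧ d = 0) ∨ (p = 1 ∧ y = k ∧ c = 1 ∧ d = 0) ∨
  (p + 1 = l ∧ y = k ∧ c = l ∧ d = l - 2) ∨ (p = l ∧ y = k ∧ c = l + 1 ∧ d = l - 2) ∨
  (1 < p ∧ p + 1 < l ∧ y = 2 * k ∧ c = p + 1 ∧ d = p - 1) ∨
  (1 < p ∧ p + 1 < l ∧ y = 2 * k + 1 ∧ c = 2 * l + 1 - p ∧ d = 2 * l - 3 - p)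

theorem SlotD.zeta_eq (hl : 3 < l) {p : ℕ} {y k c d : ℤ} (h : SlotD l p y k c d) :
    zetaD l p y = 2 * l * k + c ∧ rankD l p y = 2 * (l - 2) * k + d := by
  rcases h with ⟨rfl, rfl, rfl, rfl⟩ | ⟨rfl, rfl, rfl, rfl⟩ | ⟨rfl, rfl, rfl, rfl⟩ |
    ⟨rfl, rfl, rfl, rfl⟩ | ⟨h1, h2, rfl, rfl, rfl⟩ | ⟨h1, h2, rfl, rfl, rfl⟩
  · simp [zetaD, rankD]
  · simp [zetaD, rankD]
  · have e0 : p ≠ 0 := by omega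
    have e1 : p ≠ 1 := by omega
    simp only [zetaD, rankD, e0, e1, true_or, if_false, if_true]
    push_cast
    exact ⟨by ring, trivial⟩
  · have e0 : p ≠ 0 := by omega
    have e1 : p ≠ 1 := by omega
    simp only [zetaD, rankD, e0, e1, or_true, if_false, if_true]
    exact ⟨by ring, trivial⟩
  all_goals
    have e0 : p ≠ 0 := by omega
    have e1 : p ≠ 1 := by omega
    have e2 : ¬ (p + 1 = l ∨ p = l) := by omega
    simp only [zetaD, rankD, e0, e1, e2, even_two_mul, Int.not_even_two_mul_add_one, if_false, if_true]
    constructor <;> ring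

theorem exists_slotD (x : HeapD l) : ∃ k c d, SlotD l x.label x.index k c d := by
  have := x.label.isLt
  unfold SlotD
  by_cases h0 : (x.label : ℕ) = 0
  · exact ⟨x.index + 1, 0, 0, Or.inl ⟨h0, by ring, rfl, rfl⟩⟩
  by_cases h1 : (x.label : ℕ) = 1
  · exact ⟨x.index, 1, 0, Or.inr (Or.inl ⟨h1, rfl, rfl, rfl⟩)⟩
  by_cases h2 : (x.label : ℕ) + 1 = l
  · exact ⟨x.index, l, l - 2, Or.inr (Or.inr (Or.inl ⟨h2, rfl, rfl, rfl⟩))⟩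
  by_cases h3 : (x.label : ℕ) = l
  · exact ⟨x.index, l + 1, l - 2, Or.inr (Or.inr (Or.inr (Or.inl ⟨h3, rfl, rfl, rfl⟩)))⟩
  have h4 : 1 < (x.label : ℕ) ∧ (x.label : ℕ) + 1 < l := by omega
  rcases Int.even_or_odd' x.index with ⟨m, h | h⟩
  · exact ⟨m, _, _, Or.inr (Or.inr (Or.inr (Or.inr (Or.inl ⟨h4.1, h4.2, h, rfl, rfl⟩))))⟩
  · exact ⟨m, _, _, Or.inr (Or.inr (Or.inr (Or.inr (Or.inr ⟨h4.1, h4.2, h, rfl, rfl⟩))))⟩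

theorem exists_numD (hl : 3 < l) (x : HeapD l) :
    ∃ k c d, SlotD l x.label x.index k c d ∧ numD x = 2 * l * k + c ∧
      x.rank = 2 * (l - 2) * k + d := by
  obtain ⟨k, c, d, h⟩ := exists_slotD x
  exact ⟨k, c, d, h, h.zeta_eq hl⟩

theorem SlotD.exists_elt (hl : 3 < l) {p : Fin (l + 1)} {y k c d : ℤ} (h : SlotD l p y k c d) :
    ∃ x : HeapD l, labelD l x = p ∧ numD x = 2 * l * k + c :=
  ⟨⟨p, y⟩, rfl, (h.zeta_eq hl).1⟩

/-- Forgets label and index, which the order does not see. Within a period the rank is the number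
minus a correction that grows by one at each pair of equal rank and at each skipped number. -/
theorem SlotD.bounds (hl : 3 < l) {p : ℕ} {y k c d : ℤ} (h : SlotD l p y k c d) :
    (c = 0 ∧ d = 0) ∨ (c = 1 ∧ d = 0) ∨ (3 ≤ c ∧ c ≤ l ∧ d = c - 2) ∨ (c = l + 1 ∧ d = c - 3) ∨
      (l + 3 ≤ c ∧ c < 2 * l ∧ d = c - 4) := by
  unfold SlotD at h
  omega

theorem numD_injective (hl : 3 < l) : Function.Injective (numD (l := l)) := by
  intro x y hxy
  rw [HeapElt.ext_iff']
  obtain ⟨k, c, d, h1, h2, -⟩ := exists_numD hl x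
  obtain ⟨k', c', d', h1', h2', -⟩ := exists_numD hl y
  rw [h2, h2'] at hxy
  have b1 := h1.bounds hl
  have b2 := h1'.bounds hl
  have : k = k' ∧ c = c' := by
    rcases mul_trichotomy (N := 2 * l) (M := 1) (by omega) (by omega) k k' with h | rfl | h <;> omega
  obtain ⟨rfl, rfl⟩ := this
  unfold SlotD at h1 h1'
  omega

theorem topD_mul_add (k z : ℤ) : TopD l (2 * l * k + z) ↔ TopD l z := by
  simp only [TopD, mul_add_modEq]

theorem topD_iff (hl : 3 < l) {z : ℤ} (h0 : -l < z) (h1 : z ≤ 2 * l + 1) : TopD l z ↔ z = 2 ∨ z = l + 2 ∨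
    z = 2 - l := by
  rw [TopD, modEq_iff_of_lt (by omega) (by omega), modEq_iff_of_lt (by omega) (by omega)]
  omega

theorem not_topD_numD (hl : 3 < l) (x : HeapD l) : ¬ TopD l (numD x) := by
  obtain ⟨k, c, d, h1, h2, -⟩ := exists_numD hl x
  have := h1.bounds hl
  rw [h2, topD_mul_add, topD_iff hl (by omega) (by omega)]
  omega

theorem heapD_le_iff (hl : 3 < l) (x y : HeapD l) : x ≤ y ↔
    numD x ≤ numD y ∧ ¬ (numD y = numD x + 1 ∧ TopD l (numD y + 1)) := by
  rw [HeapElt.le_iff, ← (numD_injective hl).eq_iff]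
  obtain ⟨k, c, d, h1, h2, h3⟩ := exists_numD hl x
  obtain ⟨k', c', d', h1', h2', h3'⟩ := exists_numD hl y
  have b1 := h1.bounds hl
  have b2 := h1'.bounds hl
  rw [h2, h2', h3, h3', add_assoc _ c' 1, topD_mul_add, topD_iff hl (by omega) (by omega)]
  clear h1 h1' h2 h2' h3 h3'
  rcases mul_trichotomy (N := 2 * l) (M := 2 * (l - 2)) (by omega) (by omega) k k' with h | rfl | h
  · omega
  · omega
  · omega

/-- Successive skipped numbers are `l` apart, so the required gap amounts to `l > 3`. -/
theorem topD_sep (hl : 3 < l) (z : ℤ) (h : TopD l z) :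
    ¬ TopD l (z + 1) ∧ ¬ TopD l (z + 2) ∧ ¬ TopD l (z + 3) := by
  have : ∃ k c : ℤ, z = 2 * l * k + c ∧ (c = 2 ∨ c = l + 2 - 2 * l) := by
    rcases h with h | h
    · obtain ⟨k, rfl⟩ := exists_of_modEq h
      exact ⟨k, 2, rfl, Or.inl rfl⟩
    · obtain ⟨k, rfl⟩ := exists_of_modEq h
      exact ⟨k + 1, l + 2 - 2 * l, by ring, Or.inr rfl⟩
  obtain ⟨k, c, rfl, hc⟩ := this
  simp only [add_assoc, topD_mul_add]
  rw [topD_iff hl (by omega) (by omega), topD_iff hl (by omega) (by omega),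
    topD_iff hl (by omega) (by omega)]
  omega

/-- The ideals with numbers `2lk + a` and `2lk + b` differ by the element with number `2lk + c`. -/
def EdgeD (l : ℕ) (c a b : ℤ) : Prop :=
  (c ≠ 1 ∧ c ≠ l + 1 ∧ a = c - 1 ∧ b = c) ∨ ((c = 1 ∨ c = l + 1) ∧ a = c - 2 ∧ b = c) ∨
  ((c = 1 ∨ c = l + 1) ∧ a = c - 1 ∧ b = c + 1) ∨ ((c = 0 ∨ c = l) ∧ a = c + 1 ∧ b = c + 2)

theorem cutEdgeD_iff (hl : 3 < l) {x : HeapD l} {k c a b : ℤ} (hx : numD x = 2 * l * k + c)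
    (h0 : 0 ≤ c) (h1 : c < 2 * l) :
    CutEdge (TopD l) numD x (2 * l * k + a) (2 * l * k + b) ↔ EdgeD l c a b := by
  unfold CutEdge EdgeD
  rw [hx]
  simp only [add_assoc, topD_mul_add]
  rw [topD_iff hl (by omega) (by omega), topD_iff hl (by omega) (by omega)]
  omega

theorem exists_of_cutEdgeD (hl : 3 < l) {x : HeapD l} {z w : ℤ}
    (h : CutEdge (TopD l) numD x z w) : ∃ y k c d a b, SlotD l x.label y k c d ∧ EdgeD l c a b ∧
      z = 2 * l * k + a ∧ w = 2 * l * k + b := by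
  obtain ⟨k, c, d, h1, h2, -⟩ := exists_numD hl x
  have b1 := h1.bounds hl
  have ez : z = 2 * l * k + (z - 2 * l * k) := by ring
  have ew : w = 2 * l * k + (w - 2 * l * k) := by ring
  rw [ez, ew, cutEdgeD_iff hl h2 (by omega) (by omega)] at h
  exact ⟨_, k, c, d, _, _, h1, h, ez, ew⟩

theorem cartanD_cases (i j : Fin (l + 1)) :
    (cartanD l i j = 2 ∧ (i : ℕ) = j) ∨
    (cartanD l i j = -1 ∧ (i : ℕ) ≠ j ∧ (edgeD l i j ∨ edgeD l j i)) ∨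
    (cartanD l i j = 0 ∧ (i : ℕ) ≠ j ∧ ¬ (edgeD l i j ∨ edgeD l j i)) := by
  simp only [cartanD, Fin.ext_iff]
  split_ifs with h1 h2
  · simp [h1]
  · simp [h1, h2]
  · exact Or.inr (Or.inr ⟨rfl, h1, h2⟩)

theorem isGCM_cartanD (l : ℕ) : IsGCM (cartanD l) := by
  constructor
  · intro i; simp [cartanD]
  · intro i j hij
    simp only [cartanD, if_neg hij]
    split_ifs <;> simp
  · intro i j
    simp only [cartanD, Fin.ext_iff]
    split_ifs <;> simp <;> grind

/-- The positions interchanged by `s_j`. -/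
def leftD (l j : ℕ) : ℤ := if j = 0 then 1 else if j = 1 then 0 else if j = l then l - 1 else j

def rightD (j : ℕ) : ℤ := if j = 0 then 2 else if j = 1 then 2 else j + 1

theorem leftD_cases (hl : 3 < l) (j : Fin (l + 1)) :
    ((j : ℕ) = 0 ∧ leftD l j = 1 ∧ rightD j = 2) ∨ ((j : ℕ) = 1 ∧ leftD l j = 0 ∧ rightD j = 2) ∨
    ((j : ℕ) = l ∧ leftD l j = l - 1 ∧ rightD j = l + 1) ∨
    (1 < (j : ℕ) ∧ (j : ℕ) < l ∧ leftD l j = (j : ℕ) ∧ rightD j = (j : ℕ) + 1) := by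
  have := j.isLt
  unfold leftD rightD
  split_ifs <;> omega

theorem stepD_eq (hl : 3 < l) (j : Fin (l + 1)) : stepD l j = swapStep l (leftD l j) (rightD j) := by
  ext z
  have hj := j.isLt
  have c0 : (j : ℕ) = 0 ∨ (j : ℕ) = 1 → corrD j = 0 := fun h => if_pos h
  have c1 : 1 < (j : ℕ) → corrD j = 1 := fun h => if_neg (by omega)
  rcases leftD_cases hl j with ⟨h, e1, e2⟩ | ⟨h, e1, e2⟩ | ⟨h, e1, e2⟩ | ⟨h, h', e1, e2⟩
  · rw [stepD, if_pos (Or.inl h), e1, e2]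
    refine ite_eq_swapStep ?_ ?_ rfl
    · rw [or_comm, show ((j : ℕ) : ℤ) + 1 + corrD j = 1 by omega,
        show ((j : ℕ) : ℤ) - 1 + corrD j = 1 - 2 by omega]
    · rw [or_comm, show ((j : ℕ) : ℤ) + 2 + corrD j = 2 by omega,
        show ((j : ℕ) : ℤ) + corrD j = 1 - 1 by omega]
  · rw [stepD, if_neg (by omega), if_pos (Or.inl h), e1, e2]
    refine ite_eq_swapStep ?_ ?_ rfl
    · rw [or_comm, show ((j : ℕ) : ℤ) - 1 + corrD j = 0 by omega,
        show ((j : ℕ) : ℤ) - 2 + corrD j = 1 - 2 by omega]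
    · rw [or_comm, show ((j : ℕ) : ℤ) + 1 + corrD j = 2 by omega,
        show ((j : ℕ) : ℤ) + corrD j = 1 - 0 by omega]
  · rw [stepD, if_neg (by omega), if_pos (Or.inr h), e1, e2]
    refine ite_eq_swapStep ?_ ?_ (by omega)
    · rw [show ((j : ℕ) : ℤ) - 2 + corrD j = l - 1 by omega,
        show ((j : ℕ) : ℤ) - 1 + corrD j = l by omega, show 1 - ((l : ℤ) + 1) = l - 2 * l by ring,
        modEq_sub_self]
    · rw [or_comm, show ((j : ℕ) : ℤ) + 1 + corrD j = l + 2 by omega,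
        show ((j : ℕ) : ℤ) + corrD j = l + 1 by omega,
        show 1 - ((l : ℤ) - 1) = l + 2 - 2 * l by ring, modEq_sub_self, or_comm]
  -- The label `l - 1` exchanges `l - 1` and `l` like its predecessors; its formula only names the
  -- mirror classes `1 - l` and `2 - l` by `l + 1` and `l + 2`.
  · by_cases h1 : (j : ℕ) + 1 = l
    · rw [stepD, if_pos (Or.inr h1), e1, e2]
      refine ite_eq_swapStep ?_ ?_ (by omega)
      · rw [show 1 - (((j : ℕ) : ℤ) + 1) = l + 1 - 2 * l by omega, modEq_sub_self,
          show ((j : ℕ) : ℤ) - 1 + corrD j = j by omega,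
          show ((j : ℕ) : ℤ) + 1 + corrD j = l + 1 by omega]
      · rw [show 1 - ((j : ℕ) : ℤ) = l + 2 - 2 * l by omega, modEq_sub_self,
          show ((j : ℕ) : ℤ) + corrD j = j + 1 by omega,
          show ((j : ℕ) : ℤ) + 2 + corrD j = l + 2 by omega]
    · rw [stepD, if_neg (by omega), if_neg (by omega), e1, e2]
      refine ite_eq_swapStep ?_ ?_ (by omega)
      · rw [show 1 - (((j : ℕ) : ℤ) + 1) = -j by ring]
      · rw [show 1 - ((j : ℕ) : ℤ) = -j + 1 by ring]

theorem exists_edgeD (hl : 3 < l) {p : Fin (l + 1)} {y k c d a b : ℤ} (h : SlotD l p y k c d)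
    (hE : EdgeD l c a b) {z w : ℤ} (hz : z = 2 * l * k + a) (hw : w = 2 * l * k + b) :
    ∃ x, labelD l x = p ∧ CutEdge (TopD l) numD x z w := by
  obtain ⟨x, hx, hx'⟩ := h.exists_elt hl
  have := h.bounds hl
  refine ⟨x, hx, ?_⟩
  rw [hz, hw, cutEdgeD_iff hl hx' (by omega) (by omega)]
  exact hE

/-- At each fork, `{0, 1}` or `{l - 1, l}`, one reflection moves both ends of the other's edge in
the same direction, which yields the entry `0`. -/
theorem sign_swapStep_sub_cartanD (hl : 3 < l) (i j : Fin (l + 1)) :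
    Int.sign (swapStep l (leftD l i) (rightD i) (rightD j) - rightD j) -
      Int.sign (swapStep l (leftD l i) (rightD i) (leftD l j) - leftD l j) = -cartanD l i j := by
  have hc := cartanD_cases i j
  have ci := leftD_cases hl i
  have cj := leftD_cases hl j
  have s1 := sign_swapStep_cases (l := l) (a := leftD l i) (b := rightD i) (z := leftD l j)
    (by omega) (by omega) (by omega) (by omega) (by omega) (by omega)
  have s2 := sign_swapStep_cases (l := l) (a := leftD l i) (b := rightD i) (z := rightD j)
    (by omega) (by omega) (by omega) (by omega) (by omega) (by omega)
  unfold edgeD at hc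
  generalize cartanD l i j = v at *
  generalize Int.sign _ = u at *
  generalize Int.sign _ = w at *
  generalize leftD l i = a at *
  generalize leftD l j = a' at *
  generalize rightD i = b at *
  generalize rightD j = b' at *
  rcases ci with ⟨hi, rfl, rfl⟩ | ⟨hi, rfl, rfl⟩ | ⟨hi, rfl, rfl⟩ | ⟨hi, hi', rfl, rfl⟩ <;>
  rcases cj with ⟨hj, rfl, rfl⟩ | ⟨hj, rfl, rfl⟩ | ⟨hj, rfl, rfl⟩ | ⟨hj, hj', rfl, rfl⟩ <;>
  rcases s1 with ⟨rfl, s1⟩ | ⟨rfl, s1⟩ | ⟨rfl, s1⟩ <;>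
  rcases s2 with ⟨rfl, s2⟩ | ⟨rfl, s2⟩ | ⟨rfl, s2⟩ <;> omega

end TypeD

/-! ### Type D: edges as translates and mirrors, and the assembled model. -/

section TypeD

variable {l : ℕ}

theorem edge_ofD (hl : 3 < l) {x : HeapD l} {z w : ℤ} (hE : CutEdge (TopD l) numD x z w) :
    ∃ k : ℤ, (z = 2 * l * k + leftD l x.label ∧ w = 2 * l * k + rightD x.label) ∨
      (z = 2 * l * k + (1 - rightD x.label) ∧ w = 2 * l * k + (1 - leftD l x.label)) := by
  obtain ⟨y, k, c, d, a, b, h1, h2, rfl, rfl⟩ := exists_of_cutEdgeD hl hE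
  have hk : 2 * (l : ℤ) * (k + 1) = 2 * l * k + 2 * l := by ring
  have hp := leftD_cases hl x.label
  have : (a = leftD l x.label ∧ b = rightD x.label) ∨
      (a = 1 - rightD x.label ∧ b = 1 - leftD l x.label) ∨
      (a = 2 * l + 1 - rightD x.label ∧ b = 2 * l + 1 - leftD l x.label) := by
    unfold EdgeD at h2
    generalize leftD l x.label = u at *
    generalize rightD x.label = v at *
    rcases h1 with h1 | h1 | h1 | h1 | h1 | h1 <;> omega
  rcases this with h | h | h
  · exact ⟨k, Or.inl (by omega)⟩
  · exact ⟨k, Or.inr (by omega)⟩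
  · exact ⟨k + 1, Or.inr (by omega)⟩

theorem exists_edge_leftD (hl : 3 < l) (j : Fin (l + 1)) (k : ℤ) : ∃ x, labelD l x = j ∧
    CutEdge (TopD l) numD x (2 * l * k + leftD l j) (2 * l * k + rightD j) := by
  rcases leftD_cases hl j with ⟨h, e1, e2⟩ | ⟨h, e1, e2⟩ | ⟨h, e1, e2⟩ | ⟨h, h', e1, e2⟩
  · exact exists_edgeD (y := k - 1) (k := k) (c := 0) (d := 0) hl
      (Or.inl ⟨h, rfl, rfl, rfl⟩) (by unfold EdgeD; omega) rfl rfl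
  · exact exists_edgeD (y := k) (k := k) (c := 1) (d := 0) hl
      (Or.inr (Or.inl ⟨h, rfl, rfl, rfl⟩)) (by unfold EdgeD; omega) rfl rfl
  · exact exists_edgeD (y := k) (k := k) (c := l + 1) (d := l - 2) hl
      (Or.inr (Or.inr (Or.inr (Or.inl ⟨h, rfl, rfl, rfl⟩)))) (by unfold EdgeD; omega) rfl rfl
  · by_cases h1 : (j : ℕ) + 1 = l
    · exact exists_edgeD (y := k) (k := k) (c := l) (d := l - 2) hl
        (Or.inr (Or.inr (Or.inl ⟨h1, rfl, rfl, rfl⟩))) (by unfold EdgeD; omega) rfl rfl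
    · exact exists_edgeD (y := 2 * k) (k := k) (c := (j : ℕ) + 1) (d := (j : ℕ) - 1) hl
        (Or.inr (Or.inr (Or.inr (Or.inr (Or.inl ⟨h, by omega, rfl, rfl, rfl⟩)))))
        (by unfold EdgeD; omega) rfl rfl

theorem exists_edge_rightD (hl : 3 < l) (j : Fin (l + 1)) (k : ℤ) : ∃ x, labelD l x = j ∧
    CutEdge (TopD l) numD x (2 * l * k + (1 - rightD j)) (2 * l * k + (1 - leftD l j)) := by
  -- For labels above `1`, the mirror edge based at `k` belongs to an element of the preceding
  -- period.
  have hk : ∀ t : ℤ, 2 * (l : ℤ) * k + t = 2 * l * (k - 1) + (2 * l + t) := fun t => by ring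
  rcases leftD_cases hl j with ⟨h, e1, e2⟩ | ⟨h, e1, e2⟩ | ⟨h, e1, e2⟩ | ⟨h, h', e1, e2⟩
  · exact exists_edgeD (y := k - 1) (k := k) (c := 0) (d := 0) hl
      (Or.inl ⟨h, rfl, rfl, rfl⟩) (by unfold EdgeD; omega) rfl rfl
  · exact exists_edgeD (y := k) (k := k) (c := 1) (d := 0) hl
      (Or.inr (Or.inl ⟨h, rfl, rfl, rfl⟩)) (by unfold EdgeD; omega) rfl rfl
  · exact exists_edgeD (y := k - 1) (k := k - 1) (c := l + 1) (d := l - 2) hl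
      (Or.inr (Or.inr (Or.inr (Or.inl ⟨h, rfl, rfl, rfl⟩)))) (by unfold EdgeD; omega) (hk _) (hk _)
  · by_cases h1 : (j : ℕ) + 1 = l
    · exact exists_edgeD (y := k - 1) (k := k - 1) (c := l) (d := l - 2) hl
        (Or.inr (Or.inr (Or.inl ⟨h1, rfl, rfl, rfl⟩))) (by unfold EdgeD; omega) (hk _) (hk _)
    · exact exists_edgeD (y := 2 * (k - 1) + 1) (k := k - 1) (c := 2 * l + 1 - (j : ℕ))
        (d := 2 * l - 3 - (j : ℕ)) hl
        (Or.inr (Or.inr (Or.inr (Or.inr (Or.inr ⟨h, by omega, rfl, rfl, rfl⟩)))))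
        (by unfold EdgeD; omega) (hk _) (hk _)

theorem exists_numD_eq (hl : 3 < l) {z : ℤ} (hz : ¬ TopD l z) : ∃ x : HeapD l, numD x = z := by
  obtain ⟨k, c, rfl, h1, h2⟩ := exists_eq_mul_add (N := 2 * l) (by omega) 0 z
  rw [topD_mul_add, topD_iff hl (by omega) (by omega)] at hz
  have hp : ∃ p y d, p < l + 1 ∧ SlotD l p y k c d := by
    unfold SlotD
    by_cases e0 : c = 0
    · exact ⟨0, k - 1, 0, by omega, Or.inl ⟨rfl, rfl, e0, rfl⟩⟩
    by_cases e1 : c = 1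
    · exact ⟨1, k, 0, by omega, Or.inr (Or.inl ⟨rfl, rfl, e1, rfl⟩)⟩
    by_cases e2 : c = l
    · exact ⟨l - 1, k, l - 2, by omega, Or.inr (Or.inr (Or.inl ⟨by omega, rfl, e2, rfl⟩))⟩
    by_cases e3 : c = l + 1
    · exact ⟨l, k, l - 2, by omega, Or.inr (Or.inr (Or.inr (Or.inl ⟨rfl, rfl, e3, rfl⟩)))⟩
    rcases le_or_gt c l with h | h
    · exact ⟨(c - 1).toNat, 2 * k, _, by omega, Or.inr (Or.inr (Or.inr (Or.inr (Or.inl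
        ⟨by omega, by omega, rfl, by omega, rfl⟩))))⟩
    · exact ⟨(2 * l + 1 - c).toNat, 2 * k + 1, _, by omega, Or.inr (Or.inr (Or.inr (Or.inr (Or.inr
        ⟨by omega, by omega, rfl, by omega, rfl⟩))))⟩
  obtain ⟨p, y, d, hp, hs⟩ := hp
  obtain ⟨x, -, hx⟩ := SlotD.exists_elt (p := ⟨p, hp⟩) hl hs
  exact ⟨x, hx⟩

theorem isSignedModelD (hl : 3 < l) :
    IsSignedModel (cartanD l) (labelD l) (TopD l) numD l (fun j => leftD l j)
      (fun j => rightD j) (stepD l) where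
  gcm := isGCM_cartanD l
  prod_le i j hij := by
    simp only [cartanD, if_neg hij, if_neg hij.symm]
    split_ifs <;> simp
  inj := numD_injective hl
  exists_eq z hz := exists_numD_eq hl hz
  not_top := not_topD_numD hl
  le_iff := heapD_le_iff hl
  sep := topD_sep hl
  pos := by omega
  lt j := by have := leftD_cases hl j; omega
  lt_add j := by have := leftD_cases hl j; omega
  step_eq := stepD_eq hl
  edge_of x z w hE := edge_ofD hl hE
  exists_edge_left := exists_edge_leftD hl
  exists_edge_right := exists_edge_rightD hl
  sign_sub := sign_swapStep_sub_cartanD hl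
  ext_of_sub_eq f g hf hg h := by
    refine hf.ext (by omega) hg fun z h1 h2 => ?_
    have h3 := h ⟨0, by omega⟩
    have h4 := h ⟨1, by omega⟩
    -- Label `0` gives the increment from `1` to `2`, labels `2` to `l - 1` the later ones. Label
    -- `1` ties the value at `0` to that at `2`, so `f 0 + f 1 = 1` can again remove the constant.
    simp only [leftD, rightD, if_true, one_ne_zero, if_false] at h3 h4
    have key := sub_eq_sub_of_increments (f := f) (g := g) (m := 1) (n := l) fun z hz hz' => by
      by_cases hz1 : z = 1
      · rw [hz1]; exact h3
      · have := h ⟨z.toNat, by omega⟩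
        simp only [leftD, rightD] at this
        rw [if_neg (by omega), if_neg (by omega), if_neg (by omega), if_neg (by omega),
          if_neg (by omega), Int.toNat_of_nonneg (by omega)] at this
        exact this
    have k2 := key z h1 h2
    have e1 := hf.2 0
    have e2 := hg.2 0
    rw [sub_zero] at e1 e2
    omega

end TypeD

/-! ### Type `A_{2l-1}^(2)` -/

section TypeA2

variable {l : ℕ}

/-- The numbering of the elements of the heap of type `A_{2l-1}^(2)`. -/
def numA2 (x : HeapA2 l) : ℤ := zetaA2 l x.label x.index

/-- The numbers of the non-principal proper ideals. -/
def TopA2 (l : ℕ) (z : ℤ) : Prop := z ≡ 2 [ZMOD (2 * l)]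

/-- The element `p(y)` has number `2lk + c` and rank `2(l-1)k + d`. -/
def SlotA2 (l p : ℕ) (y k c d : ℤ) : Prop :=
  (p = 0 ∧ y = k - 1 ∧ c = 0 ∧ d = 0) ∨ (p = 1 ∧ y = k ∧ c = 1 ∧ d = 0) ∨
  (p = l ∧ y = k ∧ c = l + 1 ∧ d = l - 1) ∨
  (1 < p ∧ p < l ∧ y = 2 * k ∧ c = p + 1 ∧ d = p - 1) ∨
  (1 < p ∧ p < l ∧ y = 2 * k + 1 ∧ c = 2 * l + 1 - p ∧ d = 2 * l - 1 - p)

theorem SlotA2.zeta_eq (hl : 2 < l) {p : ℕ} {y k c d : ℤ} (h : SlotA2 l p y k c d) :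
    zetaA2 l p y = 2 * l * k + c ∧ rankA2 l p y = 2 * (l - 1) * k + d := by
  rcases h with ⟨rfl, rfl, rfl, rfl⟩ | ⟨rfl, rfl, rfl, rfl⟩ | ⟨rfl, rfl, rfl, rfl⟩ |
    ⟨h1, h2, rfl, rfl, rfl⟩ | ⟨h1, h2, rfl, rfl, rfl⟩
  · simp [zetaA2, rankA2]
  · simp [zetaA2, rankA2]
  · have e0 : p ≠ 0 := by omega
    have e1 : p ≠ 1 := by omega
    simp only [zetaA2, rankA2, e0, e1, if_false, if_true]
    exact ⟨by ring, trivial⟩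
  all_goals
    have e0 : p ≠ 0 := by omega
    have e1 : p ≠ 1 := by omega
    have e2 : p ≠ l := by omega
    simp only [zetaA2, rankA2, e0, e1, e2, even_two_mul, Int.not_even_two_mul_add_one, if_false,
      if_true]
    constructor <;> ring

theorem exists_slotA2 (x : HeapA2 l) : ∃ k c d, SlotA2 l x.label x.index k c d := by
  have := x.label.isLt
  unfold SlotA2
  by_cases h0 : (x.label : ℕ) = 0
  · exact ⟨x.index + 1, 0, 0, Or.inl ⟨h0, by ring, rfl, rfl⟩⟩
  by_cases h1 : (x.label : ℕ) = 1
  · exact ⟨x.index, 1, 0, Or.inr (Or.inl ⟨h1, rfl, rfl, rfl⟩)⟩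
  by_cases h3 : (x.label : ℕ) = l
  · exact ⟨x.index, l + 1, l - 1, Or.inr (Or.inr (Or.inl ⟨h3, rfl, rfl, rfl⟩))⟩
  have h4 : 1 < (x.label : ℕ) ∧ (x.label : ℕ) < l := by omega
  rcases Int.even_or_odd' x.index with ⟨m, h | h⟩
  · exact ⟨m, _, _, Or.inr (Or.inr (Or.inr (Or.inl ⟨h4.1, h4.2, h, rfl, rfl⟩)))⟩
  · exact ⟨m, _, _, Or.inr (Or.inr (Or.inr (Or.inr ⟨h4.1, h4.2, h, rfl, rfl⟩)))⟩

theorem exists_numA2 (hl : 2 < l) (x : HeapA2 l) :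
    ∃ k c d, SlotA2 l x.label x.index k c d ∧ numA2 x = 2 * l * k + c ∧
      x.rank = 2 * (l - 1) * k + d := by
  obtain ⟨k, c, d, h⟩ := exists_slotA2 x
  exact ⟨k, c, d, h, h.zeta_eq hl⟩

theorem SlotA2.exists_elt (hl : 2 < l) {p : Fin (l + 1)} {y k c d : ℤ} (h : SlotA2 l p y k c d) :
    ∃ x : HeapA2 l, labelA2 l x = p ∧ numA2 x = 2 * l * k + c :=
  ⟨⟨p, y⟩, rfl, (h.zeta_eq hl).1⟩

theorem SlotA2.bounds (hl : 2 < l) {p : ℕ} {y k c d : ℤ} (h : SlotA2 l p y k c d) :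
    (c = 0 ∧ d = 0) ∨ (c = 1 ∧ d = 0) ∨ (3 ≤ c ∧ c < 2 * l ∧ d = c - 2) := by
  unfold SlotA2 at h
  omega

theorem numA2_injective (hl : 2 < l) : Function.Injective (numA2 (l := l)) := by
  intro x y hxy
  rw [HeapElt.ext_iff']
  obtain ⟨k, c, d, h1, h2, -⟩ := exists_numA2 hl x
  obtain ⟨k', c', d', h1', h2', -⟩ := exists_numA2 hl y
  rw [h2, h2'] at hxy
  have b1 := h1.bounds hl
  have b2 := h1'.bounds hl
  have : k = k' ∧ c = c' := by
    rcases mul_trichotomy (N := 2 * l) (M := 1) (by omega) (by omega) k k' with h | rfl | h <;> omega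
  obtain ⟨rfl, rfl⟩ := this
  unfold SlotA2 at h1 h1'
  omega

theorem topA2_mul_add (k z : ℤ) : TopA2 l (2 * l * k + z) ↔ TopA2 l z := by
  simp only [TopA2, mul_add_modEq]

theorem topA2_iff (hl : 2 < l) {z : ℤ} (h0 : -l < z) (h1 : z ≤ 2 * l + 1) : TopA2 l z ↔ z = 2 := by
  rw [TopA2, modEq_iff_of_lt (by omega) (by omega)]
  omega

theorem not_topA2_numA2 (hl : 2 < l) (x : HeapA2 l) : ¬ TopA2 l (numA2 x) := by
  obtain ⟨k, c, d, h1, h2, -⟩ := exists_numA2 hl x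
  have := h1.bounds hl
  rw [h2, topA2_mul_add, topA2_iff hl (by omega) (by omega)]
  omega

theorem heapA2_le_iff (hl : 2 < l) (x y : HeapA2 l) : x ≤ y ↔
    numA2 x ≤ numA2 y ∧ ¬ (numA2 y = numA2 x + 1 ∧ TopA2 l (numA2 y + 1)) := by
  rw [HeapElt.le_iff, ← (numA2_injective hl).eq_iff]
  obtain ⟨k, c, d, h1, h2, h3⟩ := exists_numA2 hl x
  obtain ⟨k', c', d', h1', h2', h3'⟩ := exists_numA2 hl y
  have b1 := h1.bounds hl
  have b2 := h1'.bounds hl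
  rw [h2, h2', h3, h3', add_assoc _ c' 1, topA2_mul_add, topA2_iff hl (by omega) (by omega)]
  clear h1 h1' h2 h2' h3 h3'
  rcases mul_trichotomy (N := 2 * l) (M := 2 * (l - 1)) (by omega) (by omega) k k' with h | rfl | h
  · omega
  · omega
  · omega

theorem topA2_sep (hl : 2 < l) (z : ℤ) (h : TopA2 l z) :
    ¬ TopA2 l (z + 1) ∧ ¬ TopA2 l (z + 2) ∧ ¬ TopA2 l (z + 3) := by
  obtain ⟨k, rfl⟩ := exists_of_modEq h
  simp only [add_assoc, topA2_mul_add]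
  rw [topA2_iff hl (by omega) (by omega), topA2_iff hl (by omega) (by omega),
    topA2_iff hl (by omega) (by omega)]
  omega

/-- The ideals with numbers `2lk + a` and `2lk + b` differ by the element with number `2lk + c`. -/
def EdgeA2 (c a b : ℤ) : Prop :=
  (c ≠ 1 ∧ a = c - 1 ∧ b = c) ∨ (c = 1 ∧ a = c - 2 ∧ b = c) ∨
  (c = 1 ∧ a = c - 1 ∧ b = c + 1) ∨ (c = 0 ∧ a = c + 1 ∧ b = c + 2)

theorem cutEdgeA2_iff (hl : 2 < l) {x : HeapA2 l} {k c a b : ℤ} (hx : numA2 x = 2 * l * k + c)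
    (h0 : 0 ≤ c) (h1 : c < 2 * l) :
    CutEdge (TopA2 l) numA2 x (2 * l * k + a) (2 * l * k + b) ↔ EdgeA2 c a b := by
  unfold CutEdge EdgeA2
  rw [hx]
  simp only [add_assoc, topA2_mul_add]
  rw [topA2_iff hl (by omega) (by omega), topA2_iff hl (by omega) (by omega)]
  omega

theorem exists_of_cutEdgeA2 (hl : 2 < l) {x : HeapA2 l} {z w : ℤ}
    (h : CutEdge (TopA2 l) numA2 x z w) : ∃ y k c d a b, SlotA2 l x.label y k c d ∧ EdgeA2 c a b ∧
      z = 2 * l * k + a ∧ w = 2 * l * k + b := by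
  obtain ⟨k, c, d, h1, h2, -⟩ := exists_numA2 hl x
  have b1 := h1.bounds hl
  have ez : z = 2 * l * k + (z - 2 * l * k) := by ring
  have ew : w = 2 * l * k + (w - 2 * l * k) := by ring
  rw [ez, ew, cutEdgeA2_iff hl h2 (by omega) (by omega)] at h
  exact ⟨_, k, c, d, _, _, h1, h, ez, ew⟩

theorem cartanA2_cases (i j : Fin (l + 1)) :
    (cartanA2 l i j = 2 ∧ (i : ℕ) = j) ∨
    (cartanA2 l i j = -2 ∧ (i : ℕ) ≠ j ∧ (i : ℕ) + 1 = l ∧ (j : ℕ) = l) ∨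
    (cartanA2 l i j = -1 ∧ (i : ℕ) ≠ j ∧ ¬ ((i : ℕ) + 1 = l ∧ (j : ℕ) = l) ∧
      (((i : ℕ) = 0 ∧ (j : ℕ) = 2) ∨ ((i : ℕ) = 2 ∧ (j : ℕ) = 0) ∨
        (1 ≤ (i : ℕ) ∧ (i : ℕ) + 1 = j) ∨ (1 ≤ (j : ℕ) ∧ (j : ℕ) + 1 = i))) ∨
    (cartanA2 l i j = 0 ∧ (i : ℕ) ≠ j ∧ ¬ ((i : ℕ) + 1 = l ∧ (j : ℕ) = l) ∧
      ¬ (((i : ℕ) = 0 ∧ (j : ℕ) = 2) ∨ ((i : ℕ) = 2 ∧ (j : ℕ) = 0) ∨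
        (1 ≤ (i : ℕ) ∧ (i : ℕ) + 1 = j) ∨ (1 ≤ (j : ℕ) ∧ (j : ℕ) + 1 = i))) := by
  simp only [cartanA2, Fin.ext_iff]
  split_ifs with h1 h2 h3
  · exact Or.inl ⟨rfl, h1⟩
  · exact Or.inr (Or.inl ⟨rfl, h1, h2⟩)
  · exact Or.inr (Or.inr (Or.inl ⟨rfl, h1, h2, h3⟩))
  · exact Or.inr (Or.inr (Or.inr ⟨rfl, h1, h2, h3⟩))

theorem isGCM_cartanA2 (hl : 2 < l) : IsGCM (cartanA2 l) := by
  constructor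
  · intro i; simp [cartanA2]
  · intro i j hij
    simp only [cartanA2, if_neg hij]
    split_ifs <;> simp
  · intro i j
    have h1 := i.isLt
    have h2 := j.isLt
    rcases cartanA2_cases i j with ⟨e, h⟩ | ⟨e, h⟩ | ⟨e, h⟩ | ⟨e, h⟩ <;>
    rcases cartanA2_cases j i with ⟨e', h'⟩ | ⟨e', h'⟩ | ⟨e', h'⟩ | ⟨e', h'⟩ <;>
    rw [e, e'] <;> omega

/-- The positions interchanged by `s_j`. -/
def leftA2 (j : ℕ) : ℤ := if j = 0 then 1 else if j = 1 then 0 else j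

def rightA2 (j : ℕ) : ℤ := if j = 0 then 2 else if j = 1 then 2 else j + 1

theorem leftA2_cases (j : ℕ) :
    (j = 0 ∧ leftA2 j = 1 ∧ rightA2 j = 2) ∨ (j = 1 ∧ leftA2 j = 0 ∧ rightA2 j = 2) ∨
    (1 < j ∧ leftA2 j = j ∧ rightA2 j = j + 1) := by
  unfold leftA2 rightA2
  split_ifs <;> omega

theorem stepA2_eq (j : Fin (l + 1)) : stepA2 l j = swapStep l (leftA2 j) (rightA2 j) := by
  ext z
  rcases leftA2_cases j with ⟨h, e1, e2⟩ | ⟨h, e1, e2⟩ | ⟨h, e1, e2⟩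
  · rw [stepA2, if_pos h, e1, e2]
    refine ite_eq_swapStep Iff.rfl ?_ rfl
    rw [or_comm, sub_self]
  · rw [stepA2, if_neg (by omega), if_pos h, e1, e2]
    refine ite_eq_swapStep ?_ ?_ rfl
    · rw [or_comm]; rfl
    · rw [or_comm]; rfl
  · rw [stepA2, if_neg (by omega), if_neg (by omega), e1, e2]
    refine ite_eq_swapStep ?_ ?_ (by ring)
    · rw [show 1 - (((j : ℕ) : ℤ) + 1) = -j by ring]
    · rw [show 1 - ((j : ℕ) : ℤ) = -j + 1 by ring]

theorem exists_edgeA2 (hl : 2 < l) {p : Fin (l + 1)} {y k c d a b : ℤ} (h : SlotA2 l p y k c d)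
    (hE : EdgeA2 c a b) {z w : ℤ} (hz : z = 2 * l * k + a) (hw : w = 2 * l * k + b) :
    ∃ x, labelA2 l x = p ∧ CutEdge (TopA2 l) numA2 x z w := by
  obtain ⟨x, hx, hx'⟩ := h.exists_elt hl
  have := h.bounds hl
  refine ⟨x, hx, ?_⟩
  rw [hz, hw, cutEdgeA2_iff hl hx' (by omega) (by omega)]
  exact hE

/-- The low end is a fork, where labels `0` and `1` give entry `0`. At the high end `s_{l-1}` moves
`l` and `l + 1` in opposite directions, which gives the entry `-2`. -/
theorem sign_swapStep_sub_cartanA2 (hl : 2 < l) (i j : Fin (l + 1)) :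
    Int.sign (swapStep l (leftA2 i) (rightA2 i) (rightA2 j) - rightA2 j) -
      Int.sign (swapStep l (leftA2 i) (rightA2 i) (leftA2 j) - leftA2 j) = -cartanA2 l i j := by
  have hc := cartanA2_cases i j
  have ci := leftA2_cases i
  have cj := leftA2_cases j
  have s1 := sign_swapStep_cases (l := l) (a := leftA2 i) (b := rightA2 i) (z := leftA2 j)
    (by omega) (by omega) (by omega) (by omega) (by omega) (by omega)
  have s2 := sign_swapStep_cases (l := l) (a := leftA2 i) (b := rightA2 i) (z := rightA2 j)
    (by omega) (by omega) (by omega) (by omega) (by omega) (by omega)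
  generalize cartanA2 l i j = v at *
  generalize Int.sign _ = u at *
  generalize Int.sign _ = w at *
  generalize leftA2 i = a at *
  generalize leftA2 j = a' at *
  generalize rightA2 i = b at *
  generalize rightA2 j = b' at *
  rcases ci with ⟨hi, rfl, rfl⟩ | ⟨hi, rfl, rfl⟩ | ⟨hi, rfl, rfl⟩ <;>
  rcases cj with ⟨hj, rfl, rfl⟩ | ⟨hj, rfl, rfl⟩ | ⟨hj, rfl, rfl⟩ <;>
  rcases s1 with ⟨rfl, s1⟩ | ⟨rfl, s1⟩ | ⟨rfl, s1⟩ <;>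
  rcases s2 with ⟨rfl, s2⟩ | ⟨rfl, s2⟩ | ⟨rfl, s2⟩ <;> omega

theorem edge_ofA2 (hl : 2 < l) {x : HeapA2 l} {z w : ℤ} (hE : CutEdge (TopA2 l) numA2 x z w) :
    ∃ k : ℤ, (z = 2 * l * k + leftA2 x.label ∧ w = 2 * l * k + rightA2 x.label) ∨
      (z = 2 * l * k + (1 - rightA2 x.label) ∧ w = 2 * l * k + (1 - leftA2 x.label)) := by
  obtain ⟨y, k, c, d, a, b, h1, h2, rfl, rfl⟩ := exists_of_cutEdgeA2 hl hE
  have hk : 2 * (l : ℤ) * (k + 1) = 2 * l * k + 2 * l := by ring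
  have hp := leftA2_cases x.label
  have : (a = leftA2 x.label ∧ b = rightA2 x.label) ∨
      (a = 1 - rightA2 x.label ∧ b = 1 - leftA2 x.label) ∨
      (a = 2 * l + 1 - rightA2 x.label ∧ b = 2 * l + 1 - leftA2 x.label) := by
    unfold EdgeA2 at h2
    generalize leftA2 x.label = u at *
    generalize rightA2 x.label = v at *
    rcases h1 with h1 | h1 | h1 | h1 | h1 <;> omega
  rcases this with h | h | h
  · exact ⟨k, Or.inl (by omega)⟩
  · exact ⟨k, Or.inr (by omega)⟩
  · exact ⟨k + 1, Or.inr (by omega)⟩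

theorem exists_edge_leftA2 (hl : 2 < l) (j : Fin (l + 1)) (k : ℤ) : ∃ x, labelA2 l x = j ∧
    CutEdge (TopA2 l) numA2 x (2 * l * k + leftA2 j) (2 * l * k + rightA2 j) := by
  have hj := j.isLt
  rcases leftA2_cases j with ⟨h, e1, e2⟩ | ⟨h, e1, e2⟩ | ⟨h, e1, e2⟩
  · exact exists_edgeA2 (y := k - 1) (k := k) (c := 0) (d := 0) hl
      (Or.inl ⟨h, rfl, rfl, rfl⟩) (by unfold EdgeA2; omega) rfl rfl
  · exact exists_edgeA2 (y := k) (k := k) (c := 1) (d := 0) hl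
      (Or.inr (Or.inl ⟨h, rfl, rfl, rfl⟩)) (by unfold EdgeA2; omega) rfl rfl
  · by_cases h1 : (j : ℕ) = l
    · exact exists_edgeA2 (y := k) (k := k) (c := l + 1) (d := l - 1) hl
        (Or.inr (Or.inr (Or.inl ⟨h1, rfl, rfl, rfl⟩))) (by unfold EdgeA2; omega) rfl rfl
    · exact exists_edgeA2 (y := 2 * k) (k := k) (c := (j : ℕ) + 1) (d := (j : ℕ) - 1) hl
        (Or.inr (Or.inr (Or.inr (Or.inl ⟨h, by omega, rfl, rfl, rfl⟩))))
        (by unfold EdgeA2; omega) rfl rfl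

theorem exists_edge_rightA2 (hl : 2 < l) (j : Fin (l + 1)) (k : ℤ) : ∃ x, labelA2 l x = j ∧
    CutEdge (TopA2 l) numA2 x (2 * l * k + (1 - rightA2 j)) (2 * l * k + (1 - leftA2 j)) := by
  have hj := j.isLt
  have hk : ∀ t : ℤ, 2 * (l : ℤ) * k + t = 2 * l * (k - 1) + (2 * l + t) := fun t => by ring
  rcases leftA2_cases j with ⟨h, e1, e2⟩ | ⟨h, e1, e2⟩ | ⟨h, e1, e2⟩
  · exact exists_edgeA2 (y := k - 1) (k := k) (c := 0) (d := 0) hl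
      (Or.inl ⟨h, rfl, rfl, rfl⟩) (by unfold EdgeA2; omega) rfl rfl
  · exact exists_edgeA2 (y := k) (k := k) (c := 1) (d := 0) hl
      (Or.inr (Or.inl ⟨h, rfl, rfl, rfl⟩)) (by unfold EdgeA2; omega) rfl rfl
  · by_cases h1 : (j : ℕ) = l
    · exact exists_edgeA2 (y := k - 1) (k := k - 1) (c := l + 1) (d := l - 1) hl
        (Or.inr (Or.inr (Or.inl ⟨h1, rfl, rfl, rfl⟩))) (by unfold EdgeA2; omega) (hk _) (hk _)
    · exact exists_edgeA2 (y := 2 * (k - 1) + 1) (k := k - 1) (c := 2 * l + 1 - (j : ℕ))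
        (d := 2 * l - 1 - (j : ℕ)) hl
        (Or.inr (Or.inr (Or.inr (Or.inr ⟨h, by omega, rfl, rfl, rfl⟩))))
        (by unfold EdgeA2; omega) (hk _) (hk _)

theorem exists_numA2_eq (hl : 2 < l) {z : ℤ} (hz : ¬ TopA2 l z) : ∃ x : HeapA2 l, numA2 x = z := by
  obtain ⟨k, c, rfl, h1, h2⟩ := exists_eq_mul_add (N := 2 * l) (by omega) 0 z
  rw [topA2_mul_add, topA2_iff hl (by omega) (by omega)] at hz
  have hp : ∃ p y d, p < l + 1 ∧ SlotA2 l p y k c d := by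
    unfold SlotA2
    by_cases e0 : c = 0
    · exact ⟨0, k - 1, 0, by omega, Or.inl ⟨rfl, rfl, e0, rfl⟩⟩
    by_cases e1 : c = 1
    · exact ⟨1, k, 0, by omega, Or.inr (Or.inl ⟨rfl, rfl, e1, rfl⟩)⟩
    by_cases e3 : c = l + 1
    · exact ⟨l, k, l - 1, by omega, Or.inr (Or.inr (Or.inl ⟨rfl, rfl, e3, rfl⟩))⟩
    rcases le_or_gt c l with h | h
    · exact ⟨(c - 1).toNat, 2 * k, _, by omega, Or.inr (Or.inr (Or.inr (Or.inl
        ⟨by omega, by omega, rfl, by omega, rfl⟩)))⟩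
    · exact ⟨(2 * l + 1 - c).toNat, 2 * k + 1, _, by omega, Or.inr (Or.inr (Or.inr (Or.inr
        ⟨by omega, by omega, rfl, by omega, rfl⟩)))⟩
  obtain ⟨p, y, d, hp, hs⟩ := hp
  obtain ⟨x, -, hx⟩ := SlotA2.exists_elt (p := ⟨p, hp⟩) hl hs
  exact ⟨x, hx⟩

theorem isSignedModelA2 (hl : 2 < l) :
    IsSignedModel (cartanA2 l) (labelA2 l) (TopA2 l) numA2 l (fun j => leftA2 j)
      (fun j => rightA2 j) (stepA2 l) where
  gcm := isGCM_cartanA2 hl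
  prod_le i j hij := by
    have hij : (i : ℕ) ≠ j := fun h => hij (Fin.ext h)
    have h1 := i.isLt
    have h2 := j.isLt
    rcases cartanA2_cases i j with ⟨e, h⟩ | ⟨e, h⟩ | ⟨e, h⟩ | ⟨e, h⟩ <;>
    rcases cartanA2_cases j i with ⟨e', h'⟩ | ⟨e', h'⟩ | ⟨e', h'⟩ | ⟨e', h'⟩ <;>
    rw [e, e'] <;> omega
  inj := numA2_injective hl
  exists_eq z hz := exists_numA2_eq hl hz
  not_top := not_topA2_numA2 hl
  le_iff := heapA2_le_iff hl
  sep := topA2_sep hl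
  pos := by omega
  lt j := by have := leftA2_cases j; have := j.isLt; omega
  lt_add j := by have := leftA2_cases j; have := j.isLt; omega
  step_eq := stepA2_eq
  edge_of x z w hE := edge_ofA2 hl hE
  exists_edge_left := exists_edge_leftA2 hl
  exists_edge_right := exists_edge_rightA2 hl
  sign_sub := sign_swapStep_sub_cartanA2 hl
  ext_of_sub_eq f g hf hg h := by
    refine hf.ext (by omega) hg fun z h1 h2 => ?_
    have h3 := h ⟨0, by omega⟩
    have h4 := h ⟨1, by omega⟩
    simp only [leftA2, rightA2, if_true, one_ne_zero, if_false] at h3 h4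
    have key := sub_eq_sub_of_increments (f := f) (g := g) (m := 1) (n := l) fun z hz hz' => by
      by_cases hz1 : z = 1
      · rw [hz1]; exact h3
      · have := h ⟨z.toNat, by omega⟩
        simp only [leftA2, rightA2] at this
        rw [if_neg (by omega), if_neg (by omega), if_neg (by omega), if_neg (by omega), Int.toNat_of_nonneg (by omega)] at this
        exact this
    have k2 := key z h1 h2
    have e1 := hf.2 0
    have e2 := hg.2 0
    rw [sub_zero] at e1 e2
    omega

end TypeA2

/-! ### Principal and non-principal ideals -/

namespace IsLinearModel

variable {P E : Type} [PartialOrder E] {A : P → P → ℤ} {ε : E → P} {T : ℤ → Prop} {e : E → ℤ}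
  {step : P → ℤ → ℤ}

theorem isProperIdeal_Iic (h : IsLinearModel A ε T e step) (x : E) :
    IsProperIdeal ε (Set.Iic x) :=
  h.cut_eq_Iic x ▸ h.isProperIdeal_cut _

theorem exists_Iic_or_top (h : IsLinearModel A ε T e step) {I : Set E} (hI : IsProperIdeal ε I) :
    (∃ x, I = Set.Iic x) ∨ ∃ z, T z ∧ I = cut T e z := by
  obtain ⟨z, rfl⟩ := (h.isProperIdeal_iff I).1 hI
  by_cases hz : T z
  · exact Or.inr ⟨z, hz, rfl⟩
  · obtain ⟨x, rfl⟩ := h.exists_eq z hz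
    exact Or.inl ⟨x, h.cut_eq_Iic x⟩

theorem cut_ne_Iic (h : IsLinearModel A ε T e step) {z : ℤ} (hz : T z) (x : E) :
    cut T e z ≠ Set.Iic x := by
  rw [← h.cut_eq_Iic, h.cut_injective.ne_iff]
  rintro rfl
  exact h.not_top x hz

theorem zeta_of_Iic (h : IsLinearModel A ε T e step) {I : ProperIdeal ε} {x : E}
    (hI : I.1 = Set.Iic x) : h.zeta I = e x := by
  rw [h.zeta_eq_iff, hI, h.cut_eq_Iic]

theorem exists_incomparable (h : IsLinearModel A ε T e step) {z : ℤ} (hz : T z) :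
    ∃ I J : ProperIdeal ε, ¬ I ≤ J ∧ ¬ J ≤ I := by
  refine ⟨⟨_, h.isProperIdeal_cut (z - 2)⟩, ⟨_, h.isProperIdeal_cut (z - 1)⟩, fun h' => ?_,
    fun h' => ?_⟩
  · refine ((h.cut_subset_iff _ _).1 h').2 ⟨by ring, ?_⟩
    rwa [sub_add_cancel]
  · have := ((h.cut_subset_iff _ _).1 h').1
    omega

theorem Iic_eq_cut_iff (h : IsLinearModel A ε T e step) (x : E) (z : ℤ) :
    cut T e z = Set.Iic x ↔ z = e x := by
  rw [← h.cut_eq_Iic, h.cut_injective.eq_iff]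

end IsLinearModel

/-! ### Periodicity and duality -/

/-- Duality exchanges the ascending and descending occurrences of a middle label, which are told
apart by the parity of the index. -/
theorem even_neg_one_sub (y : ℤ) : Even (-1 - y) ↔ ¬ Even y := by
  rw [Int.even_sub]
  simp

theorem isPeriodicHeapA (l : ℕ) : IsPeriodicHeap (labelA l) := by
  refine isPeriodicHeap_of_shift (fun _ => 1) (M := l + 1) (by omega) fun p y => ?_
  simp only [rankA]
  ring

/-- Translation by one period raises the index by the number of occurrences of the label in a
period: one at the ends of the diagram, two in the middle. -/
theorem isPeriodicHeapC {l : ℕ} (hl : 1 < l) : IsPeriodicHeap (labelC l) := by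
  refine isPeriodicHeap_of_shift (fun p => if p = 0 ∨ p = l then 1 else 2) (M := 2 * l) (by omega)
    fun p y => ?_
  have : Even (y + 2) ↔ Even y := by simp
  by_cases h0 : p = 0
  · simp only [rankC, h0, true_or, if_true]
    ring
  by_cases h1 : p = l
  · simp only [rankC, h1, or_true, if_true]
    split_ifs <;> ring
  · simp only [rankC, h0, h1, or_self, if_false, this]
    split_ifs <;> ring

theorem isPeriodicHeapA2 {l : ℕ} (hl : 2 < l) : IsPeriodicHeap (labelA2 l) := by
  refine isPeriodicHeap_of_shift (fun p => if p = 0 ∨ p = 1 ∨ p = l then 1 else 2)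
    (M := 2 * (l - 1)) (by omega) fun p y => ?_
  have : Even (y + 2) ↔ Even y := by simp
  simp only [rankA2]
  split_ifs <;> first | omega | tauto | ring

theorem isPeriodicHeapD {l : ℕ} (hl : 3 < l) : IsPeriodicHeap (labelD l) := by
  refine isPeriodicHeap_of_shift (fun p => if p = 0 ∨ p = 1 ∨ p + 1 = l ∨ p = l then 1 else 2)
    (M := 2 * (l - 2)) (by omega) fun p y => ?_
  have : Even (y + 2) ↔ Even y := by simp
  simp only [rankD]
  split_ifs <;> first | omega | tauto | ring

theorem isSelfDualHeapC (l : ℕ) : IsSelfDualHeap (labelC l) := by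
  refine isSelfDualHeap_of_reflection (fun p => if p = 0 then 0 else -1) fun p y => ?_
  have := even_neg_one_sub y
  simp only [rankC]
  split_ifs <;> first | omega | tauto | ring

theorem isSelfDualHeapA2 (l : ℕ) : IsSelfDualHeap (labelA2 l) := by
  refine isSelfDualHeap_of_reflection (fun p => if p = 0 then -2 else if p = 1 then 0 else -1)
    fun p y => ?_
  have := even_neg_one_sub y
  simp only [rankA2]
  split_ifs <;> first | omega | tauto | ring

theorem isSelfDualHeapD (l : ℕ) : IsSelfDualHeap (labelD l) := by
  refine isSelfDualHeap_of_reflection (fun p => if p = 0 then -2 else if p = 1 then 0 else -1)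
    fun p y => ?_
  have := even_neg_one_sub y
  simp only [rankD]
  split_ifs <;> first | omega | tauto | ring

/-! ### The numbers of the principal ideals -/

section Numbers

variable {l : ℕ}

theorem numA_el {p : ℕ} (hp : p ≤ l) (y : ℤ) : numA (el p y : HeapA l) = zetaA l p y := by
  rw [numA, HeapElt.el_label hp, HeapElt.el_index]

theorem numC_el {p : ℕ} (hp : p ≤ l) (y : ℤ) : numC (el p y : HeapC l) = zetaC l p y := by
  rw [numC, HeapElt.el_label hp, HeapElt.el_index]

theorem numA2_el {p : ℕ} (hp : p ≤ l) (y : ℤ) : numA2 (el p y : HeapA2 l) = zetaA2 l p y := by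
  rw [numA2, HeapElt.el_label hp, HeapElt.el_index]

theorem numD_el {p : ℕ} (hp : p ≤ l) (y : ℤ) : numD (el p y : HeapD l) = zetaD l p y := by
  rw [numD, HeapElt.el_label hp, HeapElt.el_index]

theorem numA2_el_zero (y : ℤ) : numA2 (el 0 y : HeapA2 l) = 2 * l * (y + 1) := by
  rw [numA2_el (by omega)]; rfl

theorem numA2_el_one (hl : 2 < l) (y : ℤ) : numA2 (el 1 y : HeapA2 l) = 2 * l * y + 1 := by
  rw [numA2_el (by omega)]; rfl

theorem numD_el_zero (y : ℤ) : numD (el 0 y : HeapD l) = 2 * l * (y + 1) := by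
  rw [numD_el (by omega)]; rfl

theorem numD_el_one (hl : 3 < l) (y : ℤ) : numD (el 1 y : HeapD l) = 2 * l * y + 1 := by
  rw [numD_el (by omega)]; simp [zetaD]

theorem numD_el_last (hl : 3 < l) (y : ℤ) : numD (el l y : HeapD l) = 2 * l * y + l + 1 := by
  rw [numD_el (by omega), zetaD, if_neg (by omega), if_neg (by omega), if_pos (Or.inr rfl)]

theorem numD_el_penultimate (hl : 3 < l) (y : ℤ) :
    numD (el (l - 1) y : HeapD l) = 2 * l * y + l := by
  rw [numD_el (by omega), zetaD, if_neg (by omega), if_neg (by omega), if_pos (by omega)]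
  push_cast [show 1 ≤ l by omega]
  ring

theorem topA2_two (k : ℤ) : TopA2 l (2 * l * k + 2) := by
  simp [TopA2]

theorem topD_two (k : ℤ) : TopD l (2 * l * k + 2) := by
  simp [TopD]

theorem topD_add_two (k : ℤ) : TopD l (2 * l * k + l + 2) := by
  right
  rw [add_assoc, mul_add_modEq]

theorem pairA2_eq_cut (hl : 2 < l) (y : ℤ) :
    Set.Iic (el 0 (y - 1) : HeapA2 l) ∪ Set.Iic (el 1 y) =
      cut (TopA2 l) numA2 (2 * l * y + 2) :=
  ((isSignedModelA2 hl).isLinearModel.cut_of_top (topA2_two y)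
    (by rw [numA2_el_zero]; ring) (by rw [numA2_el_one hl]; ring)).symm

theorem pairD_eq_cut (hl : 3 < l) (y : ℤ) :
    Set.Iic (el 0 (y - 1) : HeapD l) ∪ Set.Iic (el 1 y) =
      cut (TopD l) numD (2 * l * y + 2) :=
  ((isSignedModelD hl).isLinearModel.cut_of_top (topD_two y)
    (by rw [numD_el_zero]; ring) (by rw [numD_el_one hl]; ring)).symm

theorem pairD_last_eq_cut (hl : 3 < l) (y : ℤ) :
    Set.Iic (el (l - 1) y : HeapD l) ∪ Set.Iic (el l y) =
      cut (TopD l) numD (2 * l * y + l + 2) :=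
  ((isSignedModelD hl).isLinearModel.cut_of_top (topD_add_two y)
    (by rw [numD_el_penultimate hl]; ring) (by rw [numD_el_last hl]; ring)).symm

theorem stipA2_cut_iff (hl : 2 < l) (z w : ℤ) :
    stipA2 l (cut (TopA2 l) numA2 z) (cut (TopA2 l) numA2 w) ↔ w = z + 1 ∧ TopA2 l (w + 1) := by
  simp only [stipA2, (isSignedModelA2 hl).isLinearModel.Iic_eq_cut_iff, numA2_el_zero,
    numA2_el_one hl]
  constructor
  · rintro ⟨y, rfl, rfl⟩
    exact ⟨rfl, by rw [add_assoc]; exact topA2_two _⟩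
  · rintro ⟨rfl, hw⟩
    obtain ⟨k, hk⟩ := exists_of_modEq hw
    -- The skipped number `2lk + 2` comes right after `0(k-1)` and `1(k)`.
    exact ⟨k - 1, by rw [sub_add_cancel]; omega, by rw [sub_add_cancel]; omega⟩

theorem stipD_cut_iff (hl : 3 < l) (z w : ℤ) :
    stipD l (cut (TopD l) numD z) (cut (TopD l) numD w) ↔ w = z + 1 ∧ TopD l (w + 1) := by
  simp only [stipD, (isSignedModelD hl).isLinearModel.Iic_eq_cut_iff, numD_el_zero,
    numD_el_one hl, numD_el_last hl, numD_el_penultimate hl]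
  constructor
  · rintro ⟨y, ⟨rfl, rfl⟩ | ⟨rfl, rfl⟩⟩
    · exact ⟨rfl, by rw [add_assoc]; exact topD_two _⟩
    · exact ⟨rfl, by rw [add_assoc _ 1 1]; exact topD_add_two _⟩
  · rintro ⟨rfl, hw | hw⟩
    · obtain ⟨k, hk⟩ := exists_of_modEq hw
      exact ⟨k - 1, Or.inl ⟨by rw [sub_add_cancel]; omega, by rw [sub_add_cancel]; omega⟩⟩
    · obtain ⟨k, hk⟩ := exists_of_modEq hw
      exact ⟨k, Or.inr ⟨by omega, by omega⟩⟩

theorem isProperIdealA2_iff (hl : 2 < l) (I : Set (HeapA2 l)) : IsProperIdeal (labelA2 l) I ↔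
    (∃ x, I = Set.Iic x) ∨ ∃ y : ℤ, I = Set.Iic (el 0 y) ∪ Set.Iic (el 1 (y + 1)) := by
  have h := (isSignedModelA2 hl).isLinearModel
  constructor
  · intro hI
    refine (h.exists_Iic_or_top hI).imp id ?_
    rintro ⟨z, hz, rfl⟩
    obtain ⟨k, rfl⟩ := exists_of_modEq hz
    exact ⟨k - 1, by rw [sub_add_cancel, pairA2_eq_cut hl]⟩
  · rintro (⟨x, rfl⟩ | ⟨y, rfl⟩)
    · exact h.isProperIdeal_Iic x
    · have := pairA2_eq_cut hl (y + 1)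
      rw [add_sub_cancel_right] at this
      rw [this]
      exact h.isProperIdeal_cut _

theorem isProperIdealD_iff (hl : 3 < l) (I : Set (HeapD l)) : IsProperIdeal (labelD l) I ↔
    (∃ x, I = Set.Iic x) ∨ (∃ y : ℤ, I = Set.Iic (el 0 y) ∪ Set.Iic (el 1 (y + 1))) ∨
      ∃ y : ℤ, I = Set.Iic (el (l - 1) y) ∪ Set.Iic (el l y) := by
  have h := (isSignedModelD hl).isLinearModel
  constructor
  · intro hI
    refine (h.exists_Iic_or_top hI).imp id ?_
    rintro ⟨z, hz | hz, rfl⟩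
    · obtain ⟨k, rfl⟩ := exists_of_modEq hz
      exact Or.inl ⟨k - 1, by rw [sub_add_cancel, pairD_eq_cut hl]⟩
    · obtain ⟨k, rfl⟩ := exists_of_modEq hz
      exact Or.inr ⟨k, by rw [pairD_last_eq_cut hl, add_assoc]⟩
  · rintro (⟨x, rfl⟩ | ⟨y, rfl⟩ | ⟨y, rfl⟩)
    · exact h.isProperIdeal_Iic x
    · have := pairD_eq_cut hl (y + 1)
      rw [add_sub_cancel_right] at this
      rw [this]
      exact h.isProperIdeal_cut _
    · rw [pairD_last_eq_cut hl]
      exact h.isProperIdeal_cut _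

end Numbers

theorem mainTheorem12 :
    -- type `A_l^(1)`
    (∀ l : ℕ, 1 < l →
      IsFullHeap (cartanA l) (labelA l) ∧ IsPeriodicHeap (labelA l) ∧
      (∀ I : Set (HeapA l), IsProperIdeal (labelA l) I ↔ ∃ x, I = Set.Iic x) ∧
      ∃ ζ : ProperIdeal (labelA l) ≃ ℤ,
        (∀ I J, I ≤ J ↔ ζ I ≤ ζ J) ∧
        (∀ (I : ProperIdeal (labelA l)) (p : ℕ) (y : ℤ), p ≤ l →
          I.1 = Set.Iic (el p y) → ζ I = zetaA l p y) ∧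
        RealizesWeylGroup (cartanA l) (labelA l) ζ (l + 1) (stepA l)) ∧
    -- type `C_l^(1)`
    (∀ l : ℕ, 1 < l →
      IsFullHeap (cartanC l) (labelC l) ∧ IsPeriodicHeap (labelC l) ∧ IsSelfDualHeap (labelC l) ∧
      (∀ I : Set (HeapC l), IsProperIdeal (labelC l) I ↔ ∃ x, I = Set.Iic x) ∧
      ∃ ζ : ProperIdeal (labelC l) ≃ ℤ,
        (∀ I J, I ≤ J ↔ ζ I ≤ ζ J) ∧
        (∀ (I : ProperIdeal (labelC l)) (p : ℕ) (y : ℤ), p ≤ l →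
          I.1 = Set.Iic (el p y) → ζ I = zetaC l p y) ∧
        RealizesWeylGroup (cartanC l) (labelC l) ζ (2 * l) (stepC l)) ∧
    -- type `A_{2l-1}^(2)`
    (∀ l : ℕ, 2 < l →
      IsFullHeap (cartanA2 l) (labelA2 l) ∧ IsPeriodicHeap (labelA2 l) ∧
      IsSelfDualHeap (labelA2 l) ∧
      (∀ I : Set (HeapA2 l), IsProperIdeal (labelA2 l) I ↔
        (∃ x, I = Set.Iic x) ∨ ∃ y : ℤ, I = Set.Iic (el 0 y) ∪ Set.Iic (el 1 (y + 1))) ∧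
      (∀ (x : HeapA2 l) (y : ℤ), Set.Iic (el 0 y) ∪ Set.Iic (el 1 (y + 1)) ≠ Set.Iic x) ∧
      ∃ ζ : ProperIdeal (labelA2 l) ≃ ℤ,
        (∀ I J, RefinedLE (labelA2 l) (stipA2 l) I J ↔ ζ I ≤ ζ J) ∧
        (∀ (I : ProperIdeal (labelA2 l)) (y : ℤ),
          I.1 = Set.Iic (el 0 (y - 1)) ∪ Set.Iic (el 1 y) → ζ I = 2 * l * y + 2) ∧
        (∀ (I : ProperIdeal (labelA2 l)) (p : ℕ) (y : ℤ), p ≤ l →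
          I.1 = Set.Iic (el p y) → ζ I = zetaA2 l p y) ∧
        RealizesWeylGroup (cartanA2 l) (labelA2 l) ζ (2 * l) (stepA2 l)) ∧
    -- type `D_l^(1)`
    (∀ l : ℕ, 3 < l →
      IsFullHeap (cartanD l) (labelD l) ∧ IsPeriodicHeap (labelD l) ∧ IsSelfDualHeap (labelD l) ∧
      (∀ I : Set (HeapD l), IsProperIdeal (labelD l) I ↔
        (∃ x, I = Set.Iic x) ∨ (∃ y : ℤ, I = Set.Iic (el 0 y) ∪ Set.Iic (el 1 (y + 1))) ∨
        ∃ y : ℤ, I = Set.Iic (el (l - 1) y) ∪ Set.Iic (el l y)) ∧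
      (∀ (x : HeapD l) (y : ℤ), Set.Iic (el 0 y) ∪ Set.Iic (el 1 (y + 1)) ≠ Set.Iic x) ∧
      (∀ (x : HeapD l) (y : ℤ), Set.Iic (el (l - 1) y) ∪ Set.Iic (el l y) ≠ Set.Iic x) ∧
      (∃ I J : ProperIdeal (labelD l), ¬ I ≤ J ∧ ¬ J ≤ I) ∧
      ∃ ζ : ProperIdeal (labelD l) ≃ ℤ,
        (∀ I J, RefinedLE (labelD l) (stipD l) I J ↔ ζ I ≤ ζ J) ∧
        (∀ (I : ProperIdeal (labelD l)) (y : ℤ),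
          I.1 = Set.Iic (el 0 (y - 1)) ∪ Set.Iic (el 1 y) → ζ I = 2 * l * y + 2) ∧
        (∀ (I : ProperIdeal (labelD l)) (y : ℤ),
          I.1 = Set.Iic (el (l - 1) y) ∪ Set.Iic (el l y) → ζ I = 2 * l * y + l + 2) ∧
        (∀ (I : ProperIdeal (labelD l)) (p : ℕ) (y : ℤ), p ≤ l →
          I.1 = Set.Iic (el p y) → ζ I = zetaD l p y) ∧
        RealizesWeylGroup (cartanD l) (labelD l) ζ (2 * l) (stepD l)) := by

  refine ⟨fun l hl => ?_, fun l hl => ?_, fun l hl => ?_, fun l hl => ?_⟩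
  · have h := isLinearModelA hl
    refine ⟨h.isFullHeap, isPeriodicHeapA l, fun I => ⟨fun hI => ?_, ?_⟩, h.zeta,
      h.le_iff_zeta_le fun _ => id, fun I p y hp hI => ?_,
      h.realizesWeylGroup (isReflectionModelA hl) fun f z hf => hf.1 z⟩
    · exact (h.exists_Iic_or_top hI).resolve_right fun ⟨_, hz, _⟩ => hz
    · rintro ⟨x, rfl⟩
      exact h.isProperIdeal_Iic x
    · rw [h.zeta_of_Iic hI, numA_el hp]
  · have h := (isSignedModelC hl).isLinearModel
    refine ⟨h.isFullHeap, isPeriodicHeapC hl, isSelfDualHeapC l, fun I => ⟨fun hI => ?_, ?_⟩,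
      h.zeta, h.le_iff_zeta_le fun _ => id, fun I p y hp hI => ?_,
      (isSignedModelC hl).realizesWeylGroup⟩
    · exact (h.exists_Iic_or_top hI).resolve_right fun ⟨_, hz, _⟩ => hz
    · rintro ⟨x, rfl⟩
      exact h.isProperIdeal_Iic x
    · rw [h.zeta_of_Iic hI, numC_el hp]
  · have h := (isSignedModelA2 hl).isLinearModel
    refine ⟨h.isFullHeap, isPeriodicHeapA2 hl, isSelfDualHeapA2 l, isProperIdealA2_iff hl,
      fun x y => ?_, h.zeta, h.refinedLE_iff (stipA2_cut_iff hl), fun I y hI => ?_,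
      fun I p y hp hI => ?_, (isSignedModelA2 hl).realizesWeylGroup⟩
    · have := pairA2_eq_cut hl (y + 1)
      rw [add_sub_cancel_right] at this
      rw [this]
      exact h.cut_ne_Iic (topA2_two _) x
    · rw [h.zeta_eq_iff, hI, pairA2_eq_cut hl]
    · rw [h.zeta_of_Iic hI, numA2_el hp]
  · have h := (isSignedModelD hl).isLinearModel
    refine ⟨h.isFullHeap, isPeriodicHeapD hl, isSelfDualHeapD l, isProperIdealD_iff hl,
      fun x y => ?_, fun x y => ?_, h.exists_incomparable (topD_two 0), h.zeta,
      h.refinedLE_iff (stipD_cut_iff hl), fun I y hI => ?_, fun I y hI => ?_,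
      fun I p y hp hI => ?_, (isSignedModelD hl).realizesWeylGroup⟩
    · have := pairD_eq_cut hl (y + 1)
      rw [add_sub_cancel_right] at this
      rw [this]
      exact h.cut_ne_Iic (topD_two _) x
    · rw [pairD_last_eq_cut hl]
      exact h.cut_ne_Iic (topD_add_two _) x
    · rw [h.zeta_eq_iff, hI, pairD_eq_cut hl]
    · rw [h.zeta_eq_iff, hI, pairD_last_eq_cut hl]
    · rw [h.zeta_of_Iic hI, numD_el hp]
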